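/- Let $F$ be a non-Archimedean local field with ring of integers $\mathcal O$, residue field of order $q$ and normalized absolute value $|\cdot|$ (so $|\varpi|=q^{-1}$ for a uniformizer $\varpi$). Let $E$ be a field of characteristic $0$ and $n\ge 2$ an integer. Equip $F$ with the Haar measure for which $\mathcal O$ has measure $1$, and $F^n$ with the product measure. Put $\|x\|=\max_i|x_i|$ and $\xi\cdot x=\sum_i\xi_ix_i$ on $F^n$. Let $\mathcal C$ be the $E$-vector space of locally constant functions $F^n\setminus\{0\}\to E$ whose translates under $K=GL_n(\mathcal O)$ span a finite-dimensional space; let $\mathcal C_+\subset\mathcal C$ be the subspace of functions with bounded support, and $\mathcal C_-\subset\mathcal C$ the subspace of functions vanishing on $\{0<\|\xi\|<\varepsilon\}$ for some $\varepsilon>0$. For $f\in\mathcal C_+$ and $\xi\in F^n\setminus\{0\}$ put $$Mf(\xi)=\int_{\xi\cdot x=1}f(x)\,d\mu_\xi(x),$$ where $\mu_\xi$ is the measure on the hyperplanes $\xi\cdot x=t$ with $d\mu_\xi\,dt=dx$. (Haar measures take rational values on compact open sets, so integrals of $E$-valued locally constant compactly supported functions are defined in $E$.) Let $\beta$ be the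 $E$-valued distribution on $F$ $$\beta=\frac{1-q^{n-1}}{1-q^{-n}}\left(|s-1|^{-n}-|s|^{-n}\right),$$ where for a locally constant compactly supported $f$ one sets $\langle |s|^{-n},f\rangle=\int_F|s|^{-n}(f(s)-f(0))\,ds$ (a rational number when $f$ is the indicator function of a compact open set, extended $E$-linearly to all $E$-valued $f$), and $\langle |s-1|^{-n},f\rangle=\langle|s|^{-n},f(\cdot+1)\rangle$. For $\varphi\in\mathcal C_-$, $x\in F^n\setminus\{0\}$ and an open compact subgroup $\Lambda\subset F^n$ let $$I_{\varphi,x}(\Lambda)=\int_\Lambda\beta(\xi\cdot x)\varphi(\xi)\,d\xi:=\Big\langle\beta,\ s\mapsto\int_{\xi\cdot x=s}\varphi(\xi)1_\Lambda(\xi)\,d\mu_x(\xi)\Big\rangle ,$$ with $\varphi$ extended by $0$ to the origin. Then $\beta$ is a well-defined linear functional on the locally constant compactly supported functions $F\to E$; it has compact support and satisfies $\langle\beta,1\rangle=0$. For all $\varphi\in\mathcal C_-$ and $x\in F^n\setminus\{0\}$ there is an open compact subgroup $\Lambda\subset F^n$ such that $I_{\varphi,x}(\Lambda')=I_{\varphi,x}(\Lambda)$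 for every open compact subgroup $\Lambda'\supset\Lambda$; denote this common value by $(A_\beta\varphi)(x)$. The Radon transform $M$ is an isomorphism of $E$-vector spaces $\mathcal C_+\to\mathcal C_-$, and its inverse is $\varphi\mapsto A_\beta\varphi$. -/

import Mathlib

open MeasureTheory ValuativeRel
open scoped NNReal ENNReal Matrix

noncomputable section

namespace RadonLocal

/-! ### The local field: absolute value, norm, Haar measures -/

section Field

variable (F : Type*) [Field F] [ValuativeRel F] [TopologicalSpace F] [IsNonarchimedeanLocalField F]

/-- The order `q` of the residue field. -/
def resCard : ℕ := Nat.card 𝓀[F]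

lemma one_lt_resCard : 1 < resCard F := Finite.one_lt_card

lemma resCard_ne_zero : (resCard F : ℝ≥0) ≠ 0 := by
  have := one_lt_resCard F
  exact_mod_cast (by omega : resCard F ≠ 0)

variable {F}

/-- The normalized absolute value of `F`: it is `q⁻¹` on uniformizers. -/
def absV (a : F) : ℝ≥0 :=
  WithZeroMulInt.toNNReal (resCard_ne_zero F)
    (IsNonarchimedeanLocalField.valueGroupWithZeroIsoInt F (valuation F a))

/-- The norm on `F ^ n`: the maximum of the absolute values of the coordinates. -/
def vnorm {n : ℕ} (x : Fin n → F) : ℝ≥0 := Finset.univ.sup fun i => absV (x i)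

/-- `v(x) = - log_q ‖x‖` (used only for `x ≠ 0`). -/
def vval {n : ℕ} (x : Fin n → F) : ℝ := -Real.logb (resCard F) (vnorm x)

variable (F)

instance secondCountable : SecondCountableTopology F := by
  let := IsTopologicalAddGroup.rightUniformSpace F
  have := isUniformAddGroup_of_addCommGroup (G := F)
  let : (Valued.v (R := F)).RankOne :=
  { hom' := IsRankLeOne.nonempty.some.emb (R := F).comp MonoidWithZeroHom.ValueGroup₀.embedding
    strictMono' := IsRankLeOne.nonempty.some.strictMono.comp
        MonoidWithZeroHom.ValueGroup₀.embedding_strictMono }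
  open scoped Valued in
  have : ProperSpace F := .of_nontriviallyNormedField_of_weaklyLocallyCompactSpace F
  open scoped Valued in
  exact secondCountable_of_proper

instance t2Space : T2Space F := by
  let := IsTopologicalAddGroup.rightUniformSpace F
  have := isUniformAddGroup_of_addCommGroup (G := F)
  have : T0Space F := ValuedRing.separated
  infer_instance

lemma isOpen_integers : IsOpen (𝒪[F] : Set F) := by
  let := IsTopologicalAddGroup.rightUniformSpace F
  have := isUniformAddGroup_of_addCommGroup (G := F)
  exact Valued.isOpen_integer F

/-- The compact open set `𝒪 ⊆ F`. -/
def integerCompacts : TopologicalSpace.PositiveCompacts F where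
  carrier := (𝒪[F] : Set F)
  isCompact' := IsNonarchimedeanLocalField.isCompact_closedBall F 1
  interior_nonempty' := by
    rw [(isOpen_integers F).interior_eq]
    exact ⟨0, zero_mem _⟩

variable [MeasurableSpace F] [BorelSpace F]

/-- The Haar measure on `F` with `mes(𝒪) = 1`. -/
def haarF : Measure F := Measure.addHaarMeasure (integerCompacts F)

instance : (haarF F).IsAddHaarMeasure := by unfold haarF; infer_instance
instance : SigmaFinite (haarF F) := by unfold haarF; infer_instance

/-- The product Haar measure on `F ^ n`. -/
def haarV (n : ℕ) : Measure (Fin n → F) := Measure.pi fun _ => haarF F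

instance (n : ℕ) : (haarV F n).IsAddHaarMeasure := by unfold haarV; infer_instance
instance (n : ℕ) : SigmaFinite (haarV F n) := by unfold haarV; infer_instance

end Field

/-! ### Integration with values in a field of characteristic zero -/

/-- A rational real number, as a rational number (and `0` for an irrational number). -/
def ratOf (r : ℝ) : ℚ := by
  classical exact if h : ∃ a : ℚ, (a : ℝ) = r then h.choose else 0

lemma ratOf_cast (a : ℚ) : ratOf (a : ℝ) = a := by
  have h : ∃ b : ℚ, (b : ℝ) = (a : ℝ) := ⟨a, rfl⟩
  unfold ratOf
  rw [dif_pos h]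
  exact_mod_cast h.choose_spec

/-- The integral `∑ₑ e · μ(g = e)` of a function `g` with values in a field `E` of characteristic
zero, where `μ` is supported on a set on which `g` takes finitely many values and the non-zero level
sets of `g` have rational measure. This applies to functions that are locally constant of compact
support on the support of `μ` and to the Haar measures used here, whose values on compact open sets
lie in `ℤ[1/q]`. -/
def eInt {X : Type*} [MeasurableSpace X] {E : Type*} [Field E] (μ : Measure X) (g : X → E) : E :=
  ∑ᶠ e : E, (ratOf (μ.real (g ⁻¹' {e})) : E) * e

/-! ### Function spaces -/

/-- `F ^ n` minus the origin. -/
abbrev Punctured (F : Type*) [Field F] (n : ℕ) : Type _ := {x : Fin n → F // x ≠ 0}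

section Spaces

variable (F : Type*) [Field F] [ValuativeRel F] [TopologicalSpace F] [IsNonarchimedeanLocalField F]
variable (n : ℕ) (E : Type*) [Field E]

variable {F n} in
/-- The action of `K = GL_n(𝒪)` on `F ^ n ∖ {0}`. -/
def kAct (k : GL (Fin n) 𝒪[F]) (x : Punctured F n) : Punctured F n :=
  ⟨(k.1.map ((↑) : 𝒪[F] → F)) *ᵥ x.1, fun h => x.2 <| by
    have h1 : (k⁻¹).1.map ((↑) : 𝒪[F] → F) * k.1.map ((↑) : 𝒪[F] → F) = 1 := by
      have h2 : (k⁻¹).1 * k.1 = 1 := k.inv_mul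
      have h3 := congrArg (fun A => A.map (𝒪[F]).subtype) h2
      rwa [Matrix.map_mul, Matrix.map_one _ (map_zero _) (map_one _)] at h3
    calc x.1 = ((k⁻¹).1.map ((↑) : 𝒪[F] → F) * k.1.map ((↑) : 𝒪[F] → F)) *ᵥ x.1 := by
          rw [h1, Matrix.one_mulVec]
      _ = 0 := by rw [← Matrix.mulVec_mulVec, h, Matrix.mulVec_zero]⟩

variable {F n E} in
/-- The left translate `(k • φ)(x) = φ(k⁻¹ x)`. -/
def translate (k : GL (Fin n) 𝒪[F]) (φ : Punctured F n → E) : Punctured F n → E :=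
  fun x => φ (kAct k⁻¹ x)

variable {F n E} in
/-- `φ` is `K`-finite: its `K`-translates span a finite-dimensional space. -/
def KFinite (φ : Punctured F n → E) : Prop :=
  FiniteDimensional E
    (Submodule.span E (Set.range fun k : GL (Fin n) 𝒪[F] => translate k φ))

/-- The space `C` of `K`-finite locally constant functions on `F ^ n ∖ {0}`. -/
def spaceC : Submodule E (Punctured F n → E) where
  carrier := {φ | IsLocallyConstant φ ∧ KFinite φ}
  zero_mem' := by
    refine ⟨IsLocallyConstant.const 0, ?_⟩
    have : (Set.range fun k : GL (Fin n) 𝒪[F] => translate k (0 : Punctured F n → E)) ⊆ {0} := by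
      rintro _ ⟨k, rfl⟩; rfl
    exact Submodule.finiteDimensional_of_le
      (S₂ := Submodule.span E {(0 : Punctured F n → E)}) (Submodule.span_mono this)
  add_mem' := by
    rintro φ ψ ⟨h1, h2⟩ ⟨h3, h4⟩
    refine ⟨h1.add h3, ?_⟩
    unfold KFinite at *
    refine Submodule.finiteDimensional_of_le (S₂ :=
      Submodule.span E (Set.range fun k : GL (Fin n) 𝒪[F] => translate k φ) ⊔
      Submodule.span E (Set.range fun k : GL (Fin n) 𝒪[F] => translate k ψ)) ?_
    rw [Submodule.span_le]
    rintro _ ⟨k, rfl⟩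
    exact Submodule.add_mem_sup (Submodule.subset_span ⟨k, rfl⟩) (Submodule.subset_span ⟨k, rfl⟩)
  smul_mem' := by
    rintro c φ ⟨h1, h2⟩
    refine ⟨h1.comp (c • ·), ?_⟩
    unfold KFinite at *
    refine Submodule.finiteDimensional_of_le (S₂ :=
      Submodule.span E (Set.range fun k : GL (Fin n) 𝒪[F] => translate k φ)) ?_
    rw [Submodule.span_le]
    rintro _ ⟨k, rfl⟩
    exact Submodule.smul_mem _ c (Submodule.subset_span ⟨k, rfl⟩)

/-- The space `C₊ = ⋃_R C_{≥ R}` of functions in `C` with bounded support. -/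
def Cplus : Submodule E (Punctured F n → E) where
  carrier := {φ | φ ∈ spaceC F n E ∧ ∃ R : ℝ, ∀ x, φ x ≠ 0 → R ≤ vval x.1}
  zero_mem' := ⟨zero_mem _, 0, fun x h => absurd rfl h⟩
  add_mem' := by
    rintro φ ψ ⟨h1, R, hR⟩ ⟨h2, S, hS⟩
    refine ⟨add_mem h1 h2, min R S, fun x hx => ?_⟩
    by_cases h : φ x = 0
    · exact (min_le_right _ _).trans (hS x fun h' => hx (by simp [h, h']))
    · exact (min_le_left _ _).trans (hR x h)
  smul_mem' := by
    rintro c φ ⟨h1, R, hR⟩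
    exact ⟨Submodule.smul_mem _ c h1, R, fun x hx => hR x fun h => hx (by simp [h])⟩

/-- The space `C₋ = ⋃_R C_{≤ R}` of functions in `C` supported away from a neighborhood of `0`. -/
def Cminus : Submodule E (Punctured F n → E) where
  carrier := {φ | φ ∈ spaceC F n E ∧ ∃ R : ℝ, ∀ x, φ x ≠ 0 → vval x.1 ≤ R}
  zero_mem' := ⟨zero_mem _, 0, fun x h => absurd rfl h⟩
  add_mem' := by
    rintro φ ψ ⟨h1, R, hR⟩ ⟨h2, S, hS⟩
    refine ⟨add_mem h1 h2, max R S, fun x hx => ?_⟩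
    by_cases h : φ x = 0
    · exact (hS x fun h' => hx (by simp [h, h'])).trans (le_max_right _ _)
    · exact (hR x h).trans (le_max_left _ _)
  smul_mem' := by
    rintro c φ ⟨h1, R, hR⟩
    exact ⟨Submodule.smul_mem _ c h1, R, fun x hx => hR x fun h => hx (by simp [h])⟩

variable {F n E} in
/-- Extension of a function on `F ^ n ∖ {0}` by zero. -/
def extZero (φ : Punctured F n → E) (x : Fin n → F) : E := by
  classical exact if h : x ≠ 0 then φ ⟨x, h⟩ else 0

end Spaces

/-- The space of test functions: locally constant functions of compact support. -/
def schwartz (X : Type*) [TopologicalSpace X] (E : Type*) [Field E] : Submodule E (X → E) where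
  carrier := {f | IsLocallyConstant f ∧ IsCompact (Function.support f)}
  zero_mem' := ⟨IsLocallyConstant.const 0, by simp⟩
  add_mem' := by
    rintro f g ⟨h1, h2⟩ ⟨h3, h4⟩
    refine ⟨h1.add h3, (h2.union h4).of_isClosed_subset ?_ (Function.support_add f g)⟩
    exact ((h1.add h3).isOpen_fiber 0).isClosed_compl
  smul_mem' := by
    rintro c f ⟨h1, h2⟩
    refine ⟨h1.comp (c • ·), h2.of_isClosed_subset ?_ (Function.support_const_smul_subset c f)⟩
    exact ((h1.comp (c • ·)).isOpen_fiber 0).isClosed_compl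

/-- `E`-valued distributions: arbitrary linear functionals on the space of test functions. -/
abbrev Distribution (X : Type*) [TopologicalSpace X] (E : Type*) [Field E] : Type _ :=
  schwartz X E →ₗ[E] E

/-! ### Hyperplanes and the Radon transform -/

section Radon

variable {F : Type*} [Field F] [ValuativeRel F] [TopologicalSpace F] [IsNonarchimedeanLocalField F]
variable {n : ℕ} {E : Type*} [Field E]

lemma exists_dual (ξ : Punctured F n) : ∃ x₀ : Fin n → F, ξ.1 ⬝ᵥ x₀ = 1 := by
  obtain ⟨i, hi⟩ := Function.ne_iff.mp ξ.2
  exact ⟨Pi.single i (ξ.1 i)⁻¹, by simpa using mul_inv_cancel₀ hi⟩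

/-- A vector `x₀` with `ξ · x₀ = 1`. -/
def dualVec (ξ : Punctured F n) : Fin n → F := (exists_dual ξ).choose

lemma dualVec_spec (ξ : Punctured F n) : ξ.1 ⬝ᵥ dualVec ξ = 1 := (exists_dual ξ).choose_spec

/-- The projection of `F ^ n` onto the hyperplane `ξ · x = t` along `dualVec ξ`. -/
def hyperProj (ξ : Punctured F n) (t : F) (x : Fin n → F) : Fin n → F :=
  x - (ξ.1 ⬝ᵥ x - t) • dualVec ξ

lemma dot_hyperProj (ξ : Punctured F n) (t : F) (x : Fin n → F) :
    ξ.1 ⬝ᵥ hyperProj ξ t x = t := by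
  simp [hyperProj, dotProduct_sub, dotProduct_smul, dualVec_spec]

lemma continuous_dot (ξ : Punctured F n) : Continuous fun x : Fin n → F => ξ.1 ⬝ᵥ x := by
  unfold dotProduct
  fun_prop

lemma continuous_hyperProj (ξ : Punctured F n) (t : F) : Continuous (hyperProj ξ t) := by
  have := continuous_dot ξ
  unfold hyperProj
  fun_prop

variable [MeasurableSpace F] [BorelSpace F]

/-- The measure `μ_ξ` on the hyperplane `ξ · x = t` (as a measure on `F ^ n`) with `dμ_ξ dt = dx`:
the image, under the projection onto the hyperplane, of the Haar measure restricted to the slab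
`ξ · x ∈ t + 𝒪`, whose thickness `mes(𝒪)` is one. -/
def hyperMeasure (ξ : Punctured F n) (t : F) : Measure (Fin n → F) :=
  ((haarV F n).restrict {x | ξ.1 ⬝ᵥ x - t ∈ 𝒪[F]}).map (hyperProj ξ t)

/-- `μ_ξ` is concentrated on the hyperplane. -/
lemma hyperMeasure_concentrated (ξ : Punctured F n) (t : F) :
    hyperMeasure ξ t {x | ξ.1 ⬝ᵥ x ≠ t} = 0 := by
  have h1 : MeasurableSet {x : Fin n → F | ξ.1 ⬝ᵥ x ≠ t} :=
    (isOpen_ne_fun (continuous_dot ξ) continuous_const).measurableSet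
  rw [hyperMeasure, Measure.map_apply (continuous_hyperProj ξ t).measurable h1]
  simp [dot_hyperProj]

/-- The normalization `dμ_ξ dt = dx`. -/
lemma hyperMeasure_disintegration (ξ : Punctured F n) {A : Set (Fin n → F)}
    (hA : MeasurableSet A) :
    ∫⁻ t, hyperMeasure ξ t A ∂(haarF F) = haarV F n A := by
  have hcd : Continuous fun p : F × (Fin n → F) => ξ.1 ⬝ᵥ p.2 := (continuous_dot ξ).comp continuous_snd
  have hO : MeasurableSet (𝒪[F] : Set F) := (isOpen_integers F).measurableSet
  have h1 : ∀ t, hyperMeasure ξ t A = ∫⁻ x, (hyperProj ξ t ⁻¹' A ∩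
      {x | ξ.1 ⬝ᵥ x - t ∈ 𝒪[F]}).indicator 1 x ∂(haarV F n) := by
    intro t
    have hS : MeasurableSet {x : Fin n → F | ξ.1 ⬝ᵥ x - t ∈ 𝒪[F]} :=
      ((continuous_dot ξ).sub continuous_const).measurable hO
    have hB := (continuous_hyperProj ξ t).measurable hA
    rw [hyperMeasure, Measure.map_apply (continuous_hyperProj ξ t).measurable hA,
      Measure.restrict_apply hB, lintegral_indicator_one (hB.inter hS)]
  have h2 : ∀ x : Fin n → F, ∫⁻ t, (hyperProj ξ t ⁻¹' A ∩
      {x | ξ.1 ⬝ᵥ x - t ∈ 𝒪[F]}).indicator (1 : (Fin n → F) → ℝ≥0∞) x ∂(haarF F) =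
      ∫⁻ s, (𝒪[F] : Set F).indicator 1 s * A.indicator 1 (x - s • dualVec ξ) ∂(haarF F) := by
    intro x
    rw [← lintegral_sub_left_eq_self _ (ξ.1 ⬝ᵥ x)]
    refine lintegral_congr fun s => ?_
    by_cases h : s ∈ (𝒪[F] : Set F) <;> by_cases h' : x - s • dualVec ξ ∈ A <;>
      simp_all [hyperProj, Set.indicator]
  simp_rw [h1]
  rw [lintegral_lintegral_swap]
  · simp_rw [h2]
    rw [lintegral_lintegral_swap]
    · have h3 : ∀ s : F, ∫⁻ x, (𝒪[F] : Set F).indicator 1 s *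
          A.indicator (1 : (Fin n → F) → ℝ≥0∞) (x - s • dualVec ξ) ∂(haarV F n) =
          (𝒪[F] : Set F).indicator 1 s * haarV F n A := by
        intro s
        rw [lintegral_const_mul, lintegral_sub_right_eq_self (A.indicator 1), lintegral_indicator_one hA]
        exact (measurable_one.indicator hA).comp (by fun_prop)
      simp_rw [h3]
      rw [lintegral_mul_const _ (measurable_one.indicator hO), lintegral_indicator_one hO]
      have : haarF F (𝒪[F] : Set F) = 1 := Measure.addHaarMeasure_self (K₀ := integerCompacts F)
      rw [this, one_mul]
    · refine Measurable.aemeasurable ?_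
      refine ((measurable_one.indicator hO).comp measurable_snd).mul
        ((measurable_one.indicator hA).comp ?_)
      exact Continuous.measurable (by fun_prop)
  · refine Measurable.aemeasurable ?_
    have hm : MeasurableSet {p : F × (Fin n → F) | hyperProj ξ p.1 p.2 ∈ A ∧
        ξ.1 ⬝ᵥ p.2 - p.1 ∈ 𝒪[F]} := by
      refine MeasurableSet.inter ?_ ?_
      · refine Continuous.measurable (f := fun p : F × (Fin n → F) => hyperProj ξ p.1 p.2) ?_ hA
        unfold hyperProj
        fun_prop
      · exact Continuous.measurable (f := fun p : F × (Fin n → F) => ξ.1 ⬝ᵥ p.2 - p.1)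
          (by fun_prop) hO
    exact measurable_one.indicator hm

/-- The measures `μ_ξ` on parallel hyperplanes are translates of each other. -/
lemma hyperMeasure_add (ξ : Punctured F n) (t u : F) :
    hyperMeasure ξ (t + u) = (hyperMeasure ξ t).map (· + u • dualVec ξ) := by
  have hO : MeasurableSet (𝒪[F] : Set F) := (isOpen_integers F).measurableSet
  have hT : Measurable fun x : Fin n → F => x + u • dualVec ξ := by fun_prop
  ext A hA
  rw [hyperMeasure, hyperMeasure, Measure.map_apply (continuous_hyperProj ξ _).measurable hA,
    Measure.map_apply hT hA, Measure.map_apply (continuous_hyperProj ξ _).measurable (hT hA),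
    Measure.restrict_apply ((continuous_hyperProj ξ _).measurable hA),
    Measure.restrict_apply ((continuous_hyperProj ξ _).measurable (hT hA)),
    ← measure_preimage_add_right (haarV F n) (u • dualVec ξ)]
  congr 1
  have h1 : ∀ x : Fin n → F, ξ.1 ⬝ᵥ (x + u • dualVec ξ) - (t + u) = ξ.1 ⬝ᵥ x - t := by
    intro x
    rw [dotProduct_add, dotProduct_smul, dualVec_spec, smul_eq_mul, mul_one]
    ring
  have h2 : ∀ x : Fin n → F, hyperProj ξ (t + u) (x + u • dualVec ξ) =
      hyperProj ξ t x + u • dualVec ξ := by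
    intro x
    rw [hyperProj, h1, hyperProj]
    abel
  ext x
  simp only [Set.mem_inter_iff, Set.mem_preimage, Set.mem_ofPred_eq, h1, h2]

/-- The Radon transform `R f(ξ, t) = ∫_{ξ · x = t} f(x) dμ_ξ`. -/
def radon (f : (Fin n → F) → E) (ξ : Punctured F n) (t : F) : E :=
  eInt (hyperMeasure ξ t) f

/-- The operator `M f(ξ) = ∫_{ξ · x = 1} f(x) dμ_ξ`. -/
def opM (f : Punctured F n → E) (ξ : Punctured F n) : E := radon (extZero f) ξ 1

lemma exists_nhds_translation {X : Type*} [AddCommGroup X] [TopologicalSpace X]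
    [IsTopologicalAddGroup X] {h : X → E} (hh : h ∈ schwartz X E) :
    ∀ᶠ u in nhds (0 : X), ∀ y, h (y + u) = h y := by
  obtain ⟨h1, h2⟩ := hh
  have key : ∀ᶠ u in nhds (0 : X), ∀ y ∈ Function.support h, h (y + u) = h y := by
    refine h2.eventually_forall_of_forall_eventually fun y _ => ?_
    have e1 : ∀ᶠ p : X × X in nhds (y, (0 : X)), h (p.1 + p.2) = h y := by
      have : Filter.Tendsto (fun p : X × X => p.1 + p.2) (nhds (y, 0)) (nhds y) := by
        have := (continuous_fst.add continuous_snd : Continuous fun p : X × X => p.1 + p.2).tendsto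
          (y, 0)
        have h0 : nhds ((Prod.fst + Prod.snd : X × X → X) (y, 0)) = nhds y :=
          congrArg nhds (add_zero y)
        rw [h0] at this
        exact this
      exact this.eventually (h1.eventually_eq y)
    have e2 : ∀ᶠ p : X × X in nhds (y, (0 : X)), h p.1 = h y :=
      (continuous_fst.tendsto (y, (0 : X))).eventually (h1.eventually_eq y)
    have e3 : ∀ᶠ p : X × X in nhds (y, (0 : X)), h (p.1 + p.2) = h p.1 := by
      filter_upwards [e1, e2] with p hp hp' using hp.trans hp'.symm
    first | exact e3 | exact (continuous_swap.tendsto ((0 : X), y)).eventually e3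
  have key' : ∀ᶠ u in nhds (0 : X), ∀ y ∈ Function.support h, h (y + -u) = h y := by
    have : Filter.Tendsto (fun u : X => -u) (nhds 0) (nhds 0) := by
      simpa using (continuous_neg (G := X)).tendsto 0
    exact this.eventually key
  filter_upwards [key, key'] with u hu hu' y
  by_cases hy : h y = 0
  · by_contra hne
    have h3 : y + u ∈ Function.support h := by
      rw [hy] at hne
      exact hne
    have h4 := hu' _ h3
    rw [add_neg_cancel_right] at h4
    exact hne h4.symm
  · exact hu y hy

/-- The Radon transform of a test function is a test function of the second variable. -/
lemma radon_mem_schwartz {h : (Fin n → F) → E} (hh : h ∈ schwartz (Fin n → F) E)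
    (ξ : Punctured F n) : radon h ξ ∈ schwartz F E := by
  have hlc : IsLocallyConstant (radon h ξ) := by
    rw [IsLocallyConstant.iff_eventually_eq]
    intro t
    have h1 : Filter.Tendsto (fun t' : F => (t' - t) • dualVec ξ) (nhds t) (nhds 0) := by
      have : Continuous fun t' : F => (t' - t) • dualVec ξ := by fun_prop
      simpa using this.tendsto t
    filter_upwards [h1.eventually (exists_nhds_translation hh)] with t' ht'
    unfold radon eInt
    refine finsum_congr fun e => ?_
    have hm : MeasurableSet (h ⁻¹' {e}) := (hh.1.isOpen_fiber e).measurableSet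
    have h2 : (hyperMeasure ξ t').real (h ⁻¹' {e}) = (hyperMeasure ξ t).real (h ⁻¹' {e}) := by
      have h3 : t' = t + (t' - t) := by ring
      rw [measureReal_def, measureReal_def, h3, hyperMeasure_add, Measure.map_apply (by fun_prop) hm]
      congr 2
      ext y
      simp [ht' y]
    rw [h2]
  refine ⟨hlc, (hh.2.image (continuous_dot ξ)).of_isClosed_subset
    (hlc.isOpen_fiber 0).isClosed_compl fun t ht => ?_⟩
  by_contra hne
  refine ht ?_
  unfold radon eInt
  refine (finsum_congr fun e => ?_).trans finsum_zero
  by_cases he : e = 0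
  · simp [he]
  have h4 : hyperMeasure ξ t (h ⁻¹' {e}) = 0 := by
    refine measure_mono_null (fun y hy => ?_) (hyperMeasure_concentrated ξ t)
    intro h5
    refine hne ⟨y, ?_, h5⟩
    have : h y = e := hy
    simpa [this] using he
  have h6 : ratOf 0 = 0 := by simpa using ratOf_cast 0
  rw [measureReal_def, h4]
  simp [h6]

end Radon

/-! ### The operators `A_β` -/

section Abeta

variable (F : Type*) [Field F] [ValuativeRel F] [TopologicalSpace F] [IsNonarchimedeanLocalField F]
variable (n : ℕ) {E : Type*} [Field E]

/-- Open compact subgroups of `F ^ n`. -/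
abbrev Lattice : Type _ := {Λ : AddSubgroup (Fin n → F) //
  IsOpen (Λ : Set (Fin n → F)) ∧ IsCompact (Λ : Set (Fin n → F))}

variable {F n}

lemma absV_lt_mem_nhds {c : ℝ≥0} (hc : 0 < c) : {a : F | absV a < c} ∈ nhds (0 : F) := by
  have hq : (1 : ℝ≥0) < resCard F := by exact_mod_cast one_lt_resCard F
  obtain ⟨m, hm⟩ := exists_pow_lt_of_lt_one hc (inv_lt_one_of_one_lt₀ hq)
  obtain ⟨ϖ, hϖ⟩ : ∃ a : F, IsNonarchimedeanLocalField.valueGroupWithZeroIsoInt F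
      (valuation F a) = WithZero.exp (-(m : ℤ)) := by
    obtain ⟨a, ha⟩ := ValuativeRel.valuation_surjective
      ((IsNonarchimedeanLocalField.valueGroupWithZeroIsoInt F).symm (WithZero.exp (-(m : ℤ))))
    exact ⟨a, by rw [ha]; simp⟩
  have h0 : absV ϖ < c := by
    refine lt_of_eq_of_lt ?_ hm
    unfold absV
    rw [hϖ, WithZeroMulInt.toNNReal_neg_apply _ WithZero.exp_ne_zero]
    have h1 : WithZero.unzero (WithZero.exp_ne_zero (a := -(m : ℤ))) =
        Multiplicative.ofAdd (-(m : ℤ)) := rfl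
    rw [h1]
    simp
  have hne : valuation F ϖ ≠ 0 := by
    intro h
    rw [h, map_zero] at hϖ
    exact WithZero.exp_ne_zero hϖ.symm
  refine (IsValuativeTopology.mem_nhds_zero_iff _).mpr ⟨Units.mk0 _ hne, fun a ha => ?_⟩
  have ha' : valuation F a < valuation F ϖ := ha
  exact ((WithZeroMulInt.toNNReal_strictMono hq)
    ((IsNonarchimedeanLocalField.valueGroupWithZeroIsoInt F).strictMono ha')).trans h0

lemma extZero_isLocallyConstant (φ : Cminus F n E) : IsLocallyConstant (extZero φ.1) := by
  have hφ := φ.2.1.1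
  obtain ⟨R, hR⟩ := φ.2.2
  rw [IsLocallyConstant.iff_eventually_eq]
  intro x
  by_cases hx : x = 0
  · subst hx
    have hq : (1 : ℝ) < resCard F := by exact_mod_cast one_lt_resCard F
    set c : ℝ≥0 := ⟨(resCard F : ℝ) ^ (-R), by positivity⟩ with hc
    have hc0 : 0 < c := by
      rw [← NNReal.coe_pos]
      exact Real.rpow_pos_of_pos (by linarith) _
    have h1 : ∀ᶠ y : Fin n → F in nhds 0, ∀ i, absV (y i) < c := by
      rw [Filter.eventually_all]
      intro i
      exact ((continuous_apply i).tendsto (0 : Fin n → F)).eventually (absV_lt_mem_nhds hc0)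
    filter_upwards [h1] with y hy
    unfold extZero
    by_cases hy0 : y = 0
    · simp [hy0]
    · rw [dif_pos hy0, dif_neg (by simp)]
      by_contra hne
      have h2 := hR ⟨y, hy0⟩ hne
      have h3 : vnorm y < c := (Finset.sup_lt_iff hc0).mpr fun i _ => hy i
      have h4 : 0 < vnorm y := by
        obtain ⟨i, hi⟩ := Function.ne_iff.mp hy0
        refine lt_of_lt_of_le ?_ (Finset.le_sup (f := fun i => absV (y i)) (Finset.mem_univ i))
        exact WithZeroMulInt.toNNReal_pos _ (by simpa using hi)
      have h5 : Real.logb (resCard F) (vnorm y) < -R := by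
        rw [Real.logb_lt_iff_lt_rpow hq (by exact_mod_cast h4)]
        exact_mod_cast h3
      simp only [vval] at h2
      linarith
  · have hopen : IsOpen {y : Fin n → F | y ≠ 0} := isOpen_ne
    have h1 := hφ.eventually_eq (⟨x, hx⟩ : Punctured F n)
    rw [nhds_subtype_eq_comap, Filter.eventually_comap] at h1
    filter_upwards [h1, hopen.mem_nhds hx] with y hy hy0
    have hy0' : y ≠ 0 := hy0
    unfold extZero
    rw [dif_pos hy0', dif_pos hx]
    exact hy ⟨y, hy0'⟩ rfl

/-- For `φ ∈ C₋`, the function `φ · 1_Λ` (extended by zero at the origin) is a test function. -/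
lemma indicator_mem_schwartz (φ : Cminus F n E) (Λ : Lattice F n) :
    (Λ.1 : Set (Fin n → F)).indicator (extZero φ.1) ∈ schwartz (Fin n → F) E := by
  have hcl : IsClopen (Λ.1 : Set (Fin n → F)) := ⟨Λ.2.2.isClosed, Λ.2.1⟩
  have hlc : IsLocallyConstant ((Λ.1 : Set (Fin n → F)).indicator (extZero φ.1)) := by
    rw [IsLocallyConstant.iff_eventually_eq]
    intro x
    have h1 := (extZero_isLocallyConstant φ).eventually_eq x
    by_cases hx : x ∈ (Λ.1 : Set (Fin n → F))
    · filter_upwards [h1, hcl.isOpen.mem_nhds hx] with y hy hy'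
      rw [Set.indicator_of_mem hx, Set.indicator_of_mem hy', hy]
    · filter_upwards [hcl.compl.isOpen.mem_nhds hx] with y hy'
      rw [Set.indicator_of_notMem hx, Set.indicator_of_notMem hy']
  exact ⟨hlc, Λ.2.2.of_isClosed_subset (hlc.isOpen_fiber 0).isClosed_compl
    Set.support_indicator_subset⟩

variable [MeasurableSpace F] [BorelSpace F]

/-- `I(Λ) = ∫_Λ β(ξ · x) φ(ξ) dξ`: the value of the distribution `β` on the test function
`s ↦ ∫_{ξ · x = s} (φ 1_Λ)(ξ) dμ_x(ξ)`, the push-forward of `φ 1_Λ dξ` under `ξ ↦ ξ · x`. -/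
def partialA (β : Distribution F E) (φ : Cminus F n E) (x : Punctured F n) (Λ : Lattice F n) : E :=
  β ⟨radon ((Λ.1 : Set (Fin n → F)).indicator (extZero φ.1)) x,
    radon_mem_schwartz (indicator_mem_schwartz φ Λ) x⟩

/-- `c` is the regularized value of `∫ β(ξ · x) φ(ξ) dξ`: there is `Λ` with `I(Λ') = c` for all
`Λ' ⊇ Λ`. -/
def IsRegValue (β : Distribution F E) (φ : Cminus F n E) (x : Punctured F n) (c : E) : Prop :=
  ∃ Λ : Lattice F n, ∀ Λ' : Lattice F n, Λ.1 ≤ Λ'.1 → partialA β φ x Λ' = c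

/-- The operator `A_β`, with `(A_β φ)(x)` the regularized value of `∫ β(ξ · x) φ(ξ) dξ`
(and `0` if there is none). -/
def opA (β : Distribution F E) (φ : Cminus F n E) (x : Punctured F n) : E := by
  classical exact if h : ∃ c, IsRegValue β φ x c then h.choose else 0

/-- The regularized value of `⟨|s|^{-n}, 1_A⟩ = ∫_F |s|^{-n} (1_A(s) - 1_A(0)) ds`. -/
def absPowIndicator (n : ℕ) (A : Set F) : ℝ :=
  ∫ s, ((absV s : ℝ) ^ n)⁻¹ * (A.indicator 1 s - A.indicator 1 0) ∂(haarF F)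

/-- The value `⟨|s|^{-n}, f⟩ = ∫_F |s|^{-n} (f(s) - f(0)) ds` at a test function `f` with values
in `E`: by linearity it is `∑ₑ e · ⟨|s|^{-n}, 1_{f = e}⟩`, where the values at indicator functions
of compact open sets are rational numbers. -/
def absPow (n : ℕ) (f : F → E) : E :=
  ∑ᶠ e : E, (ratOf (absPowIndicator n (f ⁻¹' {e})) : E) * e

/-- The value of `(1 - q^{n-1}) / (1 - q^{-n}) · (|s - 1|^{-n} - |s|^{-n})` at `f`. -/
def betaValue (n : ℕ) (f : F → E) : E :=
  (1 - (resCard F : E) ^ ((n : ℤ) - 1)) / (1 - (resCard F : E) ^ (-(n : ℤ))) *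
    (absPow n (fun s => f (s + 1)) - absPow n f)

end Abeta

end RadonLocal

end

open MeasureTheory ValuativeRel
open scoped NNReal ENNReal Matrix

set_option linter.unusedSectionVars false

noncomputable section

/-! Put Q = q^(n-1). For a test function g on F let D(k) be the average of g over 1 + 𝔭^k minus its
average over 𝔭^k. Cutting 𝒪 into the shells |s| = q^(-k) and summing by parts turns β into ⟨β, g⟩ =
∑_{k ≥ 0} Q^(k+1) (D(k+1) - D(k)) (`beta_telescope`, `regInt_formula`). The sum is finite because g
is locally constant, and the factor in front of β is the one that produces these weights. Off 𝒪 the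
two halves of β cancel, since |s + 1| = |s| there; hence β kills every test function that is
constant on 𝒪 (`betaValue_eq_zero`), which gives both compact support and total mass zero.

Apply this to the Radon transform of φ at x. Its averages over a + 𝔭^k are the normalized integrals
`pop k a φ x` of φ over the slab x · y ∈ a + 𝔭^k. To evaluate M A_β φ at ξ, integrate A_β φ over a
thin slab S around ξ · x = 1, cut down to a large ball. By Fubini, the contribution of one k is the
integral of φ(y) against the difference of `pop (k+1) a` and `pop k a` of the indicator of S, taken
at y. If y is outside a narrow tube around the line Fξ, then y · x is evenly distributed over the
cosets of 𝔭^(k+1) in a + 𝔭^k as x runs over S, and the difference is zero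
(`pop_succ_of_notMem_tube`). If y is in the tube and close to sξ, then y · x is close to s
(`pop_of_mem_tube`). The volume factors cancel Q^(k+1), leaving D(k+1) - D(k) for ψ(s) = φ(sξ). The
sum telescopes to ψ(1) - ψ(0) = φ(ξ) - φ(0), because D(0) = 0 (`pop_bop`).

The other composition follows by duality. Slab integration is symmetric, so ∫ g · A_β M f = ∫ M A_β
g · f = ∫ g · f for g the indicator of a small ball around x, and everything in sight is constant on
that ball (`Br_Mr_real`).

These identities are proved over ℝ with ordinary integrals. Both operators commute with field
homomorphisms and indicator functions are rational, so the identities descend to ℚ and reach E by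
linearity (`Mr_Br`, `Br_Mr`).

The spaces enter through one criterion: φ lies in C exactly when, for some r, φ(x + u) = φ(x)
whenever ‖u‖ ≤ q^(-r) ‖x‖ (`HomInv`, `exists_homInv_of_mem_spaceC`). By this criterion the far part
of φ has a Radon transform at x that is constant on 𝒪, so the integrals over lattices stabilize
(`Br_indicator_eq`). Conversely M f(ξ) only involves ‖x‖ ≥ ‖ξ‖⁻¹, which reduces statements about C₊
to test functions. -/

namespace RadonLocal

/-! ### The absolute value and the fractional ideals of F. -/

section AbsoluteValue

variable {F : Type*} [Field F] [ValuativeRel F] [TopologicalSpace F] [IsNonarchimedeanLocalField F]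

variable (F) in
lemma one_lt_resCard_nnreal : (1 : ℝ≥0) < resCard F := by exact_mod_cast one_lt_resCard F

variable (F) in
lemma one_lt_resCard_real : (1 : ℝ) < resCard F := by exact_mod_cast one_lt_resCard F

variable (F) in
lemma resCard_pos : (0 : ℝ) < resCard F := zero_lt_one.trans (one_lt_resCard_real F)

lemma absV_strictMono {a b : F} : absV a < absV b ↔ valuation F a < valuation F b := by
  unfold absV
  rw [(WithZeroMulInt.toNNReal_strictMono (one_lt_resCard_nnreal F)).lt_iff_lt,
    (IsNonarchimedeanLocalField.valueGroupWithZeroIsoInt F).strictMono.lt_iff_lt]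

lemma absV_le_iff {a b : F} : absV a ≤ absV b ↔ valuation F a ≤ valuation F b := by
  rw [← not_lt, absV_strictMono, not_lt]

@[simp] lemma absV_zero : absV (0 : F) = 0 := by simp [absV]

@[simp] lemma absV_one : absV (1 : F) = 1 := by simp [absV]

lemma absV_mul (a b : F) : absV (a * b) = absV a * absV b := by simp [absV]

@[simp] lemma absV_eq_zero {a : F} : absV a = 0 ↔ a = 0 := by
  constructor
  · intro h
    by_contra ha
    exact WithZeroMulInt.toNNReal_ne_zero (resCard_ne_zero F)
      (m := IsNonarchimedeanLocalField.valueGroupWithZeroIsoInt F (valuation F a)) (by simpa using ha) h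
  · rintro rfl
    exact absV_zero

@[simp] lemma absV_neg (a : F) : absV (-a) = absV a := by simp [absV, Valuation.map_neg]

lemma absV_add_le (a b : F) : absV (a + b) ≤ max (absV a) (absV b) := by
  rw [le_max_iff, absV_le_iff, absV_le_iff, ← le_max_iff]
  exact Valuation.map_add _ _ _

lemma exists_absV_eq_zpow {a : F} (ha : a ≠ 0) : ∃ v : ℤ, absV a = (resCard F : ℝ≥0) ^ (-v) := by
  have h : IsNonarchimedeanLocalField.valueGroupWithZeroIsoInt F (valuation F a) ≠ 0 := by
    simpa using ha
  refine ⟨-(WithZero.unzero h).toAdd, ?_⟩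
  rw [neg_neg]
  exact WithZeroMulInt.toNNReal_neg_apply _ h

variable (F) in
lemma exists_of_zpow (v : ℤ) : ∃ a : F, absV a = (resCard F : ℝ≥0) ^ (-v) := by
  obtain ⟨a, ha⟩ := ValuativeRel.valuation_surjective
    ((IsNonarchimedeanLocalField.valueGroupWithZeroIsoInt F).symm (WithZero.exp (-v)))
  refine ⟨a, ?_⟩
  unfold absV
  rw [ha, OrderMonoidIso.apply_symm_apply,
    WithZeroMulInt.toNNReal_neg_apply _ WithZero.exp_ne_zero]
  rfl

variable (F) in
lemma zpow_neg_le_iff {a b : ℤ} :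
    (resCard F : ℝ≥0) ^ (-a) ≤ (resCard F : ℝ≥0) ^ (-b) ↔ b ≤ a := by
  rw [zpow_le_zpow_iff_right₀ (one_lt_resCard_nnreal F)]
  omega

variable (F) in
lemma zpow_ne_zero' (a : ℤ) : (resCard F : ℝ≥0) ^ a ≠ 0 := zpow_ne_zero _ (resCard_ne_zero F)

variable (F) in
lemma zpow_neg_inj {a b : ℤ} :
    (resCard F : ℝ≥0) ^ (-a) = (resCard F : ℝ≥0) ^ (-b) ↔ a = b := by
  constructor
  · intro h
    exact le_antisymm ((zpow_neg_le_iff F).1 h.ge) ((zpow_neg_le_iff F).1 h.le)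
  · rintro rfl
    rfl

lemma absV_le_one_iff (a : F) : absV a ≤ 1 ↔ a ∈ 𝒪[F] := by
  rw [← absV_one (F := F), absV_le_iff, map_one]
  rfl

variable (F) in
/-- The fractional ideal of elements of absolute value at most `q ^ (-k)`. -/
def pBall (k : ℤ) : AddSubgroup F where
  carrier := {a | absV a ≤ (resCard F : ℝ≥0) ^ (-k)}
  zero_mem' := by simp
  add_mem' := fun ha hb => (absV_add_le _ _).trans (max_le ha hb)
  neg_mem' := fun ha => by simpa using ha

lemma mem_pBall {k : ℤ} {a : F} : a ∈ pBall F k ↔ absV a ≤ (resCard F : ℝ≥0) ^ (-k) := Iff.rfl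

lemma mem_pBall_zero {a : F} : a ∈ pBall F 0 ↔ a ∈ 𝒪[F] := by
  rw [mem_pBall, neg_zero, zpow_zero, absV_le_one_iff]

lemma pBall_anti {j k : ℤ} (h : j ≤ k) : pBall F k ≤ pBall F j :=
  fun _ ha => le_trans ha ((zpow_neg_le_iff F).2 h)

lemma mul_mem_pBall {j k : ℤ} {a b : F} (ha : a ∈ pBall F j) (hb : b ∈ pBall F k) :
    a * b ∈ pBall F (j + k) := by
  rw [mem_pBall, absV_mul, neg_add, zpow_add₀ (resCard_ne_zero F)]
  exact mul_le_mul' ha hb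

lemma mem_pBall_of_eq {v k : ℤ} {a : F} (ha : absV a = (resCard F : ℝ≥0) ^ (-v)) :
    a ∈ pBall F k ↔ k ≤ v := by
  rw [mem_pBall, ha, zpow_neg_le_iff]

lemma mul_mem_pBall_iff {v k : ℤ} {a b : F} (ha : absV a = (resCard F : ℝ≥0) ^ (-v)) :
    a * b ∈ pBall F k ↔ b ∈ pBall F (k - v) := by
  rw [mem_pBall, mem_pBall, absV_mul, ha, show -k = -v + -(k - v) by ring,
    zpow_add₀ (resCard_ne_zero F)]
  exact mul_le_mul_iff_right₀ (zpow_ne_zero' F (-v)).bot_lt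

lemma absV_inv_eq {v : ℤ} {a : F} (ha : absV a = (resCard F : ℝ≥0) ^ (-v)) :
    absV a⁻¹ = (resCard F : ℝ≥0) ^ (-(-v)) := by
  have h0 : a ≠ 0 := by
    rintro rfl
    rw [absV_zero] at ha
    exact zpow_ne_zero' F _ ha.symm
  have h1 : absV a * absV a⁻¹ = 1 := by rw [← absV_mul, mul_inv_cancel₀ h0, absV_one]
  rw [ha] at h1
  rw [eq_comm, zpow_neg, ← one_div, div_eq_iff (zpow_ne_zero' F _), mul_comm, h1]

lemma ne_zero_of_absV {v : ℤ} {a : F} (ha : absV a = (resCard F : ℝ≥0) ^ (-v)) : a ≠ 0 := by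
  rintro rfl
  rw [absV_zero] at ha
  exact zpow_ne_zero' F _ ha.symm

lemma div_mem_pBall_iff {v k : ℤ} {a b : F} (ha : absV a = (resCard F : ℝ≥0) ^ (-v)) :
    b / a ∈ pBall F k ↔ b ∈ pBall F (k + v) := by
  rw [div_eq_inv_mul, mul_mem_pBall_iff (absV_inv_eq ha), sub_neg_eq_add]

lemma absV_eq_iff {v : ℤ} {a : F} :
    absV a = (resCard F : ℝ≥0) ^ (-v) ↔ a ∈ pBall F v ∧ a ∉ pBall F (v + 1) := by
  constructor
  · intro h
    rw [mem_pBall_of_eq h, mem_pBall_of_eq h]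
    omega
  · rintro ⟨h1, h2⟩
    have ha : a ≠ 0 := by
      rintro rfl
      exact h2 (zero_mem _)
    obtain ⟨w, hw⟩ := exists_absV_eq_zpow ha
    rw [mem_pBall_of_eq hw] at h1 h2
    rw [hw, zpow_neg_inj]
    omega

/-- A nonzero element of a sub-`𝒪`-module brings along the fractional ideal it generates. -/
lemma exists_integer_mul {k : ℤ} {a c : F} (ha : a ∉ pBall F (k + 1)) (hc : c ∈ pBall F k) :
    ∃ b ∈ pBall F 0, b * a = c := by
  have h0 : a ≠ 0 := by
    rintro rfl
    exact ha (zero_mem _)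
  obtain ⟨w, hw⟩ := exists_absV_eq_zpow h0
  rw [mem_pBall_of_eq hw] at ha
  refine ⟨c / a, ?_, div_mul_cancel₀ _ h0⟩
  rw [div_mem_pBall_iff hw]
  exact pBall_anti (by omega) hc

lemma isOpen_pBall (k : ℤ) : IsOpen (pBall F k : Set F) := by
  refine AddSubgroup.isOpen_of_mem_nhds _ (g := 0) ?_
  refine Filter.mem_of_superset (absV_lt_mem_nhds (zpow_ne_zero' F (-k)).bot_lt) ?_
  intro a ha
  exact le_of_lt (Set.mem_ofPred_eq ▸ ha)

lemma isClosed_pBall (k : ℤ) : IsClosed (pBall F k : Set F) :=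
  AddSubgroup.isClosed_of_isOpen _ (isOpen_pBall k)

lemma isCompact_pBall (k : ℤ) : IsCompact (pBall F k : Set F) := by
  obtain ⟨a, ha⟩ := exists_of_zpow F k
  have h := IsNonarchimedeanLocalField.isCompact_closedBall F (valuation F a)
  convert h using 1
  ext b
  rw [Set.mem_ofPred_eq, SetLike.mem_coe, mem_pBall, ← ha, absV_le_iff]

lemma exists_pBall_subset {U : Set F} (hU : U ∈ nhds (0 : F)) : ∃ k : ℤ, (pBall F k : Set F) ⊆ U := by
  obtain ⟨γ, hγ⟩ := (IsValuativeTopology.mem_nhds_zero_iff _).mp hU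
  obtain ⟨a, ha⟩ := ValuativeRel.valuation_surjective γ.1
  have ha0 : a ≠ 0 := by
    rintro rfl
    rw [map_zero] at ha
    exact γ.ne_zero ha.symm
  obtain ⟨v, hv⟩ := exists_absV_eq_zpow ha0
  refine ⟨v + 1, fun b hb => hγ ?_⟩
  show valuation F b < γ.1
  rw [← ha, ← absV_strictMono, hv]
  refine lt_of_le_of_lt hb ?_
  exact zpow_lt_zpow_right₀ (one_lt_resCard_nnreal F) (by omega)

lemma exists_mem_pBall (a : F) : ∃ k : ℤ, a ∈ pBall F k := by
  by_cases ha : a = 0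
  · exact ⟨0, ha ▸ zero_mem _⟩
  · obtain ⟨v, hv⟩ := exists_absV_eq_zpow ha
    exact ⟨v, (mem_pBall_of_eq hv).2 le_rfl⟩

variable (F) in
/-- Representatives of the `q` cosets of the next smaller fractional ideal. -/
lemma exists_coset_reps (k : ℤ) : ∃ T : Finset F, T.card = resCard F ∧ (∀ b ∈ T, b ∈ pBall F k) ∧
    ∀ a ∈ pBall F k, ∃! b, b ∈ T ∧ a - b ∈ pBall F (k + 1) := by
  classical
  obtain ⟨p, hp⟩ := exists_of_zpow F k
  have hp0 := ne_zero_of_absV hp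
  have := Fintype.ofFinite 𝓀[F]
  let s : 𝓀[F] → 𝒪[F] := Function.surjInv IsLocalRing.residue_surjective
  have hs : ∀ x, IsLocalRing.residue 𝒪[F] (s x) = x := Function.surjInv_eq _
  have key : ∀ a b : 𝒪[F], IsLocalRing.residue 𝒪[F] a = IsLocalRing.residue 𝒪[F] b ↔
      (a - b : F) ∈ pBall F 1 := by
    intro a b
    rw [← sub_eq_zero, ← map_sub, IsLocalRing.residue_eq_zero_iff]
    have h1 : (a - b : 𝒪[F]) ∈ IsLocalRing.maximalIdeal 𝒪[F] ↔ valuation F ((a - b : 𝒪[F]) : F) < 1 :=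
      by
      rw [IsLocalRing.mem_maximalIdeal, mem_nonunits_iff,
        (Valuation.integer.integers (valuation F)).isUnit_iff_valuation_eq_one, lt_iff_le_and_ne]
      exact ⟨fun h => ⟨(a - b).2, h⟩, fun h => h.2⟩
    rw [h1, ← map_one (valuation F), ← absV_strictMono, absV_one]
    constructor
    · intro h
      by_cases h0 : ((a - b : 𝒪[F]) : F) = 0
      · have : (a - b : F) = 0 := h0
        rw [this]
        exact zero_mem _
      · obtain ⟨v, hv⟩ := exists_absV_eq_zpow h0
        have : (a - b : F) ∈ pBall F 1 ↔ _ := mem_pBall_of_eq hv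
        rw [this]
        rw [hv, ← zpow_zero (resCard F : ℝ≥0), zpow_lt_zpow_iff_right₀ (one_lt_resCard_nnreal F)] at h
        omega
    · intro h
      refine lt_of_le_of_lt h ?_
      rw [← zpow_zero (resCard F : ℝ≥0)]
      exact zpow_lt_zpow_right₀ (one_lt_resCard_nnreal F) (by omega)
  -- Lifts of the residue classes represent 𝒪 modulo 𝔭; scaling by p, of valuation k, moves them to
  -- 𝔭^k modulo 𝔭^(k+1).
  refine ⟨Finset.univ.image fun x => p * (s x : F), ?_, ?_, ?_⟩
  · rw [Finset.card_image_of_injective, Finset.card_univ, resCard, Nat.card_eq_fintype_card]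
    intro x y hxy
    have : s x = s y := Subtype.ext (mul_left_cancel₀ hp0 hxy)
    rw [← hs x, ← hs y, this]
  · intro b hb
    obtain ⟨x, -, rfl⟩ := Finset.mem_image.1 hb
    rw [mul_mem_pBall_iff hp, sub_self]
    exact mem_pBall_zero.2 (s x).2
  · intro a ha
    have ha' : a / p ∈ pBall F 0 := by
      rw [div_mem_pBall_iff hp, zero_add]
      exact ha
    let a' : 𝒪[F] := ⟨a / p, mem_pBall_zero.1 ha'⟩
    have hk : ∀ x, a - p * (s x : F) ∈ pBall F (k + 1) ↔ IsLocalRing.residue 𝒪[F] a' = x := by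
      intro x
      nth_rw 2 [← hs x]
      rw [key]
      show _ ↔ a / p - s x ∈ _
      have : a - p * (s x : F) = p * (a / p - s x) := by
        field_simp
      rw [this, mul_mem_pBall_iff hp]
      simp
    refine ⟨p * (s (IsLocalRing.residue 𝒪[F] a') : F), ⟨?_, (hk _).2 rfl⟩, ?_⟩
    · exact Finset.mem_image_of_mem _ (Finset.mem_univ _)
    · rintro b ⟨hb, hab⟩
      obtain ⟨x, -, rfl⟩ := Finset.mem_image.1 hb
      rw [(hk x).1 hab]

end AbsoluteValue

/-! ### The maximum norm and the standard lattices of F^n. -/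

section Vectors

variable {F : Type*} [Field F] [ValuativeRel F] [TopologicalSpace F] [IsNonarchimedeanLocalField F]
variable {n : ℕ}

variable (F n) in
/-- The lattice of vectors of norm at most `q ^ (-k)`. -/
def vBall (k : ℤ) : AddSubgroup (Fin n → F) := AddSubgroup.pi Set.univ fun _ => pBall F k

lemma mem_vBall {k : ℤ} {x : Fin n → F} : x ∈ vBall F n k ↔ ∀ i, x i ∈ pBall F k := by
  simp [vBall, AddSubgroup.mem_pi]

lemma mem_vBall_iff_vnorm {k : ℤ} {x : Fin n → F} :
    x ∈ vBall F n k ↔ vnorm x ≤ (resCard F : ℝ≥0) ^ (-k) := by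
  rw [mem_vBall, vnorm, Finset.sup_le_iff]
  simp [mem_pBall]

lemma vBall_anti {j k : ℤ} (h : j ≤ k) : vBall F n k ≤ vBall F n j :=
  fun _ hx => mem_vBall.2 fun i => pBall_anti h (mem_vBall.1 hx i)

lemma coe_vBall (k : ℤ) : (vBall F n k : Set (Fin n → F)) = Set.univ.pi fun _ => (pBall F k : Set F) := by
  ext x
  simp [mem_vBall]

lemma isOpen_vBall (k : ℤ) : IsOpen (vBall F n k : Set (Fin n → F)) := by
  rw [coe_vBall]
  exact isOpen_set_pi Set.finite_univ fun _ _ => isOpen_pBall k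

lemma isCompact_vBall (k : ℤ) : IsCompact (vBall F n k : Set (Fin n → F)) := by
  rw [coe_vBall]
  exact isCompact_univ_pi fun _ => isCompact_pBall k

lemma isClosed_vBall (k : ℤ) : IsClosed (vBall F n k : Set (Fin n → F)) :=
  (isCompact_vBall k).isClosed

lemma exists_vBall_subset {U : Set (Fin n → F)} (hU : U ∈ nhds (0 : Fin n → F)) :
    ∃ k : ℤ, (vBall F n k : Set (Fin n → F)) ⊆ U := by
  rw [nhds_pi, Filter.mem_pi] at hU
  obtain ⟨I, hI, t, ht, hU⟩ := hU
  choose k hk using fun i => exists_pBall_subset (ht i)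
  obtain ⟨M, hM⟩ := (Set.finite_range k).bddAbove
  refine ⟨M, fun x hx => hU fun i _ => hk i (pBall_anti (hM ⟨i, rfl⟩) (mem_vBall.1 hx i))⟩

/-- `x` has valuation exactly `v`, that is, norm `q ^ (-v)`. -/
def HasVal (x : Fin n → F) (v : ℤ) : Prop := vnorm x = (resCard F : ℝ≥0) ^ (-v)

lemma HasVal.mem_iff {x : Fin n → F} {v k : ℤ} (h : HasVal x v) : x ∈ vBall F n k ↔ k ≤ v := by
  rw [mem_vBall_iff_vnorm, h, zpow_neg_le_iff]

lemma HasVal.ne_zero {x : Fin n → F} {v : ℤ} (h : HasVal x v) : x ≠ 0 := by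
  rintro rfl
  have := (h.mem_iff (k := v + 1)).1 (zero_mem _)
  omega

lemma HasVal.exists_coord {x : Fin n → F} {v : ℤ} (h : HasVal x v) :
    ∃ i, absV (x i) = (resCard F : ℝ≥0) ^ (-v) := by
  obtain ⟨i, hi⟩ := Function.ne_iff.1 h.ne_zero
  obtain ⟨j, -, hj⟩ := Finset.exists_mem_eq_sup Finset.univ ⟨i, Finset.mem_univ i⟩ fun i => absV (x i)
  exact ⟨j, hj.symm.trans h⟩

lemma exists_hasVal {x : Fin n → F} (hx : x ≠ 0) : ∃ v : ℤ, HasVal x v := by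
  obtain ⟨i, hi⟩ := Function.ne_iff.1 hx
  obtain ⟨j, -, hj⟩ := Finset.exists_mem_eq_sup Finset.univ ⟨i, Finset.mem_univ i⟩ fun i => absV (x i)
  have hj' : vnorm x = absV (x j) := hj
  have h0 : x j ≠ 0 := by
    intro h0
    have : absV (x i) ≤ absV (x j) := hj ▸ Finset.le_sup (f := fun i => absV (x i)) (Finset.mem_univ i)
    rw [h0, absV_zero, nonpos_iff_eq_zero, absV_eq_zero] at this
    exact hi this
  obtain ⟨v, hv⟩ := exists_absV_eq_zpow h0
  exact ⟨v, hj'.trans hv⟩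

lemma hasVal_iff {x : Fin n → F} {v : ℤ} : HasVal x v ↔ x ∈ vBall F n v ∧ x ∉ vBall F n (v + 1) := by
  constructor
  · intro h
    rw [h.mem_iff, h.mem_iff]
    omega
  · rintro ⟨h1, h2⟩
    have hx : x ≠ 0 := by
      rintro rfl
      exact h2 (zero_mem _)
    obtain ⟨w, hw⟩ := exists_hasVal hx
    rw [hw.mem_iff] at h1 h2
    obtain rfl : w = v := by omega
    exact hw

lemma HasVal.add {x u : Fin n → F} {v : ℤ} (h : HasVal x v) (hu : u ∈ vBall F n (v + 1)) :
    HasVal (x + u) v := by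
  rw [hasVal_iff] at h ⊢
  exact ⟨add_mem h.1 (vBall_anti (by omega) hu), fun h' => h.2 ((add_mem_cancel_right hu).1 h')⟩

lemma exists_mem_vBall (x : Fin n → F) : ∃ k : ℤ, x ∈ vBall F n k := by
  by_cases hx : x = 0
  · exact ⟨0, hx ▸ zero_mem _⟩
  · obtain ⟨v, hv⟩ := exists_hasVal hx
    exact ⟨v, hv.mem_iff.2 le_rfl⟩

lemma dot_mem_pBall {j k : ℤ} {x y : Fin n → F} (hx : x ∈ vBall F n j) (hy : y ∈ vBall F n k) :
    x ⬝ᵥ y ∈ pBall F (j + k) :=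
  sum_mem fun i _ => mul_mem_pBall (mem_vBall.1 hx i) (mem_vBall.1 hy i)

lemma smul_mem_vBall {j k : ℤ} {a : F} {y : Fin n → F} (ha : a ∈ pBall F j) (hy : y ∈ vBall F n k) :
    a • y ∈ vBall F n (j + k) :=
  mem_vBall.2 fun i => mul_mem_pBall ha (mem_vBall.1 hy i)

lemma single_mem_vBall {k : ℤ} {a : F} (ha : a ∈ pBall F k) (i : Fin n) :
    Pi.single i a ∈ vBall F n k := by
  classical
  refine mem_vBall.2 fun j => ?_
  by_cases h : j = i
  · subst h
    simpa using ha
  · simp [Pi.single_eq_of_ne h]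

/-- Any scalar is the product of `ξ` with a vector of the smallest possible norm. -/
lemma HasVal.exists_dot_eq {ξ : Fin n → F} {v : ℤ} (h : HasVal ξ v) {k : ℤ} {c : F}
    (hc : c ∈ pBall F k) : ∃ u ∈ vBall F n (k - v), ξ ⬝ᵥ u = c := by
  obtain ⟨i, hi⟩ := h.exists_coord
  refine ⟨Pi.single i (c / ξ i), single_mem_vBall ?_ i, ?_⟩
  · rw [div_mem_pBall_iff hi]
    simpa using hc
  · simp [mul_div_cancel₀ _ (ne_zero_of_absV hi)]

end Vectors

/-! ### Sums over level sets -/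

section SetSum

variable {X : Type*} {E : Type*} [Field E]

/-- The sum `∑ₑ e · ν(g = e)` attached to a set function with rational values. -/
def setSum (ν : Set X → ℝ) (g : X → E) : E := ∑ᶠ e : E, (ratOf (ν (g ⁻¹' {e})) : E) * e

lemma ratOf_zero : ratOf 0 = 0 := by simpa using ratOf_cast 0

lemma cast_ratOf {r : ℝ} (h : ∃ a : ℚ, (a : ℝ) = r) : (ratOf r : ℝ) = r := by
  obtain ⟨a, rfl⟩ := h
  rw [ratOf_cast]

lemma ratOf_add {r s : ℝ} (hr : ∃ a : ℚ, (a : ℝ) = r) (hs : ∃ a : ℚ, (a : ℝ) = s) :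
    ratOf (r + s) = ratOf r + ratOf s := by
  obtain ⟨a, rfl⟩ := hr
  obtain ⟨b, rfl⟩ := hs
  rw [ratOf_cast, ratOf_cast, ← Rat.cast_add, ratOf_cast]

/-- Injectivity of σ identifies the level sets of g and σ ∘ g, and the coefficients are rational, so
σ fixes them. This is what lets identities travel between ℝ, ℚ and E. -/
lemma setSum_map {E' : Type*} [Field E'] (σ : E →+* E') {ν : Set X → ℝ} (hν : ν ∅ = 0) (g : X → E) :
    setSum ν (σ ∘ g) = σ (setSum ν g) := by
  unfold setSum
  have h1 : ∀ e, ((ratOf (ν ((σ ∘ g) ⁻¹' {σ e})) : E')) * σ e = σ ((ratOf (ν (g ⁻¹' {e})) : E) * e) := by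
    intro e
    have : (σ ∘ g) ⁻¹' {σ e} = g ⁻¹' {e} := by
      ext x
      simp [σ.injective.eq_iff]
    rw [this, map_mul, map_ratCast]
  rw [show σ (∑ᶠ e : E, (ratOf (ν (g ⁻¹' {e})) : E) * e) =
    ∑ᶠ e : E, σ ((ratOf (ν (g ⁻¹' {e})) : E) * e) from
    AddMonoidHom.map_finsum_of_injective σ.toAddMonoidHom σ.injective _]
  simp_rw [← h1]
  rw [← finsum_mem_range (f := fun e' : E' => (ratOf (ν ((σ ∘ g) ⁻¹' {e'})) : E') * e') σ.injective,
    finsum_mem_def]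
  refine finsum_congr fun e' => ?_
  by_cases he : e' ∈ Set.range σ
  · rw [Set.indicator_of_mem he]
  · rw [Set.indicator_of_notMem he]
    have : (σ ∘ g) ⁻¹' {e'} = ∅ := by
      ext x
      simp only [Set.mem_preimage, Function.comp_apply, Set.mem_singleton_iff,
        Set.mem_empty_iff_false, iff_false]
      exact fun h => he ⟨_, h⟩
    rw [this, hν, ratOf_zero, Rat.cast_zero, zero_mul]

variable [TopologicalSpace X]

/-- A set function that is additive with rational values on compact open sets. -/
structure IsRatAdd (ν : Set X → ℝ) : Prop where
  add : ∀ A B : Set X, IsCompact A → IsOpen A → IsCompact B → IsOpen B → Disjoint A B →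
    ν (A ∪ B) = ν A + ν B
  rat : ∀ A : Set X, IsCompact A → IsOpen A → ∃ a : ℚ, (a : ℝ) = ν A

namespace IsRatAdd

variable {ν : Set X → ℝ}

lemma empty (hν : IsRatAdd ν) : ν ∅ = 0 := by
  have := hν.add ∅ ∅ isCompact_empty isOpen_empty isCompact_empty isOpen_empty disjoint_bot_left
  simpa using this

lemma ratOf_biUnion (hν : IsRatAdd ν) {ι : Type*} (u : X → ι) (T : Finset ι)
    (hT : ∀ p ∈ T, IsCompact (u ⁻¹' {p}) ∧ IsOpen (u ⁻¹' {p})) :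
    ratOf (ν (u ⁻¹' T)) = ∑ p ∈ T, ratOf (ν (u ⁻¹' {p})) := by
  classical
  have hco : ∀ S : Finset ι, S ⊆ T → IsCompact (u ⁻¹' S) ∧ IsOpen (u ⁻¹' S) := by
    intro S hS
    have : u ⁻¹' S = ⋃ p ∈ S, u ⁻¹' {p} := by
      ext x
      simp
    rw [this]
    exact ⟨S.isCompact_biUnion fun p hp => (hT p (hS hp)).1,
      isOpen_biUnion fun p hp => (hT p (hS hp)).2⟩
  have : ∀ S : Finset ι, S ⊆ T → ratOf (ν (u ⁻¹' S)) = ∑ p ∈ S, ratOf (ν (u ⁻¹' {p})) := by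
    intro S
    induction S using Finset.induction_on with
    | empty => intro _; simp [hν.empty, ratOf_zero]
    | insert p S hp ih =>
      intro hS
      have hS' := (Finset.subset_insert p S).trans hS
      have h1 := hT p (hS (Finset.mem_insert_self p S))
      have h2 := hco S hS'
      rw [Finset.sum_insert hp, ← ih hS', ← ratOf_add (hν.rat _ h1.1 h1.2) (hν.rat _ h2.1 h2.2),
        ← hν.add _ _ h1.1 h1.2 h2.1 h2.2]
      · congr 2
        ext x
        simp
      · rw [Set.disjoint_left]
        rintro x hx hx'
        have : u x = p := hx
        exact hp (this ▸ hx')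
  exact this T subset_rfl

variable [CharZero E]

/-- The sum over level sets may be computed on any finer finite partition into compact open pieces.
Linearity follows by evaluating several functions on one common partition. -/
lemma setSum_comp (hν : IsRatAdd ν) {ι : Type*} (u : X → ι) (T : Finset ι)
    (hT : ∀ p ∈ T, IsCompact (u ⁻¹' {p}) ∧ IsOpen (u ⁻¹' {p})) (φ : ι → E)
    (hφ : ∀ x, u x ∉ T → φ (u x) = 0) :
    setSum ν (fun x => φ (u x)) = ∑ p ∈ T, (ratOf (ν (u ⁻¹' {p})) : E) * φ p := by
  classical
  have h1 : ∀ e : E, e ≠ 0 → (ratOf (ν ((fun x => φ (u x)) ⁻¹' {e})) : E) =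
      ∑ p ∈ T with φ p = e, (ratOf (ν (u ⁻¹' {p})) : E) := by
    intro e he
    rw [← Rat.cast_sum, ← hν.ratOf_biUnion u _ fun p hp => hT p (Finset.mem_filter.1 hp).1]
    congr 3
    ext x
    simp only [Set.mem_preimage, Set.mem_singleton_iff, Finset.coe_filter, Set.mem_ofPred_eq]
    refine ⟨fun h => ⟨?_, h⟩, fun h => h.2⟩
    by_contra hx
    exact he (h.symm.trans (hφ x hx))
  have h2 : ∀ e : E, (ratOf (ν ((fun x => φ (u x)) ⁻¹' {e})) : E) * e =
      ∑ p ∈ T with φ p = e, (ratOf (ν (u ⁻¹' {p})) : E) * φ p := by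
    intro e
    by_cases he : e = 0
    · subst he
      rw [mul_zero, Finset.sum_eq_zero]
      intro p hp
      rw [(Finset.mem_filter.1 hp).2, mul_zero]
    · rw [h1 e he, Finset.sum_mul]
      refine Finset.sum_congr rfl fun p hp => ?_
      rw [(Finset.mem_filter.1 hp).2]
  unfold setSum
  simp_rw [h2]
  rw [finsum_eq_sum_of_support_subset (s := T.image φ)]
  · exact Finset.sum_fiberwise_of_maps_to (fun p hp => Finset.mem_image_of_mem φ hp) _
  · intro e he
    obtain ⟨p, hp, -⟩ := Finset.exists_ne_zero_of_sum_ne_zero he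
    rw [Finset.mem_filter] at hp
    exact Finset.mem_coe.2 (Finset.mem_image.2 ⟨p, hp⟩)

end IsRatAdd

lemma schwartz_fiber {f : X → E} (hf : f ∈ schwartz X E) {e : E} (he : e ≠ 0) :
    IsCompact (f ⁻¹' {e}) ∧ IsOpen (f ⁻¹' {e}) := by
  refine ⟨hf.2.of_isClosed_subset (hf.1.isClosed_fiber e) ?_, hf.1.isOpen_fiber e⟩
  intro x hx
  have : f x = e := hx
  simpa [this] using he

lemma schwartz_finite {f : X → E} (hf : f ∈ schwartz X E) : (f '' Function.support f).Finite := by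
  let := (⊥ : TopologicalSpace E)
  have : DiscreteTopology E := ⟨rfl⟩
  exact isCompact_iff_finite.1 (hf.2.image hf.1.continuous)

/-- A test function takes finitely many nonzero values. -/
lemma schwartz_values {f : X → E} (hf : f ∈ schwartz X E) : ∃ T : Finset E, 0 ∉ T ∧
    (∀ e ∈ T, IsCompact (f ⁻¹' {e}) ∧ IsOpen (f ⁻¹' {e})) ∧ ∀ x, f x ∉ T → f x = 0 := by
  refine ⟨(schwartz_finite hf).toFinset, ?_, ?_, ?_⟩
  · simp
  · intro e he
    refine schwartz_fiber hf ?_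
    rintro rfl
    simp at he
  · intro x hx
    by_contra h
    exact hx ((schwartz_finite hf).mem_toFinset.2 ⟨x, h, rfl⟩)

lemma indicator_const_mem_schwartz [T2Space X] {A : Set X} (h1 : IsCompact A) (h2 : IsOpen A) (c : E) :
    A.indicator (fun _ => c) ∈ schwartz X E := by
  have hlc : IsLocallyConstant (A.indicator fun _ : X => c) := by
    rw [IsLocallyConstant.iff_eventually_eq]
    intro x
    by_cases hx : x ∈ A
    · filter_upwards [h2.mem_nhds hx] with y hy
      rw [Set.indicator_of_mem hx, Set.indicator_of_mem hy]
    · filter_upwards [h1.isClosed.isOpen_compl.mem_nhds hx] with y hy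
      rw [Set.indicator_of_notMem hx, Set.indicator_of_notMem hy]
  exact ⟨hlc, h1.of_isClosed_subset (hlc.isOpen_fiber 0).isClosed_compl
    Set.support_indicator_subset⟩

lemma indicator_mem_schwartz' {f : X → E} (hf : f ∈ schwartz X E) {A : Set X} (hA : IsClopen A) :
    A.indicator f ∈ schwartz X E := by
  have hlc : IsLocallyConstant (A.indicator f) := by
    rw [IsLocallyConstant.iff_eventually_eq]
    intro x
    by_cases hx : x ∈ A
    · filter_upwards [hA.isOpen.mem_nhds hx, hf.1.eventually_eq x] with y hy hy'
      rw [Set.indicator_of_mem hx, Set.indicator_of_mem hy, hy']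
    · filter_upwards [hA.compl.isOpen.mem_nhds hx] with y hy
      rw [Set.indicator_of_notMem hx, Set.indicator_of_notMem hy]
  exact ⟨hlc, hf.2.of_isClosed_subset (hlc.isOpen_fiber 0).isClosed_compl
    (by rw [Set.support_indicator]; exact Set.inter_subset_right)⟩

/-- A test function is a combination of indicator functions of its level sets. -/
lemma schwartz_decomp {f : X → E} (hf : f ∈ schwartz X E) : ∃ T : Finset E, 0 ∉ T ∧
    (∀ e ∈ T, IsCompact (f ⁻¹' {e}) ∧ IsOpen (f ⁻¹' {e})) ∧
    f = ∑ e ∈ T, e • (f ⁻¹' {e}).indicator (fun _ => (1 : E)) := by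
  classical
  obtain ⟨T, h0, h1, h2⟩ := schwartz_values hf
  refine ⟨T, h0, h1, ?_⟩
  ext x
  rw [Finset.sum_apply]
  simp only [Pi.smul_apply, smul_eq_mul, Set.indicator_apply, Set.mem_preimage,
    Set.mem_singleton_iff, mul_ite, mul_one, mul_zero]
  rw [Finset.sum_ite_eq]
  split_ifs with h
  · rfl
  · exact h2 x h

namespace IsRatAdd

variable {ν : Set X → ℝ} [CharZero E]

lemma setSum_eq_sum (hν : IsRatAdd ν) {f : X → E} {T : Finset E}
    (h1 : ∀ e ∈ T, IsCompact (f ⁻¹' {e}) ∧ IsOpen (f ⁻¹' {e})) (h2 : ∀ x, f x ∉ T → f x = 0) :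
    setSum ν f = ∑ e ∈ T, (ratOf (ν (f ⁻¹' {e})) : E) * e :=
  hν.setSum_comp f T h1 id h2

lemma setSum_add (hν : IsRatAdd ν) {f g : X → E} (hf : f ∈ schwartz X E) (hg : g ∈ schwartz X E) :
    setSum ν (f + g) = setSum ν f + setSum ν g := by
  classical
  obtain ⟨T, -, hT⟩ := schwartz_values hf
  obtain ⟨S, -, hS⟩ := schwartz_values hg
  let u : X → E × E := fun x => (f x, g x)
  have hfib : ∀ p : E × E, u ⁻¹' {p} = f ⁻¹' {p.1} ∩ g ⁻¹' {p.2} := by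
    intro p
    ext x
    simp [u, Prod.ext_iff]
  -- The joint level sets of f and g; only the one over (0, 0) can fail to be compact, and it
  -- contributes nothing.
  let W : Finset (E × E) := (insert 0 T ×ˢ insert 0 S).erase (0, 0)
  have hmem : ∀ x, f x ∈ insert 0 T ∧ g x ∈ insert 0 S := by
    intro x
    simp only [Finset.mem_insert]
    exact ⟨or_iff_not_imp_right.2 (hT.2 x), or_iff_not_imp_right.2 (hS.2 x)⟩
  have hW : ∀ p ∈ W, IsCompact (u ⁻¹' {p}) ∧ IsOpen (u ⁻¹' {p}) := by
    intro p hp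
    rw [hfib]
    have hne : p.1 ≠ 0 ∨ p.2 ≠ 0 := by
      by_contra! h
      exact Finset.ne_of_mem_erase hp (Prod.ext h.1 h.2)
    refine ⟨?_, (hf.1.isOpen_fiber _).inter (hg.1.isOpen_fiber _)⟩
    rcases hne with h | h
    · exact (schwartz_fiber hf h).1.inter_right (hg.1.isClosed_fiber _)
    · exact (schwartz_fiber hg h).1.inter_left (hf.1.isClosed_fiber _)
  have hW' : ∀ x, u x ∉ W → u x = 0 := by
    intro x hx
    by_contra h
    exact hx (Finset.mem_erase.2 ⟨h, Finset.mem_product.2 (hmem x)⟩)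
  have e1 := hν.setSum_comp u W hW (fun p => p.1 + p.2) fun x hx => by simp [hW' x hx]
  have e2 := hν.setSum_comp u W hW (fun p => p.1) fun x hx => by simp [hW' x hx]
  have e3 := hν.setSum_comp u W hW (fun p => p.2) fun x hx => by simp [hW' x hx]
  have e1' : setSum ν (f + g) = _ := e1
  have e2' : setSum ν f = _ := e2
  have e3' : setSum ν g = _ := e3
  rw [e1', e2', e3', ← Finset.sum_add_distrib]
  exact Finset.sum_congr rfl fun p _ => mul_add _ _ _

lemma setSum_smul (hν : IsRatAdd ν) (c : E) {f : X → E} (hf : f ∈ schwartz X E) :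
    setSum ν (c • f) = c * setSum ν f := by
  obtain ⟨T, -, h1, h2⟩ := schwartz_values hf
  have e1 : setSum ν (c • f) = _ :=
    hν.setSum_comp f T h1 (fun e => c * e) fun x hx => by simp [h2 x hx]
  rw [e1, hν.setSum_eq_sum h1 h2, Finset.mul_sum]
  exact Finset.sum_congr rfl fun p _ => by ring

end IsRatAdd

end SetSum

/-! ### For real coefficients, sums over level sets are Bochner integrals. -/

section RealSum

variable {X : Type*} [TopologicalSpace X] [MeasurableSpace X] [BorelSpace X]

lemma integral_schwartz_eq_sum {μ : Measure X} {f : X → ℝ} {T : Finset ℝ}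
    (h1 : ∀ e ∈ T, IsOpen (f ⁻¹' {e})) (h1' : ∀ e ∈ T, μ (f ⁻¹' {e}) ≠ ∞)
    (h2 : ∀ x, f x ∉ T → f x = 0) :
    Integrable f μ ∧ ∫ x, f x ∂μ = ∑ e ∈ T, μ.real (f ⁻¹' {e}) * e := by
  classical
  have hf : f = fun x => ∑ e ∈ T, (f ⁻¹' {e}).indicator (fun _ => e) x := by
    ext x
    simp only [Set.indicator_apply, Set.mem_preimage, Set.mem_singleton_iff]
    rw [Finset.sum_ite_eq]
    split_ifs with h
    · rfl
    · exact h2 x h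
  have hint : ∀ e ∈ T, Integrable ((f ⁻¹' {e}).indicator fun _ => e) μ := fun e he =>
    (integrable_indicator_iff (h1 e he).measurableSet).2 (integrableOn_const (h1' e he))
  constructor
  · rw [hf]
    exact integrable_finsetSum _ hint
  · nth_rw 1 [hf]
    rw [integral_finsetSum _ hint]
    refine Finset.sum_congr rfl fun e he => ?_
    rw [integral_indicator_const _ (h1 e he).measurableSet, smul_eq_mul]

lemma IsRatAdd.setSum_real {ν : Set X → ℝ} (hν : IsRatAdd ν) {f : X → ℝ} {T : Finset ℝ}
    (h1 : ∀ e ∈ T, IsCompact (f ⁻¹' {e}) ∧ IsOpen (f ⁻¹' {e})) (h2 : ∀ x, f x ∉ T → f x = 0) :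
    setSum ν f = ∑ e ∈ T, ν (f ⁻¹' {e}) * e := by
  rw [hν.setSum_eq_sum h1 h2]
  refine Finset.sum_congr rfl fun e he => ?_
  rw [cast_ratOf (hν.rat _ (h1 e he).1 (h1 e he).2)]

lemma schwartz_integrable {μ : Measure X} (hμ : ∀ A : Set X, IsCompact A → IsOpen A → μ A ≠ ∞)
    {f : X → ℝ} (hf : f ∈ schwartz X ℝ) : Integrable f μ := by
  obtain ⟨T, -, h1, h2⟩ := schwartz_values hf
  exact (integral_schwartz_eq_sum (fun e he => (h1 e he).2)
    (fun e he => hμ _ (h1 e he).1 (h1 e he).2) h2).1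

/-- For real valued test functions, the sum over level sets is the Bochner integral. -/
lemma eInt_real {μ : Measure X} (hν : IsRatAdd μ.real)
    (hμ : ∀ A : Set X, IsCompact A → IsOpen A → μ A ≠ ∞) {f : X → ℝ} (hf : f ∈ schwartz X ℝ) :
    eInt μ f = ∫ x, f x ∂μ := by
  obtain ⟨T, -, h1, h2⟩ := schwartz_values hf
  rw [(integral_schwartz_eq_sum (fun e he => (h1 e he).2)
    (fun e he => hμ _ (h1 e he).1 (h1 e he).2) h2).2]
  exact hν.setSum_real h1 h2

lemma isRatAdd_measure {μ : Measure X} (hμ : ∀ A : Set X, IsCompact A → IsOpen A → μ A ≠ ∞)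
    (hr : ∀ A : Set X, IsCompact A → IsOpen A → ∃ a : ℚ, (a : ℝ) = μ.real A) : IsRatAdd μ.real where
  add A B hA hA' hB hB' h := measureReal_union h hB'.measurableSet (hμ A hA hA') (hμ B hB hB')
  rat := hr

end RealSum

/-! ### Haar volumes of balls, and rationality of volumes of compact open sets. -/

section Haar

/-- A compact union of cosets of an open subgroup has measure a multiple of the subgroup's. -/
lemma exists_measure_eq_mul {G : Type*} [AddCommGroup G] [TopologicalSpace G]
    [IsTopologicalAddGroup G] [MeasurableSpace G] [BorelSpace G] (μ : Measure G)
    [μ.IsAddLeftInvariant] (H : AddSubgroup G) (hH : IsOpen (H : Set G)) {A : Set G}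
    (hA : IsCompact A) (hAH : ∀ a ∈ A, ∀ h ∈ H, a + h ∈ A) : ∃ N : ℕ, μ A = N * μ (H : Set G) := by
  classical
  have hd : DiscreteTopology (G ⧸ H) := QuotientAddGroup.discreteTopology hH
  have hfin : ((QuotientAddGroup.mk : G → G ⧸ H) '' A).Finite :=
    isCompact_iff_finite.1 (hA.image QuotientAddGroup.continuous_mk)
  have hAeq : A = ⋃ c ∈ hfin.toFinset, (QuotientAddGroup.mk : G → G ⧸ H) ⁻¹' {c} := by
    ext x
    simp only [Set.Finite.mem_toFinset, Set.mem_iUnion, Set.mem_preimage, Set.mem_singleton_iff,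
      exists_prop, exists_eq_right']
    refine ⟨fun h => ⟨x, h, rfl⟩, ?_⟩
    rintro ⟨y, hy, hyx⟩
    have := hAH y hy _ (QuotientAddGroup.eq.1 hyx)
    simpa using this
  refine ⟨hfin.toFinset.card, ?_⟩
  rw [congrArg μ hAeq, measure_biUnion_finset]
  · rw [Finset.sum_congr rfl (g := fun _ => μ (H : Set G)), Finset.sum_const, nsmul_eq_mul]
    intro c _
    obtain ⟨g, rfl⟩ := QuotientAddGroup.mk_surjective c
    rw [← measure_preimage_add μ (-g) (H : Set G)]
    congr 1
    ext x
    simp only [Set.mem_preimage, Set.mem_singleton_iff, SetLike.mem_coe]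
    rw [eq_comm, QuotientAddGroup.eq]
  · intro c _ d _ hcd
    exact Disjoint.preimage _ (by simpa using hcd)
  · intro c _
    exact (isOpen_discrete {c}).preimage QuotientAddGroup.continuous_mk |>.measurableSet

variable {F : Type*} [Field F] [ValuativeRel F] [TopologicalSpace F] [IsNonarchimedeanLocalField F]
variable {n : ℕ}

lemma exists_vBall_invariant {E : Type*} [Field E] {h : (Fin n → F) → E}
    (hh : h ∈ schwartz (Fin n → F) E) : ∃ l : ℤ, ∀ x, ∀ u ∈ vBall F n l, h (x + u) = h x := by
  obtain ⟨l, hl⟩ := exists_vBall_subset (exists_nhds_translation hh)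
  exact ⟨l, fun x u hu => hl hu x⟩

lemma exists_pBall_invariant {E : Type*} [Field E] {h : F → E}
    (hh : h ∈ schwartz F E) : ∃ l : ℕ, ∀ x, ∀ u ∈ pBall F l, h (x + u) = h x := by
  obtain ⟨l, hl⟩ := exists_pBall_subset (exists_nhds_translation hh)
  exact ⟨l.toNat, fun x u hu => hl (pBall_anti (Int.self_le_toNat l) hu) x⟩

lemma exists_subset_vBall {A : Set (Fin n → F)} (hA : IsCompact A) :
    ∃ C : ℤ, A ⊆ (vBall F n C : Set (Fin n → F)) := by
  have hdir : Directed (· ⊆ ·) fun k : ℤ => (vBall F n k : Set (Fin n → F)) :=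
    directed_of_isDirected_ge fun _ _ h => vBall_anti h
  obtain ⟨C, hC⟩ := hA.elim_directed_cover (fun k : ℤ => (vBall F n k : Set (Fin n → F)))
    (fun k => isOpen_vBall k) (fun x _ => by
      obtain ⟨k, hk⟩ := exists_mem_vBall x
      exact Set.mem_iUnion.2 ⟨k, hk⟩) hdir
  exact ⟨C, hC⟩

lemma exists_subset_pBall {A : Set F} (hA : IsCompact A) :
    ∃ C : ℤ, A ⊆ (pBall F C : Set F) := by
  have hdir : Directed (· ⊆ ·) fun k : ℤ => (pBall F k : Set F) :=
    directed_of_isDirected_ge fun _ _ h => pBall_anti h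
  obtain ⟨C, hC⟩ := hA.elim_directed_cover (fun k : ℤ => (pBall F k : Set F))
    (fun k => isOpen_pBall k) (fun x _ => by
      obtain ⟨k, hk⟩ := exists_mem_pBall x
      exact Set.mem_iUnion.2 ⟨k, hk⟩) hdir
  exact ⟨C, hC⟩

lemma exists_vBall_invariant_set {A : Set (Fin n → F)} (h1 : IsCompact A) (h2 : IsOpen A) :
    ∃ l : ℤ, ∀ x, ∀ u ∈ vBall F n l, x + u ∈ A ↔ x ∈ A := by
  obtain ⟨l, hl⟩ := exists_vBall_invariant (indicator_const_mem_schwartz h1 h2 (1 : ℚ))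
  refine ⟨l, fun x u hu => ?_⟩
  have := hl x u hu
  by_cases hx : x ∈ A <;> by_cases hx' : x + u ∈ A <;> simp_all

lemma exists_pBall_invariant_set {A : Set F} (h1 : IsCompact A) (h2 : IsOpen A) :
    ∃ l : ℕ, ∀ x, ∀ u ∈ pBall F l, x + u ∈ A ↔ x ∈ A := by
  obtain ⟨l, hl⟩ := exists_pBall_invariant (indicator_const_mem_schwartz h1 h2 (1 : ℚ))
  refine ⟨l, fun x u hu => ?_⟩
  have := hl x u hu
  by_cases hx : x ∈ A <;> by_cases hx' : x + u ∈ A <;> simp_all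

variable [MeasurableSpace F] [BorelSpace F]

lemma haarF_ne_top {A : Set F} (hA : IsCompact A) : haarF F A ≠ ∞ := hA.measure_lt_top.ne

lemma haarV_ne_top {A : Set (Fin n → F)} (hA : IsCompact A) : haarV F n A ≠ ∞ := hA.measure_lt_top.ne

/-- A translation-invariant function of a scalar is distributed evenly over cosets. -/
lemma haarF_real_pBall_succ (k : ℤ) :
    (haarF F).real (pBall F k : Set F) = resCard F * (haarF F).real (pBall F (k + 1) : Set F) := by
  classical
  obtain ⟨T, hT, h1, h2⟩ := exists_coset_reps F k
  have hU : (pBall F k : Set F) = ⋃ b ∈ T, (fun a => -b + a) ⁻¹' (pBall F (k + 1) : Set F) := by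
    ext a
    simp only [Set.mem_iUnion, Set.mem_preimage, SetLike.mem_coe, exists_prop]
    constructor
    · intro ha
      obtain ⟨b, hb, -⟩ := h2 a ha
      exact ⟨b, hb.1, by simpa [sub_eq_neg_add] using hb.2⟩
    · rintro ⟨b, hb, hab⟩
      have := add_mem (h1 b hb) (pBall_anti (by omega : k ≤ k + 1) hab)
      simpa using this
  have hm : ∀ b ∈ T, MeasurableSet ((fun a => -b + a) ⁻¹' (pBall F (k + 1) : Set F)) := fun b _ =>
    ((isOpen_pBall _).preimage (by fun_prop)).measurableSet
  have hμ : ∀ b : F, haarF F ((fun a => -b + a) ⁻¹' (pBall F (k + 1) : Set F)) =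
      haarF F (pBall F (k + 1) : Set F) := fun b => measure_preimage_add _ _ _
  rw [measureReal_def, hU, measure_biUnion_finset _ hm]
  · simp_rw [hμ]
    rw [Finset.sum_const, nsmul_eq_mul, hT, ENNReal.toReal_mul, measureReal_def]
    simp
  · intro b hb c hc hbc
    refine Set.disjoint_left.2 fun a ha ha' => hbc ?_
    have hbk : a ∈ pBall F k := by
      have := add_mem (h1 b hb) (pBall_anti (by omega : k ≤ k + 1) ha)
      simpa using this
    exact (h2 a hbk).unique ⟨hb, by simpa [sub_eq_neg_add] using ha⟩
      ⟨hc, by simpa [sub_eq_neg_add] using ha'⟩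

lemma haarF_real_pBall (k : ℤ) : (haarF F).real (pBall F k : Set F) = (resCard F : ℝ) ^ (-k) := by
  have hq := (resCard_pos F).ne'
  induction k using Int.induction_on with
  | zero =>
    have : (pBall F 0 : Set F) = (𝒪[F] : Set F) := Set.ext fun a => mem_pBall_zero
    have h2 : haarF F (𝒪[F] : Set F) = 1 := Measure.addHaarMeasure_self (K₀ := integerCompacts F)
    rw [this, measureReal_def, h2]
    simp
  | succ k ih =>
    have := haarF_real_pBall_succ (F := F) k
    rw [ih] at this
    rw [neg_add, zpow_add₀ hq, this]
    field_simp
  | pred k ih =>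
    have := haarF_real_pBall_succ (F := F) (-k - 1)
    rw [sub_add_cancel, ih] at this
    rw [this, show -(-(k : ℤ) - 1) = 1 + - -(k : ℤ) by ring, zpow_add₀ hq, zpow_one]

lemma haarV_real_vBall (k : ℤ) :
    (haarV F n).real (vBall F n k : Set (Fin n → F)) = ((resCard F : ℝ) ^ (-k)) ^ n := by
  rw [measureReal_def, coe_vBall, haarV, Measure.pi_pi, ENNReal.toReal_prod]
  have := haarF_real_pBall (F := F) k
  rw [measureReal_def] at this
  simp [this]

/-- A compact open set is a finite union of cosets of a small ball, and balls have volume a power of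
q. -/
lemma haarV_rat {A : Set (Fin n → F)} (h1 : IsCompact A) (h2 : IsOpen A) :
    ∃ a : ℚ, (a : ℝ) = (haarV F n).real A := by
  obtain ⟨l, hl⟩ := exists_vBall_invariant_set h1 h2
  obtain ⟨N, hN⟩ := exists_measure_eq_mul (haarV F n) (vBall F n l) (isOpen_vBall l) h1
    fun a ha u hu => (hl a u hu).2 ha
  refine ⟨N * ((resCard F : ℚ) ^ (-l)) ^ n, ?_⟩
  rw [measureReal_def, hN, ENNReal.toReal_mul, ← measureReal_def, haarV_real_vBall]
  simp

lemma haarF_rat {A : Set F} (h1 : IsCompact A) (h2 : IsOpen A) :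
    ∃ a : ℚ, (a : ℝ) = (haarF F).real A := by
  obtain ⟨l, hl⟩ := exists_pBall_invariant_set h1 h2
  obtain ⟨N, hN⟩ := exists_measure_eq_mul (haarF F) (pBall F l) (isOpen_pBall l) h1
    fun a ha u hu => (hl a u hu).2 ha
  refine ⟨N * (resCard F : ℚ) ^ (-(l : ℤ)), ?_⟩
  rw [measureReal_def, hN, ENNReal.toReal_mul, ← measureReal_def, haarF_real_pBall]
  simp

end Haar

/-! ### Hyperplane measures as normalized volumes of thin slabs. -/

section Slab

variable {F : Type*} [Field F] [ValuativeRel F] [TopologicalSpace F] [IsNonarchimedeanLocalField F]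
variable {n : ℕ}

/-- The thickened hyperplane `ξ · x ∈ t + 𝔭 ^ k`. -/
def slab (ξ : Fin n → F) (k : ℤ) (t : F) : Set (Fin n → F) := {x | ξ ⬝ᵥ x - t ∈ pBall F k}

lemma mem_slab {ξ : Fin n → F} {k : ℤ} {t : F} {x : Fin n → F} :
    x ∈ slab ξ k t ↔ ξ ⬝ᵥ x - t ∈ pBall F k := Iff.rfl

lemma continuous_dotProduct_left (ξ : Fin n → F) : Continuous fun x : Fin n → F => ξ ⬝ᵥ x := by
  unfold dotProduct
  fun_prop

lemma isClopen_slab (ξ : Fin n → F) (k : ℤ) (t : F) : IsClopen (slab ξ k t) :=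
  IsClopen.preimage ⟨isClosed_pBall k, isOpen_pBall k⟩
    ((continuous_dotProduct_left ξ).sub continuous_const)

lemma pBall_coset {k : ℤ} {a c d : F}
    (h : c - d ∈ pBall F k) :
    a - c ∈ pBall F k ↔ a - d ∈ pBall F k := by
  have := (add_mem_cancel_right (y := a - c) h).symm
  rwa [sub_add_sub_cancel] at this

lemma one_notMem_pBall {k : ℤ} (hk : 1 ≤ k) : (1 : F) ∉ pBall F k := by
  rw [mem_pBall, absV_one, ← zpow_zero (resCard F : ℝ≥0),
    zpow_le_zpow_iff_right₀ (one_lt_resCard_nnreal F)]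
  omega

/-- Slabs around a nonzero value of `ξ · x` avoid small vectors. -/
lemma slab_one_val {ξ : Fin n → F} {v k : ℤ} (hξ : HasVal ξ v) (hk : 1 ≤ k) {x : Fin n → F}
    (hx : x ∈ slab ξ k 1) : x ∉ vBall F n (1 - v) := by
  intro h
  have h1 := dot_mem_pBall (hξ.mem_iff.2 le_rfl) h
  rw [show v + (1 - v) = 1 by ring] at h1
  have h2 := pBall_anti hk (mem_slab.1 hx)
  have h3 := sub_mem h1 h2
  rw [sub_sub_cancel] at h3
  exact one_notMem_pBall le_rfl h3

variable [MeasurableSpace F] [BorelSpace F]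

lemma hyperMeasure_add_dot (ξ : Punctured F n) (t : F) (v : Fin n → F) :
    hyperMeasure ξ (t + ξ.1 ⬝ᵥ v) = (hyperMeasure ξ t).map (· + v) := by
  have hT : Measurable fun x : Fin n → F => x + v := by fun_prop
  ext A hA
  rw [hyperMeasure, hyperMeasure, Measure.map_apply (continuous_hyperProj ξ _).measurable hA,
    Measure.map_apply hT hA, Measure.map_apply (continuous_hyperProj ξ _).measurable (hT hA),
    Measure.restrict_apply ((continuous_hyperProj ξ _).measurable hA),
    Measure.restrict_apply ((continuous_hyperProj ξ _).measurable (hT hA)),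
    ← measure_preimage_add_right (haarV F n) v]
  congr 1
  have h1 : ∀ x : Fin n → F, ξ.1 ⬝ᵥ (x + v) - (t + ξ.1 ⬝ᵥ v) = ξ.1 ⬝ᵥ x - t := by
    intro x
    rw [dotProduct_add]
    ring
  have h2 : ∀ x : Fin n → F, hyperProj ξ (t + ξ.1 ⬝ᵥ v) (x + v) = hyperProj ξ t x + v := by
    intro x
    rw [hyperProj, h1, hyperProj]
    abel
  ext x
  simp only [Set.mem_inter_iff, Set.mem_preimage, Set.mem_ofPred_eq, h1, h2]

lemma hyperMeasure_apply_add_dot (ξ : Punctured F n) (t : F) {v : Fin n → F} {A : Set (Fin n → F)}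
    (hA : MeasurableSet A) (hv : ∀ x, x + v ∈ A ↔ x ∈ A) :
    hyperMeasure ξ (t + ξ.1 ⬝ᵥ v) A = hyperMeasure ξ t A := by
  rw [hyperMeasure_add_dot, Measure.map_apply (by fun_prop) hA]
  congr 1
  ext x
  exact hv x

/-- Disintegration of A ∩ slab: each hyperplane ξ · x = s lies entirely inside the slab or entirely
outside it. -/
lemma lintegral_hyperMeasure_slab (ξ : Punctured F n) (k : ℤ) (t : F) {A : Set (Fin n → F)}
    (hA : MeasurableSet A) :
    ∫⁻ s in {s | s - t ∈ pBall F k}, hyperMeasure ξ s A ∂(haarF F) =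
      haarV F n (A ∩ slab ξ.1 k t) := by
  have hS : MeasurableSet {s : F | s - t ∈ pBall F k} :=
    ((isOpen_pBall k).preimage (continuous_id.sub continuous_const)).measurableSet
  rw [← hyperMeasure_disintegration ξ (hA.inter (isClopen_slab ξ.1 k t).isOpen.measurableSet),
    ← lintegral_indicator hS]
  refine lintegral_congr fun s => ?_
  have h0 : ∀ B : Set (Fin n → F), hyperMeasure ξ s B = hyperMeasure ξ s (B ∩ {x | ξ.1 ⬝ᵥ x = s}) := by
    intro B
    exact (measure_inter_conull (hyperMeasure_concentrated ξ s)).symm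
  by_cases hs : s - t ∈ pBall F k
  · rw [Set.indicator_of_mem (by exact hs), h0 A, h0 (A ∩ slab ξ.1 k t)]
    congr 1
    refine Set.ext fun x => ?_
    simp only [Set.mem_inter_iff, Set.mem_ofPred_eq, mem_slab]
    constructor
    · rintro ⟨h1, rfl⟩
      exact ⟨⟨h1, hs⟩, rfl⟩
    · rintro ⟨⟨h1, -⟩, h2⟩
      exact ⟨h1, h2⟩
  · rw [Set.indicator_of_notMem (by exact hs), h0 (A ∩ slab ξ.1 k t)]
    symm
    convert measure_empty (μ := hyperMeasure ξ s)
    ext x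
    simp only [Set.mem_inter_iff, Set.mem_ofPred_eq, mem_slab, Set.mem_empty_iff_false, iff_false]
    rintro ⟨⟨-, h1⟩, rfl⟩
    exact hs h1

lemma haarF_coset (k : ℤ) (t : F) : haarF F {s | s - t ∈ pBall F k} = haarF F (pBall F k : Set F) := by
  rw [← measure_preimage_add (haarF F) (-t) (pBall F k : Set F)]
  congr 1
  ext s
  simp [sub_eq_neg_add]

/-- The measure of a set on a hyperplane is the normalized measure of its intersection with a
sufficiently thin slab. -/
lemma hyperMeasure_mul_haarF {ξ : Punctured F n} {v l k : ℤ} (hξ : HasVal ξ.1 v) (hk : l + v ≤ k)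
    (t : F) {A : Set (Fin n → F)} (hA : MeasurableSet A)
    (hl : ∀ x, ∀ u ∈ vBall F n l, x + u ∈ A ↔ x ∈ A) :
    hyperMeasure ξ t A * haarF F (pBall F k : Set F) = haarV F n (A ∩ slab ξ.1 k t) := by
  rw [← lintegral_hyperMeasure_slab ξ k t hA, ← haarF_coset k t, ← setLIntegral_const]
  refine (setLIntegral_congr_fun ?_ ?_).symm
  -- The integrand is constant on the coset: every s in t + 𝔭^k is reached from t by a translation
  -- that preserves A.
  · exact ((isOpen_pBall k).preimage (continuous_id.sub continuous_const)).measurableSet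
  · intro s hs
    obtain ⟨u, hu, hus⟩ := hξ.exists_dot_eq (show s - t ∈ pBall F k from hs)
    have : s = t + ξ.1 ⬝ᵥ u := by rw [hus]; ring
    show hyperMeasure ξ s A = _
    rw [this]
    exact hyperMeasure_apply_add_dot ξ t hA fun x => hl x u (vBall_anti (by omega) hu)

lemma hyperMeasure_real_eq {ξ : Punctured F n} {v l k : ℤ} (hξ : HasVal ξ.1 v) (hk : l + v ≤ k)
    (t : F) {A : Set (Fin n → F)} (hA : MeasurableSet A)
    (hl : ∀ x, ∀ u ∈ vBall F n l, x + u ∈ A ↔ x ∈ A) :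
    (hyperMeasure ξ t).real A = (resCard F : ℝ) ^ k * (haarV F n).real (A ∩ slab ξ.1 k t) := by
  rw [measureReal_def, measureReal_def, ← hyperMeasure_mul_haarF hξ hk t hA hl, ENNReal.toReal_mul,
    ← measureReal_def (haarF F), haarF_real_pBall, zpow_neg, mul_comm, mul_assoc,
    inv_mul_cancel₀ (zpow_ne_zero _ (resCard_pos F).ne'), mul_one]

lemma hyperMeasure_compactOpen (ξ : Punctured F n) (t : F) {A : Set (Fin n → F)} (h1 : IsCompact A)
    (h2 : IsOpen A) : hyperMeasure ξ t A ≠ ∞ ∧ ∃ a : ℚ, (a : ℝ) = (hyperMeasure ξ t).real A := by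
  obtain ⟨v, hv⟩ := exists_hasVal ξ.2
  obtain ⟨l, hl⟩ := exists_vBall_invariant_set h1 h2
  have hs := isClopen_slab ξ.1 (l + v) t
  have hc : IsCompact (A ∩ slab ξ.1 (l + v) t) := h1.inter_right hs.isClosed
  constructor
  · intro htop
    have h3 := hyperMeasure_mul_haarF hv le_rfl t h2.measurableSet hl
    rw [htop, ENNReal.top_mul] at h3
    · exact haarV_ne_top hc h3.symm
    · exact ((isOpen_pBall _).measure_pos _ ⟨0, zero_mem _⟩).ne'
  · obtain ⟨a, ha⟩ := haarV_rat hc (h2.inter hs.isOpen)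
    refine ⟨(resCard F : ℚ) ^ (l + v) * a, ?_⟩
    rw [hyperMeasure_real_eq hv le_rfl t h2.measurableSet hl, ← ha]
    simp

lemma isRatAdd_hyperMeasure (ξ : Punctured F n) (t : F) : IsRatAdd (hyperMeasure ξ t).real :=
  isRatAdd_measure (fun _ h1 h2 => (hyperMeasure_compactOpen ξ t h1 h2).1)
    fun _ h1 h2 => (hyperMeasure_compactOpen ξ t h1 h2).2

lemma radon_add {E : Type*} [Field E] [CharZero E] {f g : (Fin n → F) → E}
    (hf : f ∈ schwartz (Fin n → F) E) (hg : g ∈ schwartz (Fin n → F) E) (ξ : Punctured F n) (t : F) :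
    radon (f + g) ξ t = radon f ξ t + radon g ξ t :=
  (isRatAdd_hyperMeasure ξ t).setSum_add hf hg

lemma radon_smul {E : Type*} [Field E] [CharZero E] (c : E) {f : (Fin n → F) → E}
    (hf : f ∈ schwartz (Fin n → F) E) (ξ : Punctured F n) (t : F) :
    radon (c • f) ξ t = c * radon f ξ t :=
  (isRatAdd_hyperMeasure ξ t).setSum_smul c hf

lemma radon_map {E E' : Type*} [Field E] [Field E'] (σ : E →+* E') (f : (Fin n → F) → E)
    (ξ : Punctured F n) (t : F) : radon (σ ∘ f) ξ t = σ (radon f ξ t) :=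
  setSum_map σ (by simp) f

lemma radon_congr {E : Type*} [Field E] {f g : (Fin n → F) → E} {ξ : Punctured F n} {t : F}
    (h : ∀ x, ξ.1 ⬝ᵥ x = t → f x = g x) : radon f ξ t = radon g ξ t := by
  unfold radon eInt
  refine finsum_congr fun e => ?_
  have : hyperMeasure ξ t (f ⁻¹' {e}) = hyperMeasure ξ t (g ⁻¹' {e}) := by
    refine measure_congr ?_
    have h0 : ∀ᵐ x ∂(hyperMeasure ξ t), ξ.1 ⬝ᵥ x = t := by
      rw [ae_iff]
      exact hyperMeasure_concentrated ξ t
    filter_upwards [h0] with x hx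
    have : f x = g x := h x hx
    exact propext (by
      show f x = e ↔ g x = e
      rw [this])
  rw [measureReal_def, measureReal_def, this]

lemma radon_zero {E : Type*} [Field E] (ξ : Punctured F n) (t : F) :
    radon (0 : (Fin n → F) → E) ξ t = 0 := by
  unfold radon eInt
  refine (finsum_congr fun e => ?_).trans finsum_zero
  by_cases he : e = 0
  · simp [he]
  · have : (0 : (Fin n → F) → E) ⁻¹' {e} = ∅ := by
      ext x
      simpa using Ne.symm he
    rw [this]
    simp [ratOf_zero]

lemma radon_add_dot {E : Type*} [Field E] {h : (Fin n → F) → E} (hh : IsLocallyConstant h)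
    (ξ : Punctured F n) (t : F) {u : Fin n → F} (hu : ∀ x, h (x + u) = h x) :
    radon h ξ (t + ξ.1 ⬝ᵥ u) = radon h ξ t := by
  unfold radon eInt
  refine finsum_congr fun e => ?_
  rw [measureReal_def, measureReal_def,
    hyperMeasure_apply_add_dot ξ t (A := h ⁻¹' {e}) (hh.isOpen_fiber e).measurableSet fun x => by
      simp [hu x]]

/-- Invariance of the Radon transform in the second variable. -/
lemma radon_invariant {E : Type*} [Field E] {h : (Fin n → F) → E} (hh : IsLocallyConstant h)
    {ξ : Punctured F n} {v l k : ℤ} (hξ : HasVal ξ.1 v) (hk : l + v ≤ k)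
    (hl : ∀ x, ∀ u ∈ vBall F n l, h (x + u) = h x) (t c : F) (hc : c ∈ pBall F k) :
    radon h ξ (t + c) = radon h ξ t := by
  obtain ⟨u, hu, rfl⟩ := hξ.exists_dot_eq hc
  exact radon_add_dot hh ξ t fun x => hl x u (vBall_anti (by omega) hu)

lemma radon_real {h : (Fin n → F) → ℝ} (hh : h ∈ schwartz (Fin n → F) ℝ) (ξ : Punctured F n)
    (t : F) : radon h ξ t = ∫ x, h x ∂(hyperMeasure ξ t) :=
  eInt_real (isRatAdd_hyperMeasure ξ t) (fun _ h1 h2 => (hyperMeasure_compactOpen ξ t h1 h2).1) hh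

end Slab

/-! ### Isometries -/

section Isometry

variable {F : Type*} [Field F] [ValuativeRel F] [TopologicalSpace F] [IsNonarchimedeanLocalField F]
variable {n : ℕ} [MeasurableSpace F] [BorelSpace F]

/-- A continuous additive automorphism preserving the standard lattice preserves Haar measure. -/
lemma measurePreserving_of_vBall (e : (Fin n → F) ≃ₜ+ (Fin n → F))
    (he : ∀ x, e x ∈ vBall F n 0 ↔ x ∈ vBall F n 0) :
    MeasurePreserving e (haarV F n) (haarV F n) := by
  refine ⟨e.continuous.measurable, ?_⟩
  have : ((haarV F n).map e).IsAddHaarMeasure := e.isAddHaarMeasure_map (haarV F n)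
  have h1 := Measure.isAddLeftInvariant_eq_smul ((haarV F n).map e) (haarV F n)
  set c := Measure.addHaarScalarFactor ((haarV F n).map e) (haarV F n)
  have h2 : (haarV F n).map e (vBall F n 0 : Set (Fin n → F)) = haarV F n (vBall F n 0 : Set (Fin n → F)) := by
    refine (Measure.map_apply e.continuous.measurable (isOpen_vBall 0).measurableSet).trans ?_
    congr 1
    ext x
    exact he x
  rw [h1, Measure.smul_apply] at h2
  have h3 : haarV F n (vBall F n 0 : Set (Fin n → F)) ≠ 0 :=
    ((isOpen_vBall 0).measure_pos _ ⟨0, zero_mem _⟩).ne'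
  have h4 := haarV_ne_top (F := F) (n := n) (isCompact_vBall 0)
  have h5 : (c : ℝ≥0∞) = 1 := by
    have : (c : ℝ≥0∞) * haarV F n (vBall F n 0 : Set (Fin n → F)) =
        1 * haarV F n (vBall F n 0 : Set (Fin n → F)) := by
      rw [one_mul]
      exact h2
    exact (ENNReal.mul_left_inj h3 h4).1 this
  have h6 : c = 1 := by exact_mod_cast h5
  rw [h1, h6, one_smul]

/-- A perturbation of the identity moving `ξ` to `ξ + η`. -/
lemma exists_isometry {ξ η : Fin n → F} {v : ℤ} {r : ℕ} (hr : 1 ≤ r) (hξ : HasVal ξ v)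
    (hη : η ∈ vBall F n (v + r)) : ∃ e : (Fin n → F) ≃ₜ+ (Fin n → F),
      MeasurePreserving e (haarV F n) (haarV F n) ∧ (∀ x, ξ ⬝ᵥ e x = (ξ + η) ⬝ᵥ x) ∧
      ∀ x k, x ∈ vBall F n k → e x - x ∈ vBall F n (k + r) := by
  obtain ⟨i, hi⟩ := hξ.exists_coord
  have hi0 := ne_zero_of_absV hi
  set w : Fin n → F := Pi.single i (ξ i)⁻¹ with hw
  have hwv : w ∈ vBall F n (-v) := single_mem_vBall ((mem_pBall_of_eq (absV_inv_eq hi)).2 le_rfl) i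
  have hξw : ξ ⬝ᵥ w = 1 := by simp [hw, mul_inv_cancel₀ hi0]
  have hηw : η ⬝ᵥ w ∈ pBall F 1 := by
    have := dot_mem_pBall hη hwv
    exact pBall_anti (by omega) this
  have hu : 1 + η ⬝ᵥ w ≠ 0 := by
    intro h0
    have h1 : (1 : F) ∈ pBall F 1 := by
      rw [eq_neg_of_add_eq_zero_left h0]
      exact neg_mem hηw
    exact one_notMem_pBall le_rfl h1
  have hc := continuous_dotProduct_left η
  -- As ξ · w = 1, the map x ↦ x + (η · x) w pulls the functional ξ back to ξ + η. It is invertible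
  -- because η · w lies in 𝔭, so 1 + η · w is nonzero.
  let e : (Fin n → F) ≃ₜ+ (Fin n → F) :=
    { toFun := fun x => x + (η ⬝ᵥ x) • w
      invFun := fun y => y - ((η ⬝ᵥ y) / (1 + η ⬝ᵥ w)) • w
      left_inv := fun x => by
        simp only [dotProduct_add, dotProduct_smul, smul_eq_mul]
        rw [show (η ⬝ᵥ x + η ⬝ᵥ x * η ⬝ᵥ w) / (1 + η ⬝ᵥ w) = η ⬝ᵥ x by field_simp]
        abel
      right_inv := fun y => by
        simp only [dotProduct_sub, dotProduct_smul, smul_eq_mul]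
        rw [show η ⬝ᵥ y - η ⬝ᵥ y / (1 + η ⬝ᵥ w) * η ⬝ᵥ w = η ⬝ᵥ y / (1 + η ⬝ᵥ w) by
          field_simp; ring]
        abel
      map_add' := fun x y => by
        rw [dotProduct_add, add_smul]
        abel
      continuous_toFun := by fun_prop
      continuous_invFun := by fun_prop }
  have he : ∀ x, e x = x + (η ⬝ᵥ x) • w := fun _ => rfl
  have hsmall : ∀ x k, x ∈ vBall F n k → e x - x ∈ vBall F n (k + r) := by
    intro x k hx
    rw [he, add_sub_cancel_left]
    have := smul_mem_vBall (dot_mem_pBall hη hx) hwv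
    convert this using 2
    ring
  refine ⟨e, measurePreserving_of_vBall e fun x => ?_, fun x => ?_, hsmall⟩
  · by_cases hx : x = 0
    · subst hx
      simp
    · obtain ⟨u, hu⟩ := exists_hasVal hx
      have h1 := hsmall x u (hu.mem_iff.2 le_rfl)
      have h2 : HasVal (e x) u := by
        have := hu.add (vBall_anti (by omega : u + 1 ≤ u + r) h1)
        rwa [add_sub_cancel] at this
      rw [h2.mem_iff, hu.mem_iff]
  · rw [he, dotProduct_add, dotProduct_smul, hξw, add_dotProduct, smul_eq_mul, mul_one]

end Isometry

/-! ### Functions invariant under relatively small translations -/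

section HomInv

variable {F : Type*} [Field F] [ValuativeRel F] [TopologicalSpace F] [IsNonarchimedeanLocalField F]
variable {n : ℕ} {E : Type*} [Field E]

/-- `f (x + u) = f x` whenever `‖u‖ ≤ q ^ (-r) ‖x‖`. -/
def HomInv (r : ℕ) (f : (Fin n → F) → E) : Prop :=
  ∀ x v, HasVal x v → ∀ u ∈ vBall F n (v + r), f (x + u) = f x

lemma HomInv.eventually_eq {r : ℕ} {f : (Fin n → F) → E} (h : HomInv r f) {x : Fin n → F}
    (hx : x ≠ 0) : ∀ᶠ y in nhds x, f y = f x := by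
  obtain ⟨v, hv⟩ := exists_hasVal hx
  have h1 : (fun y => y - x) ⁻¹' (vBall F n (v + r) : Set (Fin n → F)) ∈ nhds x := by
    refine ((isOpen_vBall (F := F) (n := n) (v + r)).preimage (by fun_prop)).mem_nhds ?_
    simp
  filter_upwards [h1] with y hy
  have := h x v hv (y - x) hy
  rwa [add_sub_cancel] at this

lemma HomInv.indicator {r : ℕ} (hr : 1 ≤ r) {f : (Fin n → F) → E} (h : HomInv r f)
    {A : Set (Fin n → F)} (hA : ∀ x v, HasVal x v → ∀ u ∈ vBall F n (v + 1), x + u ∈ A ↔ x ∈ A) :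
    HomInv r (A.indicator f) := by
  intro x v hx u hu
  have h1 := hA x v hx u (vBall_anti (by omega) hu)
  by_cases hxA : x ∈ A
  · rw [Set.indicator_of_mem hxA, Set.indicator_of_mem (h1.2 hxA), h x v hx u hu]
  · rw [Set.indicator_of_notMem hxA, Set.indicator_of_notMem (fun h' => hxA (h1.1 h'))]

lemma vBall_hom (k : ℤ) (x : Fin n → F) (v : ℤ) (hx : HasVal x v) (u : Fin n → F)
    (hu : u ∈ vBall F n (v + 1)) :
    x + u ∈ (vBall F n k : Set (Fin n → F)) ↔ x ∈ (vBall F n k : Set (Fin n → F)) := by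
  rw [SetLike.mem_coe, SetLike.mem_coe, (hx.add hu).mem_iff, hx.mem_iff]

lemma vBall_compl_hom (k : ℤ) (x : Fin n → F) (v : ℤ) (hx : HasVal x v) (u : Fin n → F)
    (hu : u ∈ vBall F n (v + 1)) :
    x + u ∈ (vBall F n k : Set (Fin n → F))ᶜ ↔ x ∈ (vBall F n k : Set (Fin n → F))ᶜ :=
  not_congr (vBall_hom k x v hx u hu)

/-- A function with homogeneous invariance, vanishing near the origin and outside of a compact set,
is a test function. -/
lemma HomInv.mem_schwartz {r : ℕ} {f : (Fin n → F) → E} (h : HomInv r f) {c C : ℤ}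
    (hc : ∀ x ∈ vBall F n c, f x = 0) (hC : ∀ x, f x ≠ 0 → x ∈ vBall F n C) :
    f ∈ schwartz (Fin n → F) E := by
  have hlc : IsLocallyConstant f := by
    rw [IsLocallyConstant.iff_eventually_eq]
    intro x
    by_cases hx : x = 0
    · subst hx
      filter_upwards [(isOpen_vBall (F := F) (n := n) c).mem_nhds (zero_mem _)] with y hy
      rw [hc y hy, hc 0 (zero_mem _)]
    · exact h.eventually_eq hx
  exact ⟨hlc, (isCompact_vBall C).of_isClosed_subset (hlc.isOpen_fiber 0).isClosed_compl hC⟩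

/-- A test function vanishing at the origin has homogeneous invariance. -/
lemma exists_homInv {f : (Fin n → F) → E} (hf : f ∈ schwartz (Fin n → F) E) :
    ∃ r : ℕ, 1 ≤ r ∧ HomInv r f := by
  obtain ⟨C, hC⟩ := exists_subset_vBall hf.2
  obtain ⟨l, hl⟩ := exists_vBall_invariant hf
  -- If v ≥ C then v + r ≥ l and plain invariance applies; if v < C then x and x + u are both
  -- outside the support. The extra 1 keeps the valuation of x + u equal to v.
  refine ⟨(l - C).toNat + 1, by omega, fun x v hx u hu => ?_⟩
  by_cases hv : C ≤ v
  · exact hl x u (vBall_anti (by omega) hu)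
  · have h0 : ∀ y, HasVal y v → f y = 0 := by
      intro y hy
      by_contra h
      exact hv (hy.mem_iff.1 (hC h))
    rw [h0 x hx, h0 _ (hx.add (vBall_anti (by omega) hu))]

variable [MeasurableSpace F] [BorelSpace F]

/-- The Radon transform of a function with homogeneous invariance has the same invariance in `ξ`. -/
lemma radon_homInv {r : ℕ} (hr : 1 ≤ r) {h : (Fin n → F) → E} (hh : h ∈ schwartz (Fin n → F) E)
    (hi : HomInv r h) {ξ η : Punctured F n} {v : ℤ} (hξ : HasVal ξ.1 v)
    (hη : η.1 - ξ.1 ∈ vBall F n (v + r)) (t : F) : radon h η t = radon h ξ t := by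
  -- The isometry e moves each vector relatively so little that it preserves h, while it matches the
  -- slabs of η with those of ξ.
  obtain ⟨e, he, hdot, hsmall⟩ := exists_isometry hr hξ hη
  have hη' : HasVal η.1 v := by
    have := hξ.add (vBall_anti (by omega : v + 1 ≤ v + r) hη)
    rwa [add_sub_cancel] at this
  have hinv : ∀ x, h (e x) = h x := by
    intro x
    by_cases hx : x = 0
    · rw [hx, map_zero]
    · obtain ⟨w, hw⟩ := exists_hasVal hx
      have := hi x w hw _ (hsmall x w (hw.mem_iff.2 le_rfl))
      rwa [add_sub_cancel] at this
  obtain ⟨l, hl⟩ := exists_vBall_invariant hh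
  unfold radon eInt
  refine finsum_congr fun a => ?_
  have hA : MeasurableSet (h ⁻¹' {a}) := (hh.1.isOpen_fiber a).measurableSet
  have hl' : ∀ x, ∀ u ∈ vBall F n l, x + u ∈ h ⁻¹' {a} ↔ x ∈ h ⁻¹' {a} := fun x u hu => by
    simp [hl x u hu]
  rw [hyperMeasure_real_eq hξ le_rfl t hA hl', hyperMeasure_real_eq hη' le_rfl t hA hl',
    measureReal_def, measureReal_def,
    ← he.measure_preimage (hA.inter (isClopen_slab ξ.1 (l + v) t).isOpen.measurableSet).nullMeasurableSet]
  congr 6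
  ext x
  simp only [Set.mem_inter_iff, Set.mem_preimage, Set.mem_singleton_iff, mem_slab, hinv, hdot,
    add_sub_cancel]

end HomInv

/-! ### The regularized integral against |s|^(-n) and its expansion over shells. -/

section AbsPow

variable {F : Type*} [Field F] [ValuativeRel F] [TopologicalSpace F] [IsNonarchimedeanLocalField F]

lemma absV_add_eq {s u : F} {v : ℤ} (hs : absV s = (resCard F : ℝ≥0) ^ (-v)) (hu : u ∈ pBall F (v + 1)) :
    absV (s + u) = (resCard F : ℝ≥0) ^ (-v) := by
  rw [absV_eq_iff] at hs ⊢
  exact ⟨add_mem hs.1 (pBall_anti (by omega) hu), fun h => hs.2 ((add_mem_cancel_right hu).1 h)⟩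

lemma absV_eventually_eq {s : F} (hs : s ≠ 0) : ∀ᶠ t in nhds s, absV t = absV s := by
  obtain ⟨v, hv⟩ := exists_absV_eq_zpow hs
  have h1 : (fun t => t - s) ⁻¹' (pBall F (v + 1) : Set F) ∈ nhds s := by
    refine ((isOpen_pBall (F := F) (v + 1)).preimage (by fun_prop)).mem_nhds ?_
    simp
  filter_upwards [h1] with t ht
  have := absV_add_eq hv (show t - s ∈ pBall F (v + 1) from ht)
  rw [add_sub_cancel] at this
  rw [this, hv]

/-- The weight `|s| ^ (-n)`. -/
def wt (n : ℕ) (s : F) : ℝ := ((absV s : ℝ) ^ n)⁻¹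

lemma wt_eq (n : ℕ) {s : F} {v : ℤ} (hs : absV s = (resCard F : ℝ≥0) ^ (-v)) :
    wt n s = ((resCard F : ℝ) ^ v) ^ n := by
  rw [wt, hs]
  push_cast
  rw [zpow_neg, inv_pow, inv_inv]

lemma schwartz_shift {E : Type*} [Field E] {g : F → E} (hg : g ∈ schwartz F E) (a : F) :
    (fun s => g (s + a)) ∈ schwartz F E := by
  refine ⟨hg.1.comp_continuous (by fun_prop : Continuous fun s : F => s + a), ?_⟩
  exact (Homeomorph.addRight a).isCompact_preimage.2 hg.2

/-- The singularity of the weight at 0 is harmless because the other factor vanishes in a whole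
neighbourhood of 0. -/
lemma wt_mul_isLocallyConstant (n : ℕ) {g : F → ℝ} (hg : IsLocallyConstant g) :
    IsLocallyConstant fun s => wt n s * (g s - g 0) := by
  rw [IsLocallyConstant.iff_eventually_eq]
  intro s
  by_cases hs : s = 0
  · subst hs
    filter_upwards [hg.eventually_eq 0] with t ht
    simp [ht]
  · filter_upwards [hg.eventually_eq s, absV_eventually_eq hs] with t ht ht'
    rw [ht, wt, wt, ht']

lemma schwartz_bounded {g : F → ℝ} (hg : g ∈ schwartz F ℝ) : ∃ B, ∀ s, ‖g s‖ ≤ B := by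
  obtain ⟨T, -, -, hT⟩ := schwartz_values hg
  refine ⟨∑ e ∈ T, ‖e‖, fun s => ?_⟩
  by_cases h : g s ∈ T
  · exact Finset.single_le_sum (f := fun e => ‖e‖) (fun e _ => norm_nonneg e) h
  · rw [hT s h, norm_zero]
    exact Finset.sum_nonneg fun e _ => norm_nonneg e

variable [MeasurableSpace F] [BorelSpace F]

lemma haarF_real_shell (k : ℤ) : (haarF F).real ((pBall F k : Set F) \ pBall F (k + 1)) =
    (resCard F : ℝ) ^ (-k) * (1 - (resCard F : ℝ)⁻¹) := by
  rw [measureReal_sdiff (pBall_anti (by omega)) (isOpen_pBall _).measurableSet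
    (haarF_ne_top (isCompact_pBall _)), haarF_real_pBall, haarF_real_pBall, neg_add,
    zpow_add₀ (resCard_pos F).ne', zpow_neg_one]
  ring

variable (F) in
lemma pBall_compl_eq : (pBall F 0 : Set F)ᶜ =
    ⋃ j : ℕ, ((pBall F (-(j : ℤ) - 1) : Set F) \ pBall F (-(j : ℤ) - 1 + 1)) := by
  ext s
  simp only [Set.mem_compl_iff, SetLike.mem_coe, Set.mem_iUnion, Set.mem_sdiff]
  constructor
  · intro hs
    have h0 : s ≠ 0 := by
      rintro rfl
      exact hs (zero_mem _)
    obtain ⟨v, hv⟩ := exists_absV_eq_zpow h0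
    rw [mem_pBall_of_eq hv] at hs
    refine ⟨(-v - 1).toNat, ?_⟩
    rw [mem_pBall_of_eq hv, mem_pBall_of_eq hv]
    omega
  · rintro ⟨j, -, h⟩ h'
    exact h (pBall_anti (by omega) h')

lemma measurableSet_shell (k : ℤ) : MeasurableSet ((pBall F k : Set F) \ pBall F (k + 1)) :=
  (isOpen_pBall _).measurableSet.diff (isOpen_pBall _).measurableSet

lemma wt_shell {n : ℕ} {k : ℤ} {s : F} (hs : s ∈ (pBall F k : Set F) \ pBall F (k + 1)) :
    wt n s = ((resCard F : ℝ) ^ k) ^ n := wt_eq n (absV_eq_iff.2 hs)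

lemma setIntegral_wt_shell (n : ℕ) (k : ℤ) (g : F → ℝ) :
    ∫ s in (pBall F k : Set F) \ pBall F (k + 1), wt n s * g s ∂(haarF F) =
      ((resCard F : ℝ) ^ k) ^ n * ∫ s in (pBall F k : Set F) \ pBall F (k + 1), g s ∂(haarF F) := by
  rw [← integral_const_mul]
  exact setIntegral_congr_fun (measurableSet_shell k) fun s hs => by
    show wt n s * g s = _
    rw [wt_shell hs]

/-- The weight is integrable at infinity, with explicit integral. -/
lemma wt_tail {n : ℕ} (hn : 2 ≤ n) : IntegrableOn (wt n) (pBall F 0 : Set F)ᶜ (haarF F) ∧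
    ∫ s in (pBall F 0 : Set F)ᶜ, wt n s ∂(haarF F) =
      (1 - (resCard F : ℝ)⁻¹) / ((resCard F : ℝ) ^ (n - 1) - 1) := by
  have hq := one_lt_resCard_real F
  have hq0 := (resCard_pos F).ne'
  set q : ℝ := (resCard F : ℝ) with hqdef
  have hQ : 1 < q ^ (n - 1) := one_lt_pow₀ hq (by omega)
  -- On the shell |s| = q^(j+1) the weight is q^(-n(j+1)) and the volume q^(j+1) (1 - q⁻¹): a
  -- geometric series of ratio q^(-(n-1)), convergent because n ≥ 2.
  have hint : ∀ j : ℕ, ∫ s in ((pBall F (-(j : ℤ) - 1) : Set F) \ pBall F (-(j : ℤ) - 1 + 1)), wt n s ∂(haarF F) =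
      (1 - q⁻¹) * (q ^ (n - 1))⁻¹ * ((q ^ (n - 1))⁻¹) ^ j := by
    intro j
    have := setIntegral_wt_shell n (-(j : ℤ) - 1) (fun _ : F => (1 : ℝ))
    simp only [mul_one] at this
    rw [this, setIntegral_const, haarF_real_shell, smul_eq_mul, mul_one, ← hqdef]
    obtain ⟨m, rfl⟩ : ∃ m, n = m + 1 := ⟨n - 1, by omega⟩
    have e1 : q ^ (-(j : ℤ) - 1) = (q ^ (j + 1))⁻¹ := by
      rw [show -(j : ℤ) - 1 = -((j + 1 : ℕ) : ℤ) by push_cast; ring, zpow_neg, zpow_natCast]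
    have e2 : q ^ (-(-(j : ℤ) - 1)) = q ^ (j + 1) := by
      rw [zpow_neg, e1, inv_inv]
    rw [e1, e2, Nat.add_sub_cancel]
    simp only [inv_pow, pow_succ, mul_pow, ← pow_mul, mul_comm m j]
    field_simp
  have hm := fun j : ℕ => measurableSet_shell (F := F) (-(j : ℤ) - 1)
  have hnn : ∀ s : F, 0 ≤ wt n s := fun s => by unfold wt; positivity
  have hr1 : (q ^ (n - 1))⁻¹ < 1 := inv_lt_one_of_one_lt₀ hQ
  have hr0 : 0 ≤ (q ^ (n - 1))⁻¹ := by positivity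
  have hsum : HasSum (fun j : ℕ => (1 - q⁻¹) * (q ^ (n - 1))⁻¹ * ((q ^ (n - 1))⁻¹) ^ j)
      ((1 - q⁻¹) * (q ^ (n - 1))⁻¹ * (1 - (q ^ (n - 1))⁻¹)⁻¹) :=
    (hasSum_geometric_of_lt_one hr0 hr1).mul_left _
  have hIon : ∀ j : ℕ, IntegrableOn (wt n) ((pBall F (-(j : ℤ) - 1) : Set F) \ pBall F (-(j : ℤ) - 1 + 1)) (haarF F) := by
    intro j
    have : IntegrableOn (fun _ : F => ((q ^ (-(j : ℤ) - 1)) ^ n : ℝ))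
        ((pBall F (-(j : ℤ) - 1) : Set F) \ pBall F (-(j : ℤ) - 1 + 1)) (haarF F) :=
      integrableOn_const ((measure_mono Set.sdiff_subset).trans_lt
        (isCompact_pBall (F := F) _).measure_lt_top).ne
    exact this.congr_fun (fun s hs => (wt_shell hs).symm) (hm j)
  have hI : IntegrableOn (wt n) (pBall F 0 : Set F)ᶜ (haarF F) := by
    rw [pBall_compl_eq]
    refine integrableOn_iUnion_of_summable_integral_norm hIon ?_
    convert hsum.summable using 2 with j
    rw [← hint j]
    exact setIntegral_congr_fun (hm j) fun s _ => Real.norm_of_nonneg (hnn s)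
  refine ⟨hI, ?_⟩
  have h1 := hasSum_integral_iUnion (μ := haarF F) (f := wt n) hm ?_ (by rwa [← pBall_compl_eq])
  · rw [← pBall_compl_eq] at h1
    simp_rw [hint] at h1
    rw [h1.unique hsum]
    have : q ^ (n - 1) - 1 ≠ 0 := by linarith
    have h3 : q ^ (n - 1) ≠ 0 := by positivity
    field_simp
  · intro i j hij
    refine Set.disjoint_left.2 fun s hs hs' => hij ?_
    have := (absV_eq_iff.2 hs).symm.trans (absV_eq_iff.2 hs')
    rw [zpow_neg_inj] at this
    omega

/-- The regularized integral `∫ |s| ^ (-n) (g s - g 0) ds`. -/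
def regInt (n : ℕ) (g : F → ℝ) : ℝ := ∫ s, wt n s * (g s - g 0) ∂(haarF F)

lemma absPowIndicator_eq (n : ℕ) (A : Set F) :
    absPowIndicator n A = regInt n (A.indicator fun _ => 1) := rfl

lemma wt_mul_tail_integrable {n : ℕ} (hn : 2 ≤ n) {g : F → ℝ} (hg : g ∈ schwartz F ℝ) :
    IntegrableOn (fun s => wt n s * g s) (pBall F 0 : Set F)ᶜ (haarF F) := by
  obtain ⟨B, hB⟩ := schwartz_bounded hg
  refine (wt_tail hn).1.mul_bdd (c := B) ?_ (Filter.Eventually.of_forall hB)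
  exact hg.1.continuous.aestronglyMeasurable

lemma regInt_integrable {n : ℕ} (hn : 2 ≤ n) {g : F → ℝ} (hg : g ∈ schwartz F ℝ) :
    Integrable (fun s => wt n s * (g s - g 0)) (haarF F) := by
  rw [← integrableOn_univ, ← Set.union_compl_self (pBall F 0 : Set F)]
  refine IntegrableOn.union ?_ ?_
  · exact (wt_mul_isLocallyConstant n hg.1).continuous.continuousOn.integrableOn_compact
      (isCompact_pBall 0)
  · simp only [mul_sub]
    exact (wt_mul_tail_integrable hn hg).sub ((wt_tail hn).1.mul_const _)

/-- The subtraction of g(0) is only needed near 0. Off 𝒪 it contributes an explicit multiple of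
g(0), and what remains there will cancel in β. -/
lemma regInt_split {n : ℕ} (hn : 2 ≤ n) {g : F → ℝ} (hg : g ∈ schwartz F ℝ) :
    regInt n g = (∫ s in (pBall F 0 : Set F), wt n s * (g s - g 0) ∂(haarF F)) +
      (∫ s in (pBall F 0 : Set F)ᶜ, wt n s * g s ∂(haarF F)) -
      g 0 * ((1 - (resCard F : ℝ)⁻¹) / ((resCard F : ℝ) ^ (n - 1) - 1)) := by
  rw [regInt, ← integral_add_compl (isOpen_pBall (F := F) 0).measurableSet (regInt_integrable hn hg)]
  simp only [mul_sub]
  rw [integral_sub (f := fun s => wt n s * g s) (wt_mul_tail_integrable hn hg)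
    ((wt_tail hn).1.mul_const _), integral_mul_const, (wt_tail hn).2]
  ring

lemma regInt_add {n : ℕ} (hn : 2 ≤ n) {f g : F → ℝ} (hf : f ∈ schwartz F ℝ) (hg : g ∈ schwartz F ℝ) :
    regInt n (f + g) = regInt n f + regInt n g := by
  unfold regInt
  rw [← integral_add (regInt_integrable hn hf) (regInt_integrable hn hg)]
  congr 1
  ext s
  simp only [Pi.add_apply]
  ring

lemma regInt_smul (n : ℕ) (c : ℝ) (f : F → ℝ) :
    regInt n (c • f) = c * regInt n f := by
  unfold regInt
  rw [← integral_const_mul]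
  congr 1
  ext s
  simp only [Pi.smul_apply, smul_eq_mul]
  ring

lemma setIntegral_pBall_succ {n : ℕ} {g : F → ℝ} (hg : g ∈ schwartz F ℝ) (k : ℤ) :
    ∫ s in (pBall F k : Set F), wt n s * (g s - g 0) ∂(haarF F) =
      ((resCard F : ℝ) ^ k) ^ n * ((∫ s in (pBall F k : Set F), (g s - g 0) ∂(haarF F)) -
        ∫ s in (pBall F (k + 1) : Set F), (g s - g 0) ∂(haarF F)) +
      ∫ s in (pBall F (k + 1) : Set F), wt n s * (g s - g 0) ∂(haarF F) := by
  have hsub : (pBall F (k + 1) : Set F) ⊆ pBall F k := pBall_anti (by omega)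
  have hm := (isOpen_pBall (F := F) (k + 1)).measurableSet
  have hc : ∀ {f : F → ℝ}, IsLocallyConstant f → IntegrableOn f (pBall F k : Set F) (haarF F) :=
    fun hf => hf.continuous.continuousOn.integrableOn_compact (isCompact_pBall k)
  have h1 := hc (wt_mul_isLocallyConstant n hg.1)
  have h2 : IntegrableOn (fun s => g s - g 0) (pBall F k : Set F) (haarF F) :=
    hc (hg.1.comp (· - g 0))
  have h3 := setIntegral_wt_shell n k (fun s => g s - g 0)
  rw [setIntegral_sdiff hm h1 hsub, setIntegral_sdiff hm h2 hsub] at h3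
  linarith

lemma setIntegral_pBall_eq_zero {n : ℕ} {g : F → ℝ} {m : ℤ}
    (hm : ∀ u ∈ pBall F m, g u = g 0) :
    ∫ s in (pBall F m : Set F), wt n s * (g s - g 0) ∂(haarF F) = 0 := by
  refine (setIntegral_congr_fun (g := fun _ => 0) (isOpen_pBall m).measurableSet fun s hs => ?_).trans
    (by simp)
  simp [hm s hs]

/-- The normalized average over `a + 𝔭 ^ k`. -/
def avg (k : ℤ) (a : F) (g : F → ℝ) : ℝ :=
  (resCard F : ℝ) ^ k * ∫ s in {s | s - a ∈ pBall F k}, g s ∂(haarF F)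

lemma avg_eq_shift (k : ℤ) (a : F) (g : F → ℝ) :
    avg k a g = (resCard F : ℝ) ^ k * ∫ s in (pBall F k : Set F), g (s + a) ∂(haarF F) := by
  unfold avg
  have h1 : MeasurableSet {s : F | s - a ∈ pBall F k} :=
    ((isOpen_pBall k).preimage (continuous_id.sub continuous_const)).measurableSet
  rw [← integral_indicator h1, ← integral_indicator (isOpen_pBall k).measurableSet]
  refine congrArg _ ((integral_add_right_eq_self _ a).symm.trans ?_)
  refine integral_congr_ae (Filter.Eventually.of_forall fun s => ?_)
  have h2 : s + a ∈ {s : F | s - a ∈ pBall F k} ↔ s ∈ (pBall F k : Set F) := by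
    show s + a - a ∈ pBall F k ↔ s ∈ pBall F k
    rw [add_sub_cancel_right]
  by_cases hs : s ∈ (pBall F k : Set F)
  · exact (Set.indicator_of_mem (h2.2 hs) g).trans
      (Set.indicator_of_mem hs fun s => g (s + a)).symm
  · exact (Set.indicator_of_notMem (fun h => hs (h2.1 h)) g).trans
      (Set.indicator_of_notMem hs fun s => g (s + a)).symm

lemma avg_eq_of_invariant {k : ℤ} {a : F} {g : F → ℝ} (h : ∀ u ∈ pBall F k, g (a + u) = g a) :
    avg k a g = g a := by
  rw [avg_eq_shift, setIntegral_congr_fun (g := fun _ => g a) (isOpen_pBall k).measurableSet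
    (fun s hs => by
      show g (s + a) = g a
      rw [add_comm, h s hs]), setIntegral_const, haarF_real_pBall, smul_eq_mul, ← mul_assoc,
    ← zpow_add₀ (resCard_pos F).ne', add_neg_cancel, zpow_zero, one_mul]

lemma avg_congr {k : ℤ} {a b : F} (h : a - b ∈ pBall F k) (g : F → ℝ) : avg k a g = avg k b g := by
  unfold avg
  congr 3
  ext s
  exact pBall_coset h

lemma setIntegral_sub_const {g : F → ℝ} (hg : g ∈ schwartz F ℝ) (k : ℤ) (a : F) :
    ∫ s in (pBall F k : Set F), (g (s + a) - g (0 + a)) ∂(haarF F) =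
      (resCard F : ℝ) ^ (-k) * (avg k a g - g a) := by
  rw [integral_sub, setIntegral_const, haarF_real_pBall, avg_eq_shift, mul_sub, ← mul_assoc,
    ← zpow_add₀ (resCard_pos F).ne', neg_add_cancel, zpow_zero, one_mul, smul_eq_mul, zero_add]
  · exact (schwartz_shift hg a).1.continuous.continuousOn.integrableOn_compact (isCompact_pBall k)
  · exact integrableOn_const (haarF_ne_top (isCompact_pBall k))

/-- Peel off the shells one at a time, each expressed by averages over two consecutive balls;
nothing is left on 𝔭^m, where g(· + a) is constant. -/
lemma setIntegral_wt_sum {n : ℕ} {g : F → ℝ} (hg : g ∈ schwartz F ℝ) (a : F) {m : ℕ}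
    (hm : ∀ u ∈ pBall F m, g (u + a) = g (0 + a)) :
    ∫ s in (pBall F 0 : Set F), wt n s * (g (s + a) - g (0 + a)) ∂(haarF F) =
      ∑ k ∈ Finset.range m, ((resCard F : ℝ) ^ k) ^ n *
        ((resCard F : ℝ) ^ (-(k : ℤ)) * (avg k a g - g a) -
          (resCard F : ℝ) ^ (-((k : ℤ) + 1)) * (avg (k + 1) a g - g a)) := by
  have key : ∀ k : ℕ, (fun k : ℕ => ∫ s in (pBall F k : Set F),
      wt n s * (g (s + a) - g (0 + a)) ∂(haarF F)) k - (fun k : ℕ => ∫ s in (pBall F k : Set F),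
      wt n s * (g (s + a) - g (0 + a)) ∂(haarF F)) (k + 1) = ((resCard F : ℝ) ^ k) ^ n *
        ((resCard F : ℝ) ^ (-(k : ℤ)) * (avg k a g - g a) -
          (resCard F : ℝ) ^ (-((k : ℤ) + 1)) * (avg (k + 1) a g - g a)) := by
    intro k
    have := setIntegral_pBall_succ (n := n) (schwartz_shift hg a) k
    rw [setIntegral_sub_const hg, setIntegral_sub_const hg, zpow_natCast] at this
    simp only
    rw [this]
    push_cast
    ring
  rw [← Finset.sum_congr rfl fun k _ => key k, Finset.sum_range_sub']
  rw [setIntegral_pBall_eq_zero (g := fun s => g (s + a)) hm]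
  simp

/-- Summation by parts. The prefactor of β makes the coefficients of the differences pure powers of
Q and makes the tail term in d match the boundary term at m = 0. The boundary term at m vanishes in
the application, where D m = d. -/
lemma beta_telescope {q Q : ℝ} (hq : 1 < q) (hQ : 1 < Q) (D : ℕ → ℝ) (h0 : D 0 = 0) (d : ℝ) (m : ℕ) :
    (1 - Q) / (1 - (Q * q)⁻¹) * (∑ k ∈ Finset.range m, (Q ^ k * (D k - d) -
      Q ^ k * q⁻¹ * (D (k + 1) - d)) - d * ((1 - q⁻¹) / (Q - 1))) =
    ∑ k ∈ Finset.range m, Q ^ (k + 1) * (D (k + 1) - D k) -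
      (q - 1) * Q / (Q * q - 1) * Q ^ m * (D m - d) := by
  have h1 : Q - 1 ≠ 0 := by linarith
  have h3 : Q * q - 1 ≠ 0 := by nlinarith
  have h2 : 1 - (Q * q)⁻¹ ≠ 0 := by
    rw [sub_ne_zero, ne_comm, Ne, inv_eq_one]
    exact fun h => h3 (by linarith)
  have h4 : (1 - Q) / (1 - (Q * q)⁻¹) = (1 - Q) * (Q * q) / (Q * q - 1) := by
    have : Q * q ≠ 0 := by positivity
    field_simp
  rw [h4]
  induction m with
  | zero =>
    simp [h0]
    field_simp
    ring
  | succ m ih =>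
    have step : (1 - Q) * (Q * q) / (Q * q - 1) * (Q ^ m * (D m - d) -
        Q ^ m * q⁻¹ * (D (m + 1) - d)) = Q ^ (m + 1) * (D (m + 1) - D m) -
        (q - 1) * Q / (Q * q - 1) * Q ^ (m + 1) * (D (m + 1) - d) +
        (q - 1) * Q / (Q * q - 1) * Q ^ m * (D m - d) := by
      field_simp
      ring
    rw [Finset.sum_range_succ, Finset.sum_range_succ]
    linear_combination ih + step

/-- Off 𝒪 one has |s + 1| = |s|, and the complement of 𝒪 is stable under translation by 1. -/
lemma tail_shift {n : ℕ} (g : F → ℝ) :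
    ∫ s in (pBall F 0 : Set F)ᶜ, wt n s * g (s + 1) ∂(haarF F) =
      ∫ s in (pBall F 0 : Set F)ᶜ, wt n s * g s ∂(haarF F) := by
  have hm := (isOpen_pBall (F := F) 0).measurableSet.compl
  rw [← integral_indicator hm, ← integral_indicator hm]
  refine Eq.trans ?_ (integral_add_right_eq_self _ (1 : F))
  congr 1
  ext s
  have h1 : (1 : F) ∈ pBall F 0 := by simp [mem_pBall]
  by_cases hs : s ∈ pBall F 0
  · rw [Set.indicator_of_notMem (by simpa using hs),
      Set.indicator_of_notMem (by simpa using add_mem hs h1)]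
  · have hs' : s + 1 ∉ pBall F 0 := fun h => hs ((add_mem_cancel_right h1).1 h)
    rw [Set.indicator_of_mem (by simpa using hs), Set.indicator_of_mem (by simpa using hs')]
    have h0 : s ≠ 0 := by
      rintro rfl
      exact hs (zero_mem _)
    obtain ⟨v, hv⟩ := exists_absV_eq_zpow h0
    rw [mem_pBall_of_eq hv] at hs
    rw [wt, wt, absV_add_eq hv (pBall_anti (by omega) h1), hv]

/-- The tails cancel, so only the values of g on 𝒪 matter: the source of the compact support of β.
-/
lemma regInt_shift_sub {n : ℕ} (hn : 2 ≤ n) {g : F → ℝ} (hg : g ∈ schwartz F ℝ) :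
    regInt n (fun s => g (s + 1)) - regInt n g =
      (∫ s in (pBall F 0 : Set F), wt n s * (g (s + 1) - g (0 + 1)) ∂(haarF F)) -
      (∫ s in (pBall F 0 : Set F), wt n s * (g s - g 0) ∂(haarF F)) -
      (g 1 - g 0) * ((1 - (resCard F : ℝ)⁻¹) / ((resCard F : ℝ) ^ (n - 1) - 1)) := by
  rw [regInt_split hn hg, regInt_split hn (schwartz_shift hg 1), tail_shift, zero_add]
  ring

/-- The value of `β` at a real valued test function, through averages. -/
lemma regInt_formula {n : ℕ} (hn : 2 ≤ n) {g : F → ℝ} (hg : g ∈ schwartz F ℝ) {m : ℕ}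
    (hm : ∀ x, ∀ u ∈ pBall F m, g (x + u) = g x) :
    (1 - (resCard F : ℝ) ^ ((n : ℤ) - 1)) / (1 - (resCard F : ℝ) ^ (-(n : ℤ))) *
      (regInt n (fun s => g (s + 1)) - regInt n g) =
    ∑ k ∈ Finset.range m, ((resCard F : ℝ) ^ (n - 1)) ^ (k + 1) *
      ((avg (k + 1) 1 g - avg (k + 1) 0 g) - (avg k 1 g - avg k 0 g)) := by
  have hq := one_lt_resCard_real F
  have hq0 := (resCard_pos F).ne'
  obtain ⟨N, rfl⟩ : ∃ N, n = N + 1 := ⟨n - 1, by omega⟩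
  have hQ : 1 < (resCard F : ℝ) ^ N := one_lt_pow₀ hq (by omega)
  have h1 := setIntegral_wt_sum (n := N + 1) hg 1 (m := m) fun u hu => by
    rw [add_comm, hm 1 u hu, zero_add]
  have h0 := setIntegral_wt_sum (n := N + 1) hg 0 (m := m) fun u hu => by
    rw [add_zero, add_zero, ← zero_add u, hm 0 u hu]
  simp only [add_zero] at h0
  rw [regInt_shift_sub hn hg, h1, h0, ← Finset.sum_sub_distrib]
  -- The sequence starts at 0 because 0 and 1 lie in the same coset of 𝒪; the next step shows that
  -- it reaches g(1) - g(0) at level m.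
  have hD := beta_telescope hq hQ (fun k : ℕ => avg k 1 g - avg k 0 g)
    (by
      exact sub_eq_zero.2 <| avg_congr (by simp [mem_pBall]) g) (g 1 - g 0) m
  have hDm : avg (m : ℤ) 1 g - avg (m : ℤ) 0 g - (g 1 - g 0) = 0 := by
    rw [avg_eq_of_invariant fun u hu => hm 1 u hu, avg_eq_of_invariant fun u hu => hm 0 u hu]
    ring
  simp only [Nat.add_sub_cancel]
  simp only [hDm, mul_zero, sub_zero] at hD
  rw [show ((N + 1 : ℕ) : ℤ) - 1 = N by push_cast; ring, zpow_neg, zpow_natCast, zpow_natCast, pow_succ]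
  push_cast at hD
  rw [← hD]
  congr 2
  refine Finset.sum_congr rfl fun k _ => ?_
  rw [zpow_neg, zpow_neg, zpow_add₀ hq0, zpow_natCast, zpow_one, ← pow_mul, mul_comm k,
    add_mul, pow_add, one_mul, pow_mul]
  field_simp
  ring

end AbsPow

/-! ### Rationality and linearity of β, and its vanishing on functions constant on 𝒪. -/

section Beta

variable {F : Type*} [Field F] [ValuativeRel F] [TopologicalSpace F] [IsNonarchimedeanLocalField F]
variable [MeasurableSpace F] [BorelSpace F]

lemma setIntegral_indicator_one_rat {A B : Set F} (hA : IsCompact A) (hA' : IsOpen A) (hB : IsClopen B) :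
    ∃ a : ℚ, (a : ℝ) = ∫ s in B, A.indicator (fun _ => (1 : ℝ)) s ∂(haarF F) := by
  obtain ⟨a, ha⟩ := haarF_rat (hA.inter_right hB.isClosed) (hA'.inter hB.isOpen)
  refine ⟨a, ?_⟩
  rw [setIntegral_indicator hA'.measurableSet, setIntegral_const, smul_eq_mul, mul_one, ha,
    Set.inter_comm]

lemma avg_indicator_rat {A : Set F} (hA : IsCompact A) (hA' : IsOpen A) (k : ℤ) (a : F) :
    ∃ b : ℚ, (b : ℝ) = avg k a (A.indicator fun _ => (1 : ℝ)) := by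
  obtain ⟨b, hb⟩ := setIntegral_indicator_one_rat hA hA' (B := {s | s - a ∈ pBall F k})
    (IsClopen.preimage ⟨isClosed_pBall k, isOpen_pBall k⟩ (continuous_id.sub continuous_const))
  exact ⟨(resCard F : ℚ) ^ k * b, by rw [avg, ← hb]; push_cast; rfl⟩

/-- A bounded set meets only finitely many shells off 𝒪, and on each of them the weight is a power
of q. -/
lemma tail_indicator_rat {n : ℕ} {A : Set F} (hA : IsCompact A) (hA' : IsOpen A) :
    ∃ a : ℚ, (a : ℝ) = ∫ s in (pBall F 0 : Set F)ᶜ, wt n s * A.indicator (fun _ => 1) s ∂(haarF F) := by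
  have hg : A.indicator (fun _ => (1 : ℝ)) ∈ schwartz F ℝ := indicator_const_mem_schwartz hA hA' 1
  have key : ∀ C : ℕ, ∃ a : ℚ, (a : ℝ) = ∫ s in (pBall F (-(C : ℤ)) : Set F) \ pBall F 0,
      wt n s * A.indicator (fun _ => 1) s ∂(haarF F) := by
    intro C
    induction C with
    | zero => exact ⟨0, by simp⟩
    | succ C ih =>
      obtain ⟨a, ha⟩ := ih
      set k : ℤ := -((C + 1 : ℕ) : ℤ) with hk
      have hkC : k + 1 = -(C : ℤ) := by omega
      have hU : (pBall F k : Set F) \ pBall F 0 =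
          ((pBall F k : Set F) \ pBall F (k + 1)) ∪ ((pBall F (k + 1) : Set F) \ pBall F 0) := by
        ext s
        have h1 : s ∈ pBall F (k + 1) → s ∈ pBall F k := fun h => pBall_anti (by omega) h
        have h2 : s ∈ pBall F 0 → s ∈ pBall F (k + 1) := fun h => pBall_anti (by omega) h
        simp only [Set.mem_sdiff, Set.mem_union, SetLike.mem_coe]
        tauto
      have hm : ∀ j l : ℤ, MeasurableSet ((pBall F j : Set F) \ pBall F l) := fun j l =>
        (isOpen_pBall _).measurableSet.diff (isOpen_pBall _).measurableSet
      have hi : ∀ j l : ℤ, (pBall F l : Set F) ⊆ pBall F j →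
          IntegrableOn (fun s => wt n s * A.indicator (fun _ => (1 : ℝ)) s)
          ((pBall F j : Set F) \ pBall F l) (haarF F) := by
        intro j l _
        refine ContinuousOn.integrableOn_compact
          ((isCompact_pBall j).diff (isOpen_pBall l)) fun s hs => ?_
        have hs0 : s ≠ 0 := by
          rintro rfl
          exact hs.2 (zero_mem _)
        refine ContinuousAt.continuousWithinAt ?_
        refine (continuousAt_const (y := wt n s * A.indicator (fun _ => (1 : ℝ)) s)).congr ?_
        filter_upwards [hg.1.eventually_eq s, absV_eventually_eq hs0] with t ht ht'
        rw [ht, wt, wt, ht']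
      obtain ⟨b, hb⟩ := setIntegral_indicator_one_rat hA hA' (B := (pBall F k : Set F) \ pBall F (k + 1))
        (IsClopen.diff ⟨isClosed_pBall k, isOpen_pBall k⟩ ⟨isClosed_pBall _, isOpen_pBall _⟩)
      refine ⟨((resCard F : ℚ) ^ k) ^ n * b + a, ?_⟩
      rw [hU, setIntegral_union ?_ (hm _ _) (hi _ _ (pBall_anti (by omega)))
        (hi _ _ (pBall_anti (by omega))), setIntegral_wt_shell, ← hb, hkC, ← ha]
      · push_cast
        rfl
      · exact Set.disjoint_left.2 fun s hs hs' => hs.2 hs'.1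
  obtain ⟨C, hC⟩ := exists_subset_pBall hA
  obtain ⟨a, ha⟩ := key (-C).toNat
  refine ⟨a, ha.trans ?_⟩
  have hsub : (pBall F (-((-C).toNat : ℤ)) : Set F) \ pBall F 0 ⊆ (pBall F 0 : Set F)ᶜ :=
    fun s hs => hs.2
  refine (setIntegral_eq_of_subset_of_forall_sdiff_eq_zero
    (isOpen_pBall _).measurableSet.compl hsub fun s hs => ?_).symm
  rw [Set.indicator_of_notMem, mul_zero]
  exact fun h => hs.2 ⟨pBall_anti (by omega) (hC h), hs.1⟩

/-- The one infinite series, the tail of the constant g(0), is geometric with rational sum; all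
other terms are finitely many rational volumes. Thus `ratOf` in `absPow` never falls back on its
default value for a compact open set. -/
lemma isRatAdd_absPowIndicator {n : ℕ} (hn : 2 ≤ n) :
    IsRatAdd (absPowIndicator (F := F) n) where
  add A B hA hA' hB hB' h := by
    rw [absPowIndicator_eq, absPowIndicator_eq, absPowIndicator_eq,
      ← regInt_add hn (indicator_const_mem_schwartz hA hA' 1) (indicator_const_mem_schwartz hB hB' 1)]
    congr 1
    exact Set.indicator_union_of_disjoint h _
  rat A hA hA' := by
    have hg : A.indicator (fun _ => (1 : ℝ)) ∈ schwartz F ℝ := indicator_const_mem_schwartz hA hA' 1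
    obtain ⟨m, hm⟩ := exists_pBall_invariant hg
    have h0 := setIntegral_wt_sum (n := n) hg 0 (m := m) fun u hu => by
      rw [add_zero, add_zero, ← zero_add u, hm 0 u hu]
    simp only [add_zero] at h0
    rw [absPowIndicator_eq, regInt_split hn hg, h0]
    obtain ⟨t, ht⟩ := tail_indicator_rat (n := n) hA hA'
    obtain ⟨c, hc⟩ : ∃ c : ℚ, (c : ℝ) = A.indicator (fun _ => (1 : ℝ)) 0 := by
      by_cases h : (0 : F) ∈ A
      · exact ⟨1, by simp [h]⟩
      · exact ⟨0, by simp [h]⟩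
    choose b hb using fun k : ℤ => avg_indicator_rat hA hA' k 0
    refine ⟨∑ k ∈ Finset.range m, ((resCard F : ℚ) ^ k) ^ n *
        ((resCard F : ℚ) ^ (-(k : ℤ)) * (b k - c) -
          (resCard F : ℚ) ^ (-((k : ℤ) + 1)) * (b (k + 1) - c)) + t -
        c * ((1 - (resCard F : ℚ)⁻¹) / ((resCard F : ℚ) ^ (n - 1) - 1)), ?_⟩
    rw [← ht, ← hc]
    simp only [← hb]
    push_cast
    rfl

lemma absPow_real {n : ℕ} (hn : 2 ≤ n) {f : F → ℝ} (hf : f ∈ schwartz F ℝ) :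
    absPow n f = regInt n f := by
  classical
  obtain ⟨T, -, h1, h2⟩ := schwartz_values hf
  have e1 : absPow n f = _ := (isRatAdd_absPowIndicator hn).setSum_real h1 h2
  rw [e1]
  have hsum : f = ∑ e ∈ T, e • (f ⁻¹' {e}).indicator (fun _ => (1 : ℝ)) := by
    ext x
    rw [Finset.sum_apply]
    simp only [Pi.smul_apply, smul_eq_mul, Set.indicator_apply, Set.mem_preimage,
      Set.mem_singleton_iff, mul_ite, mul_one, mul_zero]
    rw [Finset.sum_ite_eq]
    split_ifs with h
    · rfl
    · exact h2 x h
  have hgen : ∀ S : Finset ℝ, S ⊆ T →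
      (∑ e ∈ S, e • (f ⁻¹' {e}).indicator (fun _ => (1 : ℝ))) ∈ schwartz F ℝ ∧
      regInt n (∑ e ∈ S, e • (f ⁻¹' {e}).indicator (fun _ => (1 : ℝ))) =
        ∑ e ∈ S, absPowIndicator n (f ⁻¹' {e}) * e := by
    intro S
    induction S using Finset.induction_on with
    | empty =>
      intro _
      refine ⟨zero_mem _, ?_⟩
      simp [regInt]
    | insert e S he ih =>
      intro hS
      obtain ⟨h3, h4⟩ := ih ((Finset.subset_insert e S).trans hS)
      have h5 := h1 e (hS (Finset.mem_insert_self e S))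
      have h6 := (schwartz F ℝ).smul_mem e (indicator_const_mem_schwartz h5.1 h5.2 (1 : ℝ))
      rw [Finset.sum_insert he, Finset.sum_insert he]
      refine ⟨add_mem h6 h3, ?_⟩
      rw [regInt_add hn h6 h3, regInt_smul, h4, absPowIndicator_eq, mul_comm]
  nth_rw 2 [hsum]
  exact (hgen T subset_rfl).2.symm

variable {E : Type*} [Field E]

lemma absPowIndicator_empty (n : ℕ) : absPowIndicator n (∅ : Set F) = 0 := by
  simp [absPowIndicator]

lemma betaValue_map {E' : Type*} [Field E'] (σ : E →+* E') (n : ℕ) (f : F → E) :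
    betaValue n (σ ∘ f) = σ (betaValue n f) := by
  have h : ∀ g : F → E, absPow n (σ ∘ g) = σ (absPow n g) := fun g =>
    setSum_map σ (absPowIndicator_empty n) g
  unfold betaValue
  rw [h f, show (fun s => (σ ∘ f) (s + 1)) = σ ∘ fun s => f (s + 1) from rfl, h]
  simp

/-- The value of `β` at a real valued test function. -/
lemma betaValue_real {n : ℕ} (hn : 2 ≤ n) {g : F → ℝ} (hg : g ∈ schwartz F ℝ) {m : ℕ}
    (hm : ∀ x, ∀ u ∈ pBall F m, g (x + u) = g x) :
    betaValue n g = ∑ k ∈ Finset.range m, ((resCard F : ℝ) ^ (n - 1)) ^ (k + 1) *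
      ((avg (k + 1) 1 g - avg (k + 1) 0 g) - (avg k 1 g - avg k 0 g)) := by
  rw [← regInt_formula hn hg hm, betaValue, absPow_real hn hg, absPow_real hn (schwartz_shift hg 1)]

variable [CharZero E]

lemma betaValue_add {n : ℕ} (hn : 2 ≤ n) {f g : F → E} (hf : f ∈ schwartz F E) (hg : g ∈ schwartz F E) :
    betaValue n (f + g) = betaValue n f + betaValue n g := by
  have h : ∀ {f g : F → E}, f ∈ schwartz F E → g ∈ schwartz F E →
      absPow n (f + g) = absPow n f + absPow n g := fun hf hg =>
    (isRatAdd_absPowIndicator hn).setSum_add hf hg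
  have h' := h (schwartz_shift hf 1) (schwartz_shift hg 1)
  unfold betaValue
  rw [h hf hg, show (fun s => (f + g) (s + 1)) = (fun s => f (s + 1)) + fun s => g (s + 1) from rfl, h']
  ring

lemma betaValue_smul {n : ℕ} (hn : 2 ≤ n) (c : E) {f : F → E} (hf : f ∈ schwartz F E) :
    betaValue n (c • f) = c * betaValue n f := by
  have h : ∀ {f : F → E}, f ∈ schwartz F E → absPow n (c • f) = c * absPow n f := fun hf =>
    (isRatAdd_absPowIndicator hn).setSum_smul c hf
  have h' := h (schwartz_shift hf 1)
  unfold betaValue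
  rw [h hf, show (fun s => (c • f) (s + 1)) = c • (fun s => f (s + 1)) from rfl, h']
  ring

/-- `β` as a distribution. -/
def betaDist (E : Type*) [Field E] [CharZero E] {n : ℕ} (hn : 2 ≤ n) : Distribution F E where
  toFun f := betaValue n f.1
  map_add' f g := betaValue_add hn f.2 g.2
  map_smul' c f := betaValue_smul hn c f.2

/-- `β` kills test functions that are constant on `𝒪`. -/
lemma betaValue_eq_zero {n : ℕ} (hn : 2 ≤ n) {f : F → E} (hf : f ∈ schwartz F E)
    (h : ∀ s ∈ pBall F 0, f s = f 0) : betaValue n f = 0 := by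
  classical
  -- For each nonzero value e, `regInt_shift_sub` expresses the difference by terms that vanish when
  -- the indicator of the level set is constant on 𝒪.
  have key : absPow n (fun s => f (s + 1)) = absPow n f := by
    unfold absPow
    refine finsum_congr fun e => ?_
    by_cases he : e = 0
    · simp [he]
    · obtain ⟨h1, h2⟩ := schwartz_fiber hf he
      congr 3
      have hg : (f ⁻¹' {e}).indicator (fun _ => (1 : ℝ)) ∈ schwartz F ℝ :=
        indicator_const_mem_schwartz h1 h2 1
      have h3 := regInt_shift_sub hn hg
      have hc : ∀ s ∈ pBall F 0, (f ⁻¹' {e}).indicator (fun _ => (1 : ℝ)) s =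
          (f ⁻¹' {e}).indicator (fun _ => (1 : ℝ)) 0 := fun s hs => by
        simp [Set.indicator_apply, h s hs]
      have h1' : (1 : F) ∈ pBall F 0 := by simp [mem_pBall]
      rw [setIntegral_pBall_eq_zero hc, setIntegral_pBall_eq_zero
        (g := fun s => (f ⁻¹' {e}).indicator (fun _ => (1 : ℝ)) (s + 1)) fun s hs => by
          rw [hc _ (add_mem hs h1'), hc _ (add_mem (zero_mem _) h1')], hc 1 h1'] at h3
      rw [absPowIndicator_eq, absPowIndicator_eq]
      simp only [sub_self, zero_mul] at h3
      exact sub_eq_zero.1 h3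
  rw [betaValue, key, sub_self, mul_zero]

end Beta

/-! ### The operators M and A_β on functions on F^n. -/

section Operators

variable {F : Type*} [Field F] [ValuativeRel F] [TopologicalSpace F] [IsNonarchimedeanLocalField F]
variable {n : ℕ} {E : Type*} [Field E]

lemma extZero_of_ne {φ : Punctured F n → E} {x : Fin n → F} (hx : x ≠ 0) :
    extZero φ x = φ ⟨x, hx⟩ := by
  unfold extZero
  rw [dif_pos hx]

@[simp] lemma extZero_zero (φ : Punctured F n → E) : extZero φ 0 = 0 := by
  unfold extZero
  rw [dif_neg (by simp)]

@[simp] lemma extZero_coe (φ : Punctured F n → E) (x : Punctured F n) : extZero φ x.1 = φ x :=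
  extZero_of_ne x.2

lemma extZero_injective : Function.Injective (extZero : (Punctured F n → E) → _) := by
  intro φ ψ h
  ext x
  rw [← extZero_coe φ, h, extZero_coe]

/-- Functions that vanish near the origin and are invariant under relatively small translations
are locally constant. -/
lemma HomInv.isLocallyConstant {r : ℕ} {f : (Fin n → F) → E} (h : HomInv r f) {c : ℤ}
    (hc : ∀ x ∈ vBall F n c, f x = 0) : IsLocallyConstant f := by
  rw [IsLocallyConstant.iff_eventually_eq]
  intro x
  by_cases hx : x = 0
  · subst hx
    filter_upwards [(isOpen_vBall (F := F) (n := n) c).mem_nhds (zero_mem _)] with y hy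
    rw [hc y hy, hc 0 (zero_mem _)]
  · exact h.eventually_eq hx

lemma indicator_mem_schwartz_of_isLocallyConstant {X : Type*} [TopologicalSpace X] {f : X → E}
    (hf : IsLocallyConstant f) {A : Set X} (hA : IsClopen A) (hA' : IsCompact A) :
    A.indicator f ∈ schwartz X E := by
  have hlc : IsLocallyConstant (A.indicator f) := by
    rw [IsLocallyConstant.iff_eventually_eq]
    intro x
    by_cases hx : x ∈ A
    · filter_upwards [hA.isOpen.mem_nhds hx, hf.eventually_eq x] with y hy hy'
      rw [Set.indicator_of_mem hx, Set.indicator_of_mem hy, hy']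
    · filter_upwards [hA.compl.isOpen.mem_nhds hx] with y hy
      rw [Set.indicator_of_notMem hx, Set.indicator_of_notMem hy]
  exact ⟨hlc, hA'.of_isClosed_subset (hlc.isOpen_fiber 0).isClosed_compl
    Set.support_indicator_subset⟩

variable [MeasurableSpace F] [BorelSpace F]

/-- The operator `M` on functions on `F ^ n`. -/
def Mr (f : (Fin n → F) → E) : (Fin n → F) → E := extZero fun ξ : Punctured F n => radon f ξ 1

/-- The operator with kernel `β(ξ · x)` on functions on `F ^ n`. -/
def Br (h : (Fin n → F) → E) : (Fin n → F) → E :=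
  extZero fun x : Punctured F n => betaValue n (radon h x)

lemma Mr_of_ne (f : (Fin n → F) → E) {ξ : Fin n → F} (hξ : ξ ≠ 0) : Mr f ξ = radon f ⟨ξ, hξ⟩ 1 :=
  extZero_of_ne hξ

lemma Br_of_ne (h : (Fin n → F) → E) {x : Fin n → F} (hx : x ≠ 0) :
    Br h x = betaValue n (radon h ⟨x, hx⟩) :=
  extZero_of_ne hx

@[simp] lemma Mr_zero_right (f : (Fin n → F) → E) : Mr f 0 = 0 := extZero_zero _

@[simp] lemma Br_zero_right (f : (Fin n → F) → E) : Br f 0 = 0 := extZero_zero _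

/-- The equation ξ · y = 1 forces ‖y‖ ≥ ‖ξ‖⁻¹, so M at ξ does not see the ball of valuations at
least 1 - v. -/
lemma Mr_congr {f g : (Fin n → F) → E} {ξ : Fin n → F} {v : ℤ} (hξ : HasVal ξ v)
    (h : ∀ y, y ∉ vBall F n (1 - v) → f y = g y) : Mr f ξ = Mr g ξ := by
  rw [Mr_of_ne _ hξ.ne_zero, Mr_of_ne _ hξ.ne_zero]
  refine radon_congr fun y hy => h y ?_
  refine slab_one_val hξ le_rfl ?_
  rw [mem_slab, show ξ ⬝ᵥ y = 1 from hy, sub_self]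
  exact zero_mem _

lemma Mr_zero : Mr (0 : (Fin n → F) → E) = 0 := by
  ext ξ
  by_cases hξ : ξ = 0
  · simp [hξ]
  · rw [Mr_of_ne _ hξ, radon_zero, Pi.zero_apply]

lemma Mr_eq_zero {f : (Fin n → F) → E} {C : ℤ} (hC : ∀ x, f x ≠ 0 → x ∈ vBall F n C)
    {ξ : Fin n → F} (hξ : ξ ∈ vBall F n (1 - C)) : Mr f ξ = 0 := by
  by_cases h0 : ξ = 0
  · simp [h0]
  · obtain ⟨v, hv⟩ := exists_hasVal h0
    rw [hv.mem_iff] at hξ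
    rw [Mr_congr (g := 0) hv fun y hy => ?_, Mr_zero, Pi.zero_apply]
    by_contra h
    exact hy (vBall_anti (by omega) (hC y h))

/-- Removing a neighborhood of the origin. -/
lemma Mr_cut (f : (Fin n → F) → E) {ξ : Fin n → F} {v k : ℤ} (hξ : HasVal ξ v) (hk : 1 - v ≤ k) :
    Mr ((vBall F n k : Set (Fin n → F))ᶜ.indicator f) ξ = Mr f ξ := by
  refine Mr_congr hξ fun y hy => ?_
  have : y ∈ (vBall F n k : Set (Fin n → F))ᶜ := fun h => hy (vBall_anti hk h)
  exact Set.indicator_of_mem this f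

lemma HomInv.cut_mem_schwartz {r : ℕ} (hr : 1 ≤ r) {f : (Fin n → F) → E} (h : HomInv r f) {C : ℤ}
    (hC : ∀ x, f x ≠ 0 → x ∈ vBall F n C) (k : ℤ) :
    (vBall F n k : Set (Fin n → F))ᶜ.indicator f ∈ schwartz (Fin n → F) E := by
  refine (h.indicator hr (vBall_compl_hom k)).mem_schwartz (c := k) (C := C) ?_ ?_
  · intro x hx
    have : x ∉ (vBall F n k : Set (Fin n → F))ᶜ := fun h => h hx
    exact Set.indicator_of_notMem this f
  · intro x hx
    refine hC x fun h0 => hx ?_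
    by_cases h : x ∈ (vBall F n k : Set (Fin n → F))ᶜ
    · rw [Set.indicator_of_mem h, h0]
    · rw [Set.indicator_of_notMem h]

/-- Here f may be singular at the origin; cutting out a ball that M does not see at this norm of ξ
leaves a test function. -/
lemma HomInv.Mr {r : ℕ} (hr : 1 ≤ r) {f : (Fin n → F) → E} (h : HomInv r f) {C : ℤ}
    (hC : ∀ x, f x ≠ 0 → x ∈ vBall F n C) : HomInv r (Mr f) := by
  intro x v hx u hu
  have hxu := hx.add (vBall_anti (by omega) hu)
  rw [← Mr_cut f hx le_rfl, ← Mr_cut f hxu le_rfl, Mr_of_ne _ hx.ne_zero, Mr_of_ne _ hxu.ne_zero]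
  refine radon_homInv hr (h.cut_mem_schwartz hr hC _) (h.indicator hr (vBall_compl_hom _)) hx ?_ 1
  rwa [add_sub_cancel_left]

lemma HomInv.Br {r : ℕ} (hr : 1 ≤ r) {h : (Fin n → F) → E} (hi : HomInv r h)
    (hh : h ∈ schwartz (Fin n → F) E) : HomInv r (Br h) := by
  intro x v hx u hu
  have hxu := hx.add (vBall_anti (by omega) hu)
  rw [Br_of_ne _ hx.ne_zero, Br_of_ne _ hxu.ne_zero]
  congr 1
  ext t
  refine radon_homInv hr hh hi hx ?_ t
  rwa [add_sub_cancel_left]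

lemma Mr_map {E' : Type*} [Field E'] (σ : E →+* E') (f : (Fin n → F) → E) :
    Mr (σ ∘ f) = σ ∘ Mr f := by
  ext ξ
  by_cases hξ : ξ = 0
  · simp [hξ]
  · rw [Function.comp_apply, Mr_of_ne _ hξ, Mr_of_ne _ hξ, radon_map]

lemma Br_map {E' : Type*} [Field E'] (σ : E →+* E') (h : (Fin n → F) → E) :
    Br (σ ∘ h) = σ ∘ Br h := by
  ext x
  by_cases hx : x = 0
  · simp [hx]
  · rw [Function.comp_apply, Br_of_ne _ hx, Br_of_ne _ hx, ← betaValue_map]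
    congr 1
    ext t
    exact radon_map σ h _ t

variable [CharZero E]

lemma Mr_add {f g : (Fin n → F) → E} (hf : f ∈ schwartz (Fin n → F) E)
    (hg : g ∈ schwartz (Fin n → F) E) : Mr (f + g) = Mr f + Mr g := by
  ext ξ
  by_cases hξ : ξ = 0
  · simp [hξ]
  · rw [Pi.add_apply, Mr_of_ne _ hξ, Mr_of_ne _ hξ, Mr_of_ne _ hξ, radon_add hf hg]

lemma Mr_smul (c : E) {f : (Fin n → F) → E} (hf : f ∈ schwartz (Fin n → F) E) :
    Mr (c • f) = c • Mr f := by
  ext ξ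
  by_cases hξ : ξ = 0
  · simp [hξ]
  · rw [Pi.smul_apply, Mr_of_ne _ hξ, Mr_of_ne _ hξ, radon_smul c hf, smul_eq_mul]

lemma Br_add (hn : 2 ≤ n) {f g : (Fin n → F) → E} (hf : f ∈ schwartz (Fin n → F) E)
    (hg : g ∈ schwartz (Fin n → F) E) : Br (f + g) = Br f + Br g := by
  ext x
  by_cases hx : x = 0
  · simp [hx]
  · rw [Pi.add_apply, Br_of_ne _ hx, Br_of_ne _ hx, Br_of_ne _ hx,
      ← betaValue_add hn (radon_mem_schwartz hf _) (radon_mem_schwartz hg _)]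
    congr 1
    ext t
    exact radon_add hf hg _ t

lemma Br_smul (hn : 2 ≤ n) (c : E) {f : (Fin n → F) → E} (hf : f ∈ schwartz (Fin n → F) E) :
    Br (c • f) = c • Br f := by
  ext x
  by_cases hx : x = 0
  · simp [hx]
  · rw [Pi.smul_apply, Br_of_ne _ hx, Br_of_ne _ hx, smul_eq_mul,
      ← betaValue_smul hn c (radon_mem_schwartz hf _)]
    congr 1
    ext t
    exact radon_smul c hf _ t

/-- Translating by the ball of level l shifts x · y by all of 𝔭^(l+v), which contains 𝒪. So the
Radon transform at x is constant on 𝒪 and β kills it. This bounds the support of A_β h and drives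
the regularization. -/
lemma Br_eq_zero (hn : 2 ≤ n) {h : (Fin n → F) → E} (hh : h ∈ schwartz (Fin n → F) E) {l v : ℤ}
    (hl : ∀ x, ∀ u ∈ vBall F n l, h (x + u) = h x) {x : Fin n → F} (hx : HasVal x v)
    (hlv : l + v ≤ 0) : Br h x = 0 := by
  rw [Br_of_ne _ hx.ne_zero]
  refine betaValue_eq_zero hn (radon_mem_schwartz hh _) fun s hs => ?_
  have := radon_invariant (ξ := ⟨x, hx.ne_zero⟩) hh.1 hx hlv hl 0 s hs
  rwa [zero_add] at this

lemma Br_zero (hn : 2 ≤ n) : Br (0 : (Fin n → F) → E) = 0 := by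
  ext x
  by_cases hx : x = 0
  · simp [hx]
  · obtain ⟨v, hv⟩ := exists_hasVal hx
    exact Br_eq_zero hn (zero_mem _) (l := -v) (fun _ _ _ => rfl) hv (by omega)

/-- Enlarging a sufficiently large lattice does not change the truncated integral. -/
lemma Br_indicator_eq (hn : 2 ≤ n) {r : ℕ} {φ : (Fin n → F) → E} (hφ : HomInv r φ) {d : ℤ}
    (hd : ∀ x ∈ vBall F n d, φ x = 0) {L : AddSubgroup (Fin n → F)}
    (hL : IsOpen (L : Set (Fin n → F))) (hL' : IsCompact (L : Set (Fin n → F))) {M v : ℤ}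
    (hML : vBall F n M ≤ L) {x : Fin n → F} (hx : HasVal x v) (hM : M + r + v ≤ 0) :
    Br ((L : Set (Fin n → F)).indicator φ) x =
      Br ((vBall F n M : Set (Fin n → F)).indicator φ) x := by
  have hlc := hφ.isLocallyConstant hd
  have hcl : IsClopen (L : Set (Fin n → F)) := ⟨hL'.isClosed, hL⟩
  have hcl' : IsClopen (vBall F n M : Set (Fin n → F)) := ⟨isClosed_vBall M, isOpen_vBall M⟩
  have h1 := indicator_mem_schwartz_of_isLocallyConstant hlc hcl' (isCompact_vBall M)
  have h2 := indicator_mem_schwartz_of_isLocallyConstant hlc (hcl.diff hcl')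
    (hL'.diff (isOpen_vBall M))
  have h3 : (L : Set (Fin n → F)).indicator φ = (vBall F n M : Set (Fin n → F)).indicator φ +
      ((L : Set (Fin n → F)) \ vBall F n M).indicator φ := by
    have h := Set.indicator_union_of_disjoint
      (Set.disjoint_sdiff_right (s := (vBall F n M : Set (Fin n → F))) (t := (L : Set (Fin n → F)))) φ
    rwa [Set.union_sdiff_cancel hML] at h
  rw [h3, Br_add hn h1 h2, Pi.add_apply, add_eq_left]
  -- Points outside the ball of level M have valuation below M, so relative invariance makes the
  -- added part invariant under the fixed ball of level M + r.
  refine Br_eq_zero hn h2 (l := M + r) (fun y u hu => ?_) hx hM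
  have hu' : u ∈ vBall F n M := vBall_anti (by omega) hu
  have hiff : y + u ∈ (L : Set (Fin n → F)) \ vBall F n M ↔ y ∈ (L : Set (Fin n → F)) \ vBall F n M := by
    simp only [Set.mem_sdiff, SetLike.mem_coe]
    rw [add_mem_cancel_right (hML hu'), add_mem_cancel_right hu']
  by_cases hy : y ∈ (L : Set (Fin n → F)) \ vBall F n M
  · rw [Set.indicator_of_mem hy, Set.indicator_of_mem (hiff.2 hy)]
    have hy0 : y ≠ 0 := by
      rintro rfl
      exact hy.2 (zero_mem _)
    obtain ⟨w, hw⟩ := exists_hasVal hy0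
    have hwM : ¬ M ≤ w := fun h => hy.2 (hw.mem_iff.2 h)
    exact hφ y w hw u (vBall_anti (by omega) hu)
  · rw [Set.indicator_of_notMem hy, Set.indicator_of_notMem (fun h => hy (hiff.1 h))]

end Operators

/-- A finite-dimensional space of functions is separated by finitely many points. -/
lemma exists_finset_separating {X E : Type*} [Field E] (V : Submodule E (X → E))
    [FiniteDimensional E V] : ∃ s : Finset X, ∀ f ∈ V, (∀ x ∈ s, f x = 0) → f = 0 := by
  classical
  induction hd : Module.finrank E V using Nat.strong_induction_on generalizing V with
  | _ d ih =>
    by_cases hV : ∀ f ∈ V, f = 0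
    · exact ⟨∅, fun f hf _ => hV f hf⟩
    · push Not at hV
      obtain ⟨f, hf, hf0⟩ := hV
      obtain ⟨x, hx⟩ := Function.ne_iff.1 hf0
      -- Imposing a zero at a point where some f in V is nonzero lowers the dimension.
      let W : Submodule E (X → E) := V ⊓ LinearMap.ker (LinearMap.proj (R := E) (φ := fun _ : X => E) x)
      have hlt : W < V := by
        refine lt_of_le_of_ne inf_le_left fun h => hx ?_
        have : f ∈ W := h ▸ hf
        exact this.2
      have hfin : FiniteDimensional E W := Submodule.finiteDimensional_of_le hlt.le
      obtain ⟨s, hs⟩ := ih _ (hd ▸ Submodule.finrank_lt_finrank_of_lt hlt) W rfl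
      refine ⟨insert x s, fun g hg h => hs g ⟨hg, ?_⟩ fun y hy => h y (Finset.mem_insert_of_mem hy)⟩
      exact h x (Finset.mem_insert_self x s)

/-! ### K-finiteness as invariance under relatively small translations. -/

section KFinite

variable {F : Type*} [Field F] [ValuativeRel F] [TopologicalSpace F] [IsNonarchimedeanLocalField F]
variable {n : ℕ} {E : Type*} [Field E]

/-- The matrix over `F` of an element of `GL_n(𝒪)`. -/
def toMat (k : GL (Fin n) 𝒪[F]) : Matrix (Fin n) (Fin n) F := k.1.map ((↑) : 𝒪[F] → F)

lemma kAct_coe (k : GL (Fin n) 𝒪[F]) (x : Punctured F n) : (kAct k x).1 = toMat k *ᵥ x.1 := rfl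

lemma toMat_mul (k l : GL (Fin n) 𝒪[F]) : toMat (k * l) = toMat k * toMat l := by
  have : (k * l).1.map (𝒪[F]).subtype = k.1.map (𝒪[F]).subtype * l.1.map (𝒪[F]).subtype := by
    rw [Units.val_mul, Matrix.map_mul]
  exact this

lemma toMat_one : toMat (1 : GL (Fin n) 𝒪[F]) = 1 := by
  have : (1 : GL (Fin n) 𝒪[F]).1.map (𝒪[F]).subtype = 1 := by
    rw [Units.val_one, Matrix.map_one _ (map_zero _) (map_one _)]
  exact this

lemma kAct_mul (k l : GL (Fin n) 𝒪[F]) (x : Punctured F n) : kAct (k * l) x = kAct k (kAct l x) := by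
  refine Subtype.ext ?_
  rw [kAct_coe, kAct_coe, kAct_coe, toMat_mul, Matrix.mulVec_mulVec]

lemma kAct_one (x : Punctured F n) : kAct 1 x = x := by
  refine Subtype.ext ?_
  rw [kAct_coe, toMat_one, Matrix.one_mulVec]

lemma mulVec_mem_vBall {A : Matrix (Fin n) (Fin n) F} {j k : ℤ} (hA : ∀ a b, A a b ∈ pBall F j)
    {x : Fin n → F} (hx : x ∈ vBall F n k) : A *ᵥ x ∈ vBall F n (j + k) :=
  mem_vBall.2 fun a => by
    have : ∑ b, A a b * x b ∈ pBall F (j + k) :=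
      sum_mem fun b _ => mul_mem_pBall (hA a b) (mem_vBall.1 hx b)
    exact this

lemma toMat_mem (k : GL (Fin n) 𝒪[F]) (a b : Fin n) : toMat k a b ∈ pBall F 0 :=
  mem_pBall_zero.2 (k.1 a b).2

lemma kAct_mem_vBall (k : GL (Fin n) 𝒪[F]) (x : Punctured F n) (j : ℤ) :
    (kAct k x).1 ∈ vBall F n j ↔ x.1 ∈ vBall F n j := by
  have h : ∀ (k : GL (Fin n) 𝒪[F]) (x : Punctured F n), x.1 ∈ vBall F n j →
      (kAct k x).1 ∈ vBall F n j := fun k x hx => by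
    have := mulVec_mem_vBall (toMat_mem k) hx
    rwa [zero_add] at this
  refine ⟨fun hx => ?_, h k x⟩
  have := h k⁻¹ _ hx
  rwa [← kAct_mul, inv_mul_cancel, kAct_one] at this

lemma kAct_hasVal (k : GL (Fin n) 𝒪[F]) {x : Punctured F n} {v : ℤ} (hx : HasVal x.1 v) :
    HasVal (kAct k x).1 v := by
  rw [hasVal_iff] at hx ⊢
  rwa [kAct_mem_vBall, kAct_mem_vBall]

/-- If k⁻¹ and l⁻¹ agree modulo 𝔭^r, then k⁻¹x and l⁻¹x differ by at most q^(-r) ‖x‖, and the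
translates coincide. Matrices over the finite quotient of 𝒪 by 𝔭^r leave only finitely many
translates. -/
lemma HomInv.kFinite {r : ℕ} {φ : Punctured F n → E} (h : HomInv r (extZero φ)) : KFinite φ := by
  let I : AddSubgroup 𝒪[F] := (pBall F r).comap (𝒪[F]).subtype.toAddMonoidHom
  have hI : IsOpen (I : Set 𝒪[F]) := (isOpen_pBall (r : ℤ)).preimage continuous_subtype_val
  have hfin : Finite (𝒪[F] ⧸ I) := I.quotient_finite_of_isOpen hI
  let c : GL (Fin n) 𝒪[F] → Fin n → Fin n → 𝒪[F] ⧸ I := fun k a b => ((k⁻¹).1 a b : 𝒪[F] ⧸ I)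
  have hfac : Function.FactorsThrough (fun k : GL (Fin n) 𝒪[F] => translate k φ) c := by
    intro k l hkl
    have hent : ∀ a b, (toMat l⁻¹ - toMat k⁻¹) a b ∈ pBall F r := by
      intro a b
      have h1 := QuotientAddGroup.eq.1 (congrFun (congrFun hkl a) b)
      have h2 : ((-((k⁻¹).1 a b) + (l⁻¹).1 a b : 𝒪[F]) : F) ∈ pBall F r := h1
      rw [Matrix.sub_apply, sub_eq_neg_add]
      exact h2
    ext x
    show φ (kAct k⁻¹ x) = φ (kAct l⁻¹ x)
    obtain ⟨v, hv⟩ := exists_hasVal x.2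
    have h3 := mulVec_mem_vBall hent (hv.mem_iff.2 le_rfl)
    rw [Matrix.sub_mulVec, ← kAct_coe, ← kAct_coe, add_comm] at h3
    have h4 := h _ v (kAct_hasVal k⁻¹ hv) _ h3
    rw [add_sub_cancel, extZero_coe, extZero_coe] at h4
    exact h4.symm
  obtain ⟨g, hg⟩ := (Function.factorsThrough_iff _).1 hfac
  have : (Set.range fun k : GL (Fin n) 𝒪[F] => translate k φ).Finite := by
    rw [hg]
    exact (Set.finite_range g).subset (Set.range_comp_subset_range c g)
  exact FiniteDimensional.span_of_finite E this

lemma HomInv.mem_spaceC {r : ℕ} {φ : Punctured F n → E} (h : HomInv r (extZero φ)) :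
    φ ∈ spaceC F n E := by
  refine ⟨?_, h.kFinite⟩
  rw [IsLocallyConstant.iff_eventually_eq]
  intro x
  have h1 := continuous_subtype_val.continuousAt.eventually (h.eventually_eq x.2)
  filter_upwards [h1] with y hy
  rwa [extZero_coe, extZero_coe] at hy

lemma isUnit_one_add {w : 𝒪[F]} (hw : (w : F) ∈ pBall F 1) : IsUnit (1 + w) := by
  rw [(Valuation.integer.integers (valuation F)).isUnit_iff_valuation_eq_one]
  have h1 : absV (1 + w : F) = absV (1 : F) := by
    have := absV_add_eq (s := (1 : F)) (v := 0) (by simp) hw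
    rw [this]
    simp
  have h2 : valuation F (1 + w : F) = valuation F 1 :=
    le_antisymm (absV_le_iff.1 h1.le) (absV_le_iff.1 h1.ge)
  rw [map_one] at h2
  exact h2

/-- Every small perturbation of a vector is achieved by a small element of `GL_n(𝒪)`. -/
lemma exists_kAct_eq {r : ℕ} (hr : 1 ≤ r) {x u : Fin n → F} {v : ℤ} (hx : HasVal x v)
    (hu : u ∈ vBall F n (v + r)) : ∃ k : GL (Fin n) 𝒪[F],
      (∀ a b, (toMat k - 1) a b ∈ pBall F r) ∧ (kAct k ⟨x, hx.ne_zero⟩).1 = x + u := by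
  classical
  obtain ⟨i, hi⟩ := hx.exists_coord
  have hi0 := ne_zero_of_absV hi
  have hw : ∀ a, u a / x i ∈ pBall F r := by
    intro a
    rw [div_mem_pBall_iff hi, add_comm]
    exact mem_vBall.1 hu a
  let w : Fin n → 𝒪[F] := fun a => ⟨u a / x i, mem_pBall_zero.1 (pBall_anti (by omega) (hw a))⟩
  -- A rank-one perturbation sending x to x + u: the i-th coordinate of x has maximal size, so u/x_i
  -- is in 𝔭^r, and the determinant 1 + u_i/x_i is a unit.
  let A : Matrix (Fin n) (Fin n) 𝒪[F] := 1 + Matrix.vecMulVec w (Pi.single i 1)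
  have hdet : IsUnit A.det := by
    have : A.det = 1 + w i := by
      rw [show A = 1 + Matrix.vecMulVec w (Pi.single i 1) from rfl, Matrix.vecMulVec_eq Unit,
      Matrix.det_one_add_replicateCol_mul_replicateRow]
      simp
    rw [this]
    exact isUnit_one_add (pBall_anti (by omega) (hw i))
  let k : GL (Fin n) 𝒪[F] := Matrix.GeneralLinearGroup.mk'' A hdet
  have hk : toMat k = 1 + Matrix.vecMulVec (fun a => u a / x i) (Pi.single i 1) := by
    ext a b
    show ((A a b : 𝒪[F]) : F) = _
    simp only [A, Matrix.add_apply, Matrix.vecMulVec_apply, Matrix.one_apply, Pi.single_apply, w]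
    split_ifs <;> simp
  refine ⟨k, fun a b => ?_, ?_⟩
  · rw [hk, add_sub_cancel_left, Matrix.vecMulVec_apply, Pi.single_apply]
    split_ifs
    · rw [mul_one]
      exact hw a
    · rw [mul_zero]
      exact zero_mem _
  · rw [kAct_coe, hk, Matrix.add_mulVec, Matrix.one_mulVec]
    congr 1
    ext a
    simp [Matrix.vecMulVec_mulVec, hi0]

/-- Finitely many points separate the span of the translates. By local constancy, a matrix close
enough to 1 does not change φ at these points, hence does not change φ at all. By `exists_kAct_eq`
such matrices move x to every x + u with u relatively small, uniformly in x. -/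
lemma exists_homInv_of_mem_spaceC {φ : Punctured F n → E} (h : φ ∈ spaceC F n E) :
    ∃ r : ℕ, 1 ≤ r ∧ HomInv r (extZero φ) := by
  obtain ⟨hlc, hK⟩ := h
  have : FiniteDimensional E
    (Submodule.span E (Set.range fun k : GL (Fin n) 𝒪[F] => translate k φ)) := hK
  obtain ⟨s, hs⟩ := exists_finset_separating
    (Submodule.span E (Set.range fun k : GL (Fin n) 𝒪[F] => translate k φ))
  have hloc : ∀ x : Punctured F n, ∃ r : ℕ, ∀ y : Punctured F n,
      (∀ v, HasVal x.1 v → y.1 - x.1 ∈ vBall F n (v + r)) → φ y = φ x := by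
    intro x
    obtain ⟨v, hv⟩ := exists_hasVal x.2
    have h1 := hlc.eventually_eq x
    rw [nhds_subtype_eq_comap, Filter.eventually_comap] at h1
    have h2 : ∀ᶠ u in nhds (0 : Fin n → F), ∀ a : Punctured F n, a.1 = x.1 + u → φ a = φ x := by
      have hc : Continuous fun u : Fin n → F => x.1 + u := by fun_prop
      have := hc.tendsto 0
      rw [add_zero] at this
      exact this.eventually h1
    obtain ⟨m, hm⟩ := exists_vBall_subset h2
    refine ⟨(m - v).toNat, fun y hy => ?_⟩
    exact hm (vBall_anti (by omega) (hy v hv)) y (by abel)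
  choose R hR using hloc
  refine ⟨s.sup R + 1, by omega, ?_⟩
  have hinv : ∀ k : GL (Fin n) 𝒪[F], (∀ a b, (toMat k - 1) a b ∈ pBall F ((s.sup R + 1 : ℕ) : ℤ)) →
      ∀ x, φ (kAct k x) = φ x := by
    intro k hk x
    have h0 : translate k⁻¹ φ - translate 1 φ = 0 := by
      refine hs _ (sub_mem (Submodule.subset_span ⟨_, rfl⟩) (Submodule.subset_span ⟨_, rfl⟩)) ?_
      intro y hy
      rw [Pi.sub_apply, sub_eq_zero]
      show φ (kAct k⁻¹⁻¹ y) = φ (kAct 1⁻¹ y)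
      rw [inv_inv, inv_one, kAct_one]
      refine hR y _ fun v hv => ?_
      have h3 := mulVec_mem_vBall hk (hv.mem_iff.2 le_rfl)
      rw [Matrix.sub_mulVec, Matrix.one_mulVec, ← kAct_coe] at h3
      have h4 : R y ≤ s.sup R := Finset.le_sup hy
      exact vBall_anti (by omega) h3
    have h1 := congrFun h0 x
    rw [Pi.sub_apply, Pi.zero_apply, sub_eq_zero] at h1
    have h2 : φ (kAct k⁻¹⁻¹ x) = φ (kAct 1⁻¹ x) := h1
    rwa [inv_inv, inv_one, kAct_one] at h2
  intro x v hx u hu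
  obtain ⟨k, hk, hkx⟩ := exists_kAct_eq (by omega) hx hu
  rw [← hkx, extZero_coe, hinv k hk, extZero_of_ne hx.ne_zero]

lemma vval_of_hasVal {x : Fin n → F} {v : ℤ} (hx : HasVal x v) : vval x = v := by
  have h : (vnorm x : ℝ) = (resCard F : ℝ) ^ (-v) := by
    rw [show vnorm x = _ from hx]
    push_cast
    rfl
  have hq := one_lt_resCard_real F
  rw [vval, h, ← Real.rpow_intCast, Real.logb_rpow (by linarith) hq.ne']
  simp

lemma mem_Cplus_iff {φ : Punctured F n → E} : φ ∈ Cplus F n E ↔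
    (∃ r : ℕ, 1 ≤ r ∧ HomInv r (extZero φ)) ∧ ∃ C : ℤ, ∀ x, extZero φ x ≠ 0 → x ∈ vBall F n C := by
  constructor
  · rintro ⟨h1, R, hR⟩
    refine ⟨exists_homInv_of_mem_spaceC h1, ⌊R⌋, fun x hx => ?_⟩
    have hx0 : x ≠ 0 := by
      rintro rfl
      exact hx (extZero_zero φ)
    obtain ⟨v, hv⟩ := exists_hasVal hx0
    rw [extZero_of_ne hx0] at hx
    have h2 := hR _ hx
    rw [vval_of_hasVal hv] at h2
    rw [hv.mem_iff]
    exact_mod_cast (Int.floor_le R).trans h2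
  · rintro ⟨⟨r, -, hr⟩, C, hC⟩
    refine ⟨hr.mem_spaceC, C, fun x hx => ?_⟩
    obtain ⟨v, hv⟩ := exists_hasVal x.2
    have := hC x.1 (by rwa [extZero_coe])
    rw [hv.mem_iff] at this
    rw [vval_of_hasVal hv]
    exact_mod_cast this

lemma mem_Cminus_iff {φ : Punctured F n → E} : φ ∈ Cminus F n E ↔
    (∃ r : ℕ, 1 ≤ r ∧ HomInv r (extZero φ)) ∧ ∃ d : ℤ, ∀ x ∈ vBall F n d, extZero φ x = 0 := by
  constructor
  · rintro ⟨h1, R, hR⟩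
    refine ⟨exists_homInv_of_mem_spaceC h1, ⌊R⌋ + 1, fun x hx => ?_⟩
    by_cases hx0 : x = 0
    · rw [hx0, extZero_zero]
    · obtain ⟨v, hv⟩ := exists_hasVal hx0
      rw [extZero_of_ne hx0]
      by_contra h
      have h2 := hR _ h
      rw [vval_of_hasVal hv] at h2
      rw [hv.mem_iff] at hx
      have h3 : (v : ℝ) < ⌊R⌋ + 1 := h2.trans_lt (Int.lt_floor_add_one R)
      have h4 : v < ⌊R⌋ + 1 := by exact_mod_cast h3
      omega
  · rintro ⟨⟨r, -, hr⟩, d, hd⟩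
    refine ⟨hr.mem_spaceC, d, fun x hx => ?_⟩
    obtain ⟨v, hv⟩ := exists_hasVal x.2
    rw [vval_of_hasVal hv]
    by_contra h
    refine hx ?_
    have := hd x.1 (hv.mem_iff.2 (by
      have : d < v := by exact_mod_cast not_le.1 h
      omega))
    rwa [extZero_coe] at this

end KFinite

/-! ### Slab integrals for real coefficients and their symmetry. -/

section RealOperators

variable {F : Type*} [Field F] [ValuativeRel F] [TopologicalSpace F] [IsNonarchimedeanLocalField F]
variable {n : ℕ} [MeasurableSpace F] [BorelSpace F]

/-- The normalized integral of `h` over the slab `ξ · y ∈ a + 𝔭 ^ k`. -/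
def pop (k : ℤ) (a : F) (h : (Fin n → F) → ℝ) (ξ : Fin n → F) : ℝ :=
  (resCard F : ℝ) ^ k * ∫ y in slab ξ k a, h y ∂(haarV F n)

/-- The approximation of the kernel operator of `β` at level `m`. -/
def bop (m : ℕ) (h : (Fin n → F) → ℝ) (x : Fin n → F) : ℝ :=
  ∑ k ∈ Finset.range m, ((resCard F : ℝ) ^ (n - 1)) ^ (k + 1) *
    ((pop (k + 1) 1 h x - pop (k + 1) 0 h x) - (pop k 1 h x - pop k 0 h x))

lemma schwartz_integrable_haarV {h : (Fin n → F) → ℝ} (hh : h ∈ schwartz (Fin n → F) ℝ) :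
    Integrable h (haarV F n) :=
  schwartz_integrable (fun _ h1 _ => haarV_ne_top h1) hh

lemma setIntegral_slab_eq_sum {h : (Fin n → F) → ℝ} {T : Finset ℝ}
    (h1 : ∀ e ∈ T, IsCompact (h ⁻¹' {e}) ∧ IsOpen (h ⁻¹' {e})) (h2 : ∀ x, h x ∉ T → h x = 0)
    (ξ : Fin n → F) (k : ℤ) (a : F) :
    ∫ y in slab ξ k a, h y ∂(haarV F n) =
      ∑ e ∈ T, (haarV F n).real (h ⁻¹' {e} ∩ slab ξ k a) * e := by
  rw [(integral_schwartz_eq_sum (μ := (haarV F n).restrict (slab ξ k a)) (fun e he => (h1 e he).2)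
    (fun e he => ((Measure.restrict_apply_le _ _).trans_lt (h1 e he).1.measure_lt_top).ne) h2).2]
  refine Finset.sum_congr rfl fun e he => ?_
  rw [measureReal_restrict_apply (h1 e he).2.measurableSet]

/-- The Radon transform as a normalized integral over a thin slab. -/
lemma radon_eq_pop {h : (Fin n → F) → ℝ} (hh : h ∈ schwartz (Fin n → F) ℝ) {l v k : ℤ}
    (hl : ∀ x, ∀ u ∈ vBall F n l, h (x + u) = h x) {ξ : Punctured F n} (hξ : HasVal ξ.1 v)
    (hk : l + v ≤ k) (t : F) : radon h ξ t = pop k t h ξ.1 := by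
  obtain ⟨T, -, h1, h2⟩ := schwartz_values hh
  have e1 : radon h ξ t = _ := (isRatAdd_hyperMeasure ξ t).setSum_real h1 h2
  rw [e1, pop, setIntegral_slab_eq_sum h1 h2, Finset.mul_sum]
  refine Finset.sum_congr rfl fun e he => ?_
  rw [hyperMeasure_real_eq hξ hk t (h1 e he).2.measurableSet fun x u hu => by simp [hl x u hu]]
  ring

lemma isCompact_coset (k : ℤ) (a : F) : IsCompact {s : F | s - a ∈ pBall F k} := by
  have h := (isCompact_pBall (F := F) k).image (continuous_add_const a)
  convert h using 1
  refine Set.ext fun s => ⟨fun hs => ⟨s - a, hs, sub_add_cancel s a⟩, ?_⟩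
  rintro ⟨b, hb, rfl⟩
  show b + a - a ∈ pBall F k
  rwa [add_sub_cancel_right]

lemma setIntegral_hyperMeasure {A : Set (Fin n → F)} (h1 : IsCompact A) (h2 : IsOpen A)
    (ξ : Punctured F n) (k : ℤ) (a : F) :
    IntegrableOn (fun s => (hyperMeasure ξ s).real A) {s : F | s - a ∈ pBall F k} (haarF F) ∧
    ∫ s in {s : F | s - a ∈ pBall F k}, (hyperMeasure ξ s).real A ∂(haarF F) =
      (haarV F n).real (A ∩ slab ξ.1 k a) := by
  have hA := indicator_const_mem_schwartz h1 h2 (1 : ℝ)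
  have e1 : (fun s => (hyperMeasure ξ s).real A) = radon (A.indicator fun _ => (1 : ℝ)) ξ := by
    ext s
    rw [radon_real hA, integral_indicator_const _ h2.measurableSet, smul_eq_mul, mul_one]
  have hc : Continuous fun s => (hyperMeasure ξ s).real A := by
    rw [e1]
    exact (radon_mem_schwartz hA ξ).1.continuous
  have hm : Measurable fun s => hyperMeasure ξ s A := by
    have : (fun s => hyperMeasure ξ s A) = fun s => ENNReal.ofReal ((hyperMeasure ξ s).real A) := by
      ext s
      rw [measureReal_def, ENNReal.ofReal_toReal (hyperMeasure_compactOpen ξ s h1 h2).1]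
    rw [this]
    exact ENNReal.measurable_ofReal.comp hc.measurable
  refine ⟨hc.continuousOn.integrableOn_compact (isCompact_coset k a), ?_⟩
  simp only [measureReal_def]
  rw [integral_toReal hm.aemeasurable (Filter.Eventually.of_forall fun s =>
    (hyperMeasure_compactOpen ξ s h1 h2).1.lt_top), lintegral_hyperMeasure_slab ξ k a h2.measurableSet]

lemma setIntegral_radon {h : (Fin n → F) → ℝ} (hh : h ∈ schwartz (Fin n → F) ℝ) (ξ : Punctured F n)
    (k : ℤ) (a : F) : ∫ s in {s : F | s - a ∈ pBall F k}, radon h ξ s ∂(haarF F) =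
      ∫ y in slab ξ.1 k a, h y ∂(haarV F n) := by
  obtain ⟨T, -, h1, h2⟩ := schwartz_values hh
  have e1 : radon h ξ = fun s => ∑ e ∈ T, (hyperMeasure ξ s).real (h ⁻¹' {e}) * e := by
    ext s
    exact (isRatAdd_hyperMeasure ξ s).setSum_real h1 h2
  rw [e1, setIntegral_slab_eq_sum h1 h2, integral_finsetSum]
  · refine Finset.sum_congr rfl fun e he => ?_
    rw [integral_mul_const, (setIntegral_hyperMeasure (h1 e he).1 (h1 e he).2 ξ k a).2]
  · exact fun e he => (setIntegral_hyperMeasure (h1 e he).1 (h1 e he).2 ξ k a).1.mul_const e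

/-- Through this identity the expansion of β by averages becomes one by slab integrals, to which
Fubini applies. -/
lemma avg_radon {h : (Fin n → F) → ℝ} (hh : h ∈ schwartz (Fin n → F) ℝ) (ξ : Punctured F n)
    (k : ℤ) (a : F) : avg k a (radon h ξ) = pop k a h ξ.1 := by
  rw [avg, setIntegral_radon hh, pop]

lemma Br_eq_bop (hn : 2 ≤ n) {h : (Fin n → F) → ℝ} (hh : h ∈ schwartz (Fin n → F) ℝ) {l v : ℤ} {m : ℕ}
    (hl : ∀ x, ∀ u ∈ vBall F n l, h (x + u) = h x) {x : Fin n → F} (hx : HasVal x v)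
    (hm : l + v ≤ m) : Br h x = bop m h x := by
  rw [Br_of_ne _ hx.ne_zero, betaValue_real hn (radon_mem_schwartz hh _)
    fun t c hc => radon_invariant (ξ := ⟨x, hx.ne_zero⟩) hh.1 hx hm hl t c hc]
  simp only [avg_radon hh]
  rfl

lemma pop_eq_zero {k : ℤ} (hk : 1 ≤ k) {h : (Fin n → F) → ℝ} {v : ℤ} {ξ : Fin n → F}
    (hξ : HasVal ξ v) (hh : ∀ x, h x ≠ 0 → x ∈ vBall F n (1 - v)) : pop k 1 h ξ = 0 := by
  rw [pop, setIntegral_congr_fun (g := fun _ => 0) (isClopen_slab ξ k 1).isOpen.measurableSet]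
  · simp
  · intro x hx
    by_contra h0
    exact slab_one_val hξ hk hx (hh x h0)

/-- On test functions supported away from the origin, `M` is given by integrals over slabs of a
uniform thickness. -/
lemma Mr_eq_pop {f : (Fin n → F) → ℝ} (hf : f ∈ schwartz (Fin n → F) ℝ) {l C j : ℤ}
    (hl : ∀ x, ∀ u ∈ vBall F n l, f (x + u) = f x) (hC : ∀ x, f x ≠ 0 → x ∈ vBall F n C)
    (hj : 1 ≤ j) (hj' : l - C ≤ j) (ξ : Fin n → F) : Mr f ξ = pop j 1 f ξ := by
  by_cases h0 : ξ = 0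
  · subst h0
    have : slab (0 : Fin n → F) j 1 = ∅ := by
      refine Set.eq_empty_of_forall_notMem fun x hx => ?_
      rw [mem_slab, zero_dotProduct, zero_sub, neg_mem_iff] at hx
      exact one_notMem_pBall hj hx
    rw [Mr_zero_right, pop, this]
    simp
  · obtain ⟨v, hv⟩ := exists_hasVal h0
    -- If v ≥ 1 - C neither side meets the support of f; otherwise v ≤ -C, so l + v ≤ l - C ≤ j and
    -- the slab is thin enough for this ξ.
    by_cases hvC : 1 - C ≤ v
    · rw [Mr_eq_zero hC (hv.mem_iff.2 hvC), pop_eq_zero hj hv]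
      exact fun x hx => vBall_anti (by omega) (hC x hx)
    · rw [Mr_of_ne _ h0, radon_eq_pop (k := j) hf hl (ξ := ⟨ξ, h0⟩) hv (by omega)]

/-! ### Fubini -/

lemma measurableSet_dot (k : ℤ) (a : F) :
    MeasurableSet {p : (Fin n → F) × (Fin n → F) | p.1 ⬝ᵥ p.2 - a ∈ pBall F k} := by
  have : Continuous fun p : (Fin n → F) × (Fin n → F) => p.1 ⬝ᵥ p.2 - a := by
    unfold dotProduct
    fun_prop
  exact ((isOpen_pBall k).preimage this).measurableSet

lemma slab_comm {k : ℤ} {a : F} {x y : Fin n → F} : y ∈ slab x k a ↔ x ∈ slab y k a := by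
  rw [mem_slab, mem_slab, dotProduct_comm]

lemma integrable_dot_kernel (k : ℤ) (a : F) {f g : (Fin n → F) → ℝ} (hf : Integrable f (haarV F n))
    (hg : Integrable g (haarV F n)) :
    Integrable (fun p : (Fin n → F) × (Fin n → F) => f p.1 * (slab p.1 k a).indicator g p.2)
      ((haarV F n).prod (haarV F n)) := by
  have h := (hf.mul_prod hg).indicator (measurableSet_dot (n := n) k a)
  refine h.congr (Filter.Eventually.of_forall fun p => ?_)
  by_cases hp : p.2 ∈ slab p.1 k a
  · simp only
    rw [Set.indicator_of_mem hp, Set.indicator_of_mem (show p ∈ {p | p.1 ⬝ᵥ p.2 - a ∈ pBall F k} from hp)]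
  · simp only
    rw [Set.indicator_of_notMem hp,
      Set.indicator_of_notMem (show p ∉ {p | p.1 ⬝ᵥ p.2 - a ∈ pBall F k} from hp), mul_zero]

lemma mul_pop_eq (k : ℤ) (a : F) (f g : (Fin n → F) → ℝ) (x : Fin n → F) :
    f x * pop k a g x = (resCard F : ℝ) ^ k *
      ∫ y, f x * (slab x k a).indicator g y ∂(haarV F n) := by
  rw [integral_const_mul, integral_indicator (isClopen_slab x k a).isOpen.measurableSet, pop]
  ring

lemma integrable_mul_pop (k : ℤ) (a : F) {f g : (Fin n → F) → ℝ} (hf : Integrable f (haarV F n))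
    (hg : Integrable g (haarV F n)) : Integrable (fun x => f x * pop k a g x) (haarV F n) := by
  simp only [mul_pop_eq]
  exact (integrable_dot_kernel k a hf hg).integral_prod_left.const_mul _

/-- Slab integration is a symmetric operator. -/
lemma integral_mul_pop_comm (k : ℤ) (a : F) {f g : (Fin n → F) → ℝ} (hf : Integrable f (haarV F n))
    (hg : Integrable g (haarV F n)) :
    ∫ x, f x * pop k a g x ∂(haarV F n) = ∫ y, g y * pop k a f y ∂(haarV F n) := by
  simp only [mul_pop_eq]
  rw [integral_const_mul, integral_const_mul, integral_integral_swap (integrable_dot_kernel k a hf hg)]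
  congr 2
  ext y
  congr 1
  ext x
  by_cases hp : y ∈ slab x k a
  · rw [Set.indicator_of_mem hp, Set.indicator_of_mem (slab_comm.1 hp), mul_comm]
  · rw [Set.indicator_of_notMem hp, Set.indicator_of_notMem (fun h => hp (slab_comm.1 h)), mul_zero,
      mul_zero]

lemma integral_mul_bop (m : ℕ) {f g : (Fin n → F) → ℝ} (hf : Integrable f (haarV F n))
    (hg : Integrable g (haarV F n)) : ∫ x, f x * bop m g x ∂(haarV F n) =
    ∑ k ∈ Finset.range m, ((resCard F : ℝ) ^ (n - 1)) ^ (k + 1) *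
      (((∫ x, f x * pop (k + 1) 1 g x ∂(haarV F n)) - ∫ x, f x * pop (k + 1) 0 g x ∂(haarV F n)) -
        ((∫ x, f x * pop k 1 g x ∂(haarV F n)) - ∫ x, f x * pop k 0 g x ∂(haarV F n))) := by
  have h := fun (k : ℤ) (a : F) => integrable_mul_pop k a hf hg
  simp only [bop, Finset.mul_sum, mul_left_comm (f _)]
  rw [integral_finsetSum]
  · refine Finset.sum_congr rfl fun k _ => ?_
    rw [integral_const_mul]
    congr 1
    simp only [mul_sub]
    rw [← integral_sub (h _ _) (h _ _), ← integral_sub (h _ _) (h _ _)]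
    exact integral_sub ((h _ _).sub (h _ _)) ((h _ _).sub (h _ _))
  · intro k _
    simp only [mul_sub]
    exact (((h _ _).const_mul _).sub ((h _ _).const_mul _)).sub
      (((h _ _).const_mul _).sub ((h _ _).const_mul _))

lemma integral_mul_bop_comm (m : ℕ) {f g : (Fin n → F) → ℝ} (hf : Integrable f (haarV F n))
    (hg : Integrable g (haarV F n)) :
    ∫ x, f x * bop m g x ∂(haarV F n) = ∫ y, g y * bop m f y ∂(haarV F n) := by
  rw [integral_mul_bop m hf hg, integral_mul_bop m hg hf]
  simp only [fun k a => integral_mul_pop_comm (k := k) (a := a) hf hg]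

end RealOperators

/-! ### The inversion formula for test functions -/

section Inversion

variable {F : Type*} [Field F] [ValuativeRel F] [TopologicalSpace F] [IsNonarchimedeanLocalField F]
variable {n : ℕ}

/-- The projection of `y` along `ξ` to the hyperplane where the `i`-th coordinate is zero. -/
def projAlong (ξ : Fin n → F) (i : Fin n) (y : Fin n → F) : Fin n → F := y - (y i / ξ i) • ξ

lemma projAlong_add_smul (ξ : Fin n → F) (i : Fin n) (y : Fin n → F) :
    y = projAlong ξ i y + (y i / ξ i) • ξ := (sub_add_cancel _ _).symm

lemma projAlong_add (ξ : Fin n → F) (i : Fin n) (y u : Fin n → F) :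
    projAlong ξ i (y + u) = projAlong ξ i y + projAlong ξ i u := by
  simp only [projAlong, Pi.add_apply, add_div, add_smul]
  abel

lemma projAlong_smul_self {ξ : Fin n → F} {i : Fin n} (hi : ξ i ≠ 0) (s : F) :
    projAlong ξ i (s • ξ) = 0 := by
  simp [projAlong, mul_div_assoc, div_self hi]

lemma projAlong_mem_vBall {ξ : Fin n → F} {i : Fin n} {v k : ℤ} (hξ : HasVal ξ v)
    (hi : absV (ξ i) = (resCard F : ℝ≥0) ^ (-v)) {y : Fin n → F} (hy : y ∈ vBall F n k) :
    projAlong ξ i y ∈ vBall F n k := by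
  refine sub_mem hy ?_
  have h1 : y i / ξ i ∈ pBall F (k - v) := by
    rw [div_mem_pBall_iff hi, sub_add_cancel]
    exact mem_vBall.1 hy i
  have h2 := smul_mem_vBall h1 (hξ.mem_iff.2 le_rfl)
  rwa [sub_add_cancel] at h2

/-- The vectors whose projection along `ξ` is in a given ball. -/
def tube (ξ : Fin n → F) (i : Fin n) (L : ℤ) : Set (Fin n → F) := {y | projAlong ξ i y ∈ vBall F n L}

lemma mem_tube {ξ : Fin n → F} {i : Fin n} {L : ℤ} {y : Fin n → F} :
    y ∈ tube ξ i L ↔ projAlong ξ i y ∈ vBall F n L := Iff.rfl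

lemma continuous_projAlong (ξ : Fin n → F) (i : Fin n) : Continuous (projAlong ξ i) := by
  unfold projAlong
  fun_prop

lemma isClopen_tube (ξ : Fin n → F) (i : Fin n) (L : ℤ) : IsClopen (tube ξ i L) :=
  IsClopen.preimage ⟨isClosed_vBall L, isOpen_vBall L⟩ (continuous_projAlong ξ i)

/-- On a thin slab, pairing with a vector `y` of a narrow tube around `ξ` is nearly constant. -/
lemma dot_sub_mem_of_mem_tube {ξ : Fin n → F} {i : Fin n} {v B C j k : ℤ}
    (hi : absV (ξ i) = (resCard F : ℝ≥0) ^ (-v)) {y : Fin n → F} (hyC : y ∈ vBall F n C)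
    (hj : k ≤ j + C - v) (hy : y ∈ tube ξ i (k - B)) {x : Fin n → F} (hx : x ∈ vBall F n B)
    (hx' : x ∈ slab ξ j 1) : y ⬝ᵥ x - y i / ξ i ∈ pBall F k := by
  have h1 : y i / ξ i ∈ pBall F (C - v) := by
    rw [div_mem_pBall_iff hi, sub_add_cancel]
    exact mem_vBall.1 hyC i
  have h2 := dot_mem_pBall (mem_tube.1 hy) hx
  rw [sub_add_cancel] at h2
  have h3 := pBall_anti (by omega : k ≤ (C - v) + j) (mul_mem_pBall h1 (mem_slab.1 hx'))
  -- Split y into its component along ξ and the rest: the tube makes the first term small, the thin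
  -- slab the second.
  have h4 : y ⬝ᵥ x - y i / ξ i = projAlong ξ i y ⬝ᵥ x + y i / ξ i * (ξ ⬝ᵥ x - 1) := by
    conv_lhs => rw [projAlong_add_smul ξ i y]
    rw [add_dotProduct, smul_dotProduct, smul_eq_mul, ← projAlong_add_smul]
    ring
  rw [h4]
  exact add_mem h2 h3

variable [MeasurableSpace F] [BorelSpace F]

lemma pop_indicator_one (k : ℤ) (a : F) {S : Set (Fin n → F)} (hS : MeasurableSet S)
    (y : Fin n → F) : pop k a (S.indicator fun _ => 1) y =
      (resCard F : ℝ) ^ k * (haarV F n).real (S ∩ slab y k a) := by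
  rw [pop, setIntegral_indicator hS, setIntegral_const, smul_eq_mul, mul_one, Set.inter_comm]

lemma measurableSet_ball_inter_slab (ξ : Fin n → F) (B j : ℤ) (a : F) :
    MeasurableSet ((vBall F n B : Set (Fin n → F)) ∩ slab ξ j a) :=
  (isOpen_vBall B).measurableSet.inter (isClopen_slab ξ j a).isOpen.measurableSet

/-- For y in the tube, y · x is congruent to y_i/ξ_i modulo 𝔭^k for every x in the truncated slab,
so the slab of y contains that whole set or misses it. -/
lemma pop_of_mem_tube {ξ : Fin n → F} {i : Fin n} {v B C j k : ℤ}
    (hi : absV (ξ i) = (resCard F : ℝ≥0) ^ (-v)) {y : Fin n → F} (hyC : y ∈ vBall F n C)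
    (hj : k ≤ j + C - v) (hy : y ∈ tube ξ i (k - B)) (a : F) :
    pop k a (((vBall F n B : Set (Fin n → F)) ∩ slab ξ j 1).indicator fun _ => 1) y =
      (haarV F n).real ((vBall F n B : Set (Fin n → F)) ∩ slab ξ j 1) * ((resCard F : ℝ) ^ k *
        {s : F | s - a ∈ pBall F k}.indicator (fun _ => 1) (y i / ξ i)) := by
  classical
  rw [pop_indicator_one k a (measurableSet_ball_inter_slab ξ B j 1)]
  have key : ∀ x ∈ (vBall F n B : Set (Fin n → F)) ∩ slab ξ j 1,
      (x ∈ slab y k a ↔ y i / ξ i - a ∈ pBall F k) := fun x hx => by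
    have := add_mem_cancel_left (y := y i / ξ i - a)
      (dot_sub_mem_of_mem_tube hi hyC hj hy hx.1 hx.2)
    rwa [sub_add_sub_cancel] at this
  by_cases h : y i / ξ i - a ∈ pBall F k
  · rw [Set.indicator_of_mem (show y i / ξ i ∈ {s : F | s - a ∈ pBall F k} from h),
      Set.inter_eq_left.2 fun x hx => (key x hx).2 h]
    ring
  · rw [Set.indicator_of_notMem (show y i / ξ i ∉ {s : F | s - a ∈ pBall F k} from h),
      (Set.disjoint_left.2 fun x hx hx' => h ((key x hx).1 hx')).inter_eq, measureReal_empty]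
    ring

/-- Outside of the tube, the mass of a slab is distributed evenly over thinner slabs. -/
lemma pop_succ_of_notMem_tube {ξ : Fin n → F} {i : Fin n} {v B j k : ℤ} (hξ : HasVal ξ v)
    (hi : absV (ξ i) = (resCard F : ℝ≥0) ^ (-v)) {y : Fin n → F} (hy : y ∉ tube ξ i (k + 1 - B))
    (a : F) :
    pop (k + 1) a (((vBall F n B : Set (Fin n → F)) ∩ slab ξ j 1).indicator fun _ => 1) y =
      pop k a (((vBall F n B : Set (Fin n → F)) ∩ slab ξ j 1).indicator fun _ => 1) y := by
  classical
  rw [pop_indicator_one _ a (measurableSet_ball_inter_slab ξ B j 1),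
    pop_indicator_one _ a (measurableSet_ball_inter_slab ξ B j 1)]
  set S := (vBall F n B : Set (Fin n → F)) ∩ slab ξ j 1 with hS
  have hi0 := ne_zero_of_absV hi
  rw [mem_tube, mem_vBall] at hy
  push Not at hy
  obtain ⟨i', hi'⟩ := hy
  obtain ⟨p, hp⟩ := exists_of_zpow F B
  -- This u is orthogonal to ξ and lies in the ball, so translating by its integral multiples
  -- preserves S. As y is outside the tube, y · u is not in 𝔭^(k+1), and these multiples permute the
  -- thinner slabs of y inside the thicker one.
  set u : Fin n → F := p • (Pi.single i' 1 - Pi.single i (ξ i' / ξ i)) with hu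
  have hone : (1 : F) ∈ pBall F 0 := mem_pBall_zero.2 (one_mem _)
  have hu1 : u ∈ vBall F n B := by
    have h1 : ξ i' / ξ i ∈ pBall F 0 := by
      rw [div_mem_pBall_iff hi, zero_add]
      exact mem_vBall.1 (hξ.mem_iff.2 le_rfl) i'
    have := smul_mem_vBall ((mem_pBall_of_eq hp).2 le_rfl)
      (sub_mem (single_mem_vBall hone i') (single_mem_vBall h1 i))
    rwa [add_zero] at this
  have hu2 : ξ ⬝ᵥ u = 0 := by
    rw [hu, dotProduct_smul, dotProduct_sub, dotProduct_single, dotProduct_single, mul_one,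
      mul_div_cancel₀ _ hi0, sub_self, smul_zero]
  have hu3 : y ⬝ᵥ u ∉ pBall F (k + 1) := by
    have : y ⬝ᵥ u = p * projAlong ξ i y i' := by
      rw [hu, dotProduct_smul, dotProduct_sub, dotProduct_single, dotProduct_single, projAlong,
        Pi.sub_apply, Pi.smul_apply, smul_eq_mul, smul_eq_mul]
      ring
    rwa [this, mul_mem_pBall_iff hp]
  have hinv : ∀ c ∈ pBall F k, (haarV F n).real (S ∩ slab y (k + 1) (a + c)) =
      (haarV F n).real (S ∩ slab y (k + 1) a) := by
    intro c hc
    obtain ⟨b, hb, hbc⟩ := exists_integer_mul hu3 hc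
    have hbu : b • u ∈ vBall F n B := by
      have := smul_mem_vBall hb hu1
      rwa [zero_add] at this
    rw [measureReal_def, measureReal_def,
      ← measure_preimage_add_right (haarV F n) (b • u) (S ∩ slab y (k + 1) (a + c))]
    congr 2
    ext x
    have e1 : ξ ⬝ᵥ (x + b • u) - 1 = ξ ⬝ᵥ x - 1 := by
      rw [dotProduct_add, dotProduct_smul, hu2, smul_zero, add_zero]
    have e2 : y ⬝ᵥ (x + b • u) - (a + c) = y ⬝ᵥ x - a := by
      rw [dotProduct_add, dotProduct_smul, smul_eq_mul, hbc]
      ring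
    simp only [hS, Set.mem_preimage, Set.mem_inter_iff, SetLike.mem_coe, mem_slab, e1, e2,
      add_mem_cancel_right hbu]
  obtain ⟨T, hT, h1, h2⟩ := exists_coset_reps F k
  have hU : S ∩ slab y k a = ⋃ b ∈ T, S ∩ slab y (k + 1) (a + b) := by
    ext x
    simp only [Set.mem_inter_iff, Set.mem_iUnion, mem_slab, exists_prop]
    constructor
    · rintro ⟨hx, hx'⟩
      obtain ⟨b, ⟨hb, hb'⟩, -⟩ := h2 _ hx'
      exact ⟨b, hb, hx, by rwa [← sub_sub]⟩
    · rintro ⟨b, hb, hx, hx'⟩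
      refine ⟨hx, ?_⟩
      have := add_mem (pBall_anti (by omega) hx') (h1 b hb)
      rwa [← sub_sub, sub_add_cancel] at this
  have hd : (T : Set F).PairwiseDisjoint fun b => S ∩ slab y (k + 1) (a + b) := by
    intro b hb c hc hbc
    refine Set.disjoint_left.2 fun x hx hx' => hbc ?_
    have e1 : y ⬝ᵥ x - a - b ∈ pBall F (k + 1) := by
      rw [sub_sub]
      exact hx.2
    have e2 : y ⬝ᵥ x - a - c ∈ pBall F (k + 1) := by
      rw [sub_sub]
      exact hx'.2
    have e3 : y ⬝ᵥ x - a ∈ pBall F k := by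
      have := add_mem (pBall_anti (by omega) e1) (h1 b hb)
      rwa [sub_add_cancel] at this
    exact (h2 _ e3).unique ⟨hb, e1⟩ ⟨hc, e2⟩
  have hmeas : ∀ b, MeasurableSet (S ∩ slab y (k + 1) (a + b)) := fun b =>
    (measurableSet_ball_inter_slab ξ B j 1).inter (isClopen_slab y _ _).isOpen.measurableSet
  have hfin : ∀ b, haarV F n (S ∩ slab y (k + 1) (a + b)) ≠ ∞ := fun b =>
    ((measure_mono (Set.inter_subset_left.trans Set.inter_subset_left)).trans_lt
      (haarV_ne_top (isCompact_vBall B)).lt_top).ne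
  rw [hU, measureReal_biUnion_finset hd (fun b _ => hmeas b) (fun b _ => hfin b),
    Finset.sum_congr rfl fun b hb => hinv b (h1 b hb), Finset.sum_const, hT, nsmul_eq_mul,
    zpow_add_one₀ (resCard_pos F).ne']
  ring

/-- The dual vector `e_i / ξ_i` of `ξ`. -/
def coordDual (ξ : Fin n → F) (i : Fin n) : Fin n → F := Pi.single i (ξ i)⁻¹

lemma coordDual_dot (ξ : Fin n → F) (i : Fin n) (y : Fin n → F) :
    coordDual ξ i ⬝ᵥ y = y i / ξ i := by
  rw [coordDual, single_dotProduct, div_eq_inv_mul]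

lemma coordDual_hasVal {ξ : Fin n → F} {i : Fin n} {v : ℤ}
    (hi : absV (ξ i) = (resCard F : ℝ≥0) ^ (-v)) : HasVal (coordDual ξ i) (-v) := by
  have h := absV_inv_eq hi
  rw [hasVal_iff]
  refine ⟨single_mem_vBall ((mem_pBall_of_eq h).2 le_rfl) i, fun h' => ?_⟩
  have h2 := mem_vBall.1 h' i
  rw [coordDual, Pi.single_eq_same, mem_pBall_of_eq h] at h2
  omega

/-- The cross-section of the tube has constant volume: translation by sξ reduces to s = 0, where
thickening the cross-section by 𝔭^(L-v) along ξ gives exactly the ball of level L. -/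
lemma hyperMeasure_tube {ξ : Fin n → F} {i : Fin n} {v C L : ℤ} (hξ : HasVal ξ v)
    (hi : absV (ξ i) = (resCard F : ℝ≥0) ^ (-v)) (hL : C ≤ L) {s : F} (hs : s ∈ pBall F (C - v)) :
    (hyperMeasure ⟨coordDual ξ i, (coordDual_hasVal hi).ne_zero⟩ s).real
      (tube ξ i L ∩ slab (coordDual ξ i) (C - v) 0) =
      (resCard F : ℝ) ^ (L - v) * ((resCard F : ℝ) ^ (-L)) ^ n := by
  have hi0 := ne_zero_of_absV hi
  have hw := coordDual_hasVal hi
  set W : Punctured F n := ⟨coordDual ξ i, hw.ne_zero⟩ with hW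
  have hm : MeasurableSet (tube ξ i L ∩ slab (coordDual ξ i) (C - v) 0) :=
    ((isClopen_tube ξ i L).inter (isClopen_slab _ _ _)).isOpen.measurableSet
  have e1 : W.1 ⬝ᵥ (s • ξ) = s := by
    rw [coordDual_dot, Pi.smul_apply, smul_eq_mul, mul_div_assoc, div_self hi0, mul_one]
  have e2 : hyperMeasure W s (tube ξ i L ∩ slab (coordDual ξ i) (C - v) 0) =
      hyperMeasure W 0 (tube ξ i L ∩ slab (coordDual ξ i) (C - v) 0) := by
    have := hyperMeasure_apply_add_dot W 0 (v := s • ξ) hm fun x => by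
      have e3 : coordDual ξ i ⬝ᵥ (x + s • ξ) - 0 = coordDual ξ i ⬝ᵥ x - 0 + s := by
        rw [dotProduct_add, show coordDual ξ i ⬝ᵥ (s • ξ) = s from e1]
        ring
      rw [Set.mem_inter_iff, Set.mem_inter_iff, mem_tube, mem_tube, projAlong_add,
        projAlong_smul_self hi0, add_zero, mem_slab, mem_slab, e3, add_mem_cancel_right hs]
    rwa [e1, zero_add] at this
  rw [measureReal_def, e2, ← measureReal_def, hyperMeasure_real_eq (l := L) (k := L - v) hw
    (by omega) 0 hm]
  · congr 1
    rw [← haarV_real_vBall]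
    congr 1
    ext y
    rw [Set.mem_inter_iff, Set.mem_inter_iff, mem_tube, mem_slab, mem_slab, sub_zero,
      coordDual_dot]
    constructor
    · rintro ⟨⟨h1, -⟩, h2⟩
      rw [projAlong_add_smul ξ i y]
      have := smul_mem_vBall h2 (hξ.mem_iff.2 le_rfl)
      rw [sub_add_cancel] at this
      exact add_mem h1 this
    · intro hy
      have h1 : y i / ξ i ∈ pBall F (L - v) := by
        rw [div_mem_pBall_iff hi, sub_add_cancel]
        exact mem_vBall.1 hy i
      exact ⟨⟨projAlong_mem_vBall hξ hi hy, pBall_anti (by omega) h1⟩, h1⟩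
  · intro x u hu
    have h1 : coordDual ξ i ⬝ᵥ u ∈ pBall F (C - v) := by
      rw [coordDual_dot, div_mem_pBall_iff hi, sub_add_cancel]
      exact mem_vBall.1 (vBall_anti hL hu) i
    rw [Set.mem_inter_iff, Set.mem_inter_iff, mem_tube, mem_tube, projAlong_add,
      add_mem_cancel_right (projAlong_mem_vBall hξ hi hu), mem_slab, mem_slab, dotProduct_add,
      add_sub_right_comm, add_mem_cancel_right h1]

/-- Integrals over a narrow tube around a line reduce to integrals over the line. -/
lemma pop_tube {ξ : Fin n → F} {i : Fin n} {v l C L : ℤ} (hξ : HasVal ξ v)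
    (hi : absV (ξ i) = (resCard F : ℝ≥0) ^ (-v)) (hL : C ≤ L) (hL' : l ≤ L) {φ : (Fin n → F) → ℝ}
    (hφ : φ ∈ schwartz (Fin n → F) ℝ) (hl : ∀ x, ∀ u ∈ vBall F n l, φ (x + u) = φ x)
    (hC : ∀ x, φ x ≠ 0 → x ∈ vBall F n C) (k : ℤ) (a : F) :
    pop k a ((tube ξ i L).indicator φ) (coordDual ξ i) =
      (resCard F : ℝ) ^ (L - v) * ((resCard F : ℝ) ^ (-L)) ^ n * avg k a fun s => φ (s • ξ) := by
  classical
  have hw := coordDual_hasVal hi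
  have hi0 := ne_zero_of_absV hi
  set W : Punctured F n := ⟨coordDual ξ i, hw.ne_zero⟩ with hW
  -- The tube is unbounded along ξ; this slab makes it compact without losing any of the support of
  -- φ.
  have hcl := (isClopen_tube ξ i L).inter (isClopen_slab (coordDual ξ i) (C - v) 0)
  have hco : IsCompact (tube ξ i L ∩ slab (coordDual ξ i) (C - v) 0) := by
    refine (isCompact_vBall (min L C)).of_isClosed_subset hcl.isClosed fun y hy => ?_
    rw [SetLike.mem_coe, projAlong_add_smul ξ i y]
    have h2 := mem_slab.1 hy.2
    rw [sub_zero, coordDual_dot] at h2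
    have := smul_mem_vBall h2 (hξ.mem_iff.2 le_rfl)
    rw [sub_add_cancel] at this
    exact add_mem (vBall_anti (min_le_left _ _) (mem_tube.1 hy.1)) (vBall_anti (min_le_right _ _) this)
  -- Since L ≥ l, φ equals φ(sξ) on the whole cross-section at s.
  have key : radon ((tube ξ i L).indicator φ) W = fun s =>
      (resCard F : ℝ) ^ (L - v) * ((resCard F : ℝ) ^ (-L)) ^ n * φ (s • ξ) := by
    ext s
    have e1 : radon ((tube ξ i L).indicator φ) W s = radon (φ (s • ξ) •
        (tube ξ i L ∩ slab (coordDual ξ i) (C - v) 0).indicator (fun _ => (1 : ℝ))) W s := by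
      refine radon_congr fun y hy => ?_
      have hy' : y i / ξ i = s := by rw [← coordDual_dot, ← hy]
      rw [Pi.smul_apply, smul_eq_mul]
      by_cases h1 : y ∈ tube ξ i L
      · have h2 : φ y = φ (s • ξ) := by
          rw [projAlong_add_smul ξ i y, hy', add_comm]
          exact hl _ _ (vBall_anti hL' h1)
        rw [Set.indicator_of_mem h1, h2]
        by_cases h3 : φ (s • ξ) = 0
        · rw [h3, zero_mul]
        · rw [Set.indicator_of_mem, mul_one]
          refine ⟨h1, ?_⟩
          rw [mem_slab, sub_zero, coordDual_dot, div_mem_pBall_iff hi, sub_add_cancel]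
          exact mem_vBall.1 (hC y (h2 ▸ h3)) i
      · rw [Set.indicator_of_notMem h1, Set.indicator_of_notMem (fun h => h1 h.1), mul_zero]
    have hS := indicator_const_mem_schwartz hco hcl.isOpen (1 : ℝ)
    rw [e1, radon_smul _ hS, radon_real hS, integral_indicator_const _ hcl.isOpen.measurableSet,
      smul_eq_mul, mul_one]
    by_cases h3 : φ (s • ξ) = 0
    · rw [h3]
      ring
    · rw [hyperMeasure_tube hξ hi hL, mul_comm]
      have h4 := mem_vBall.1 (hC _ h3) i
      rw [Pi.smul_apply, smul_eq_mul, mul_comm, mul_mem_pBall_iff hi] at h4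
      exact h4
  have hS := indicator_mem_schwartz' hφ (isClopen_tube ξ i L)
  rw [show coordDual ξ i = W.1 from rfl, ← avg_radon hS W k a, key, avg, avg, integral_const_mul]
  ring

/-- The normalized volume is the hyperplane measure of the ball, so j may be replaced by B + v; at
that thickness the slab contains the entire ball, because 1 is in 𝔭^(B+v). -/
lemma ball_slab_volume {ξ : Fin n → F} {v B j : ℤ} (hξ : HasVal ξ v) (hB : B + v ≤ 0)
    (hj : B + v ≤ j) :
    (resCard F : ℝ) ^ j * (haarV F n).real ((vBall F n B : Set (Fin n → F)) ∩ slab ξ j 1) =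
      (resCard F : ℝ) ^ (B + v) * ((resCard F : ℝ) ^ (-B)) ^ n := by
  have hinv : ∀ x, ∀ u ∈ vBall F n B, x + u ∈ (vBall F n B : Set (Fin n → F)) ↔
      x ∈ (vBall F n B : Set (Fin n → F)) := fun x u hu => add_mem_cancel_right hu
  have hm := (isOpen_vBall (F := F) (n := n) B).measurableSet
  have h1 := hyperMeasure_real_eq (ξ := ⟨ξ, hξ.ne_zero⟩) hξ hj 1 hm hinv
  have h2 := hyperMeasure_real_eq (ξ := ⟨ξ, hξ.ne_zero⟩) hξ le_rfl 1 hm hinv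
  rw [← h1, h2, ← haarV_real_vBall]
  congr 2
  refine Set.inter_eq_left.2 fun x hx => ?_
  have h3 := dot_mem_pBall (hξ.mem_iff.2 le_rfl) hx
  rw [add_comm] at h3
  exact sub_mem h3 (pBall_anti hB (mem_pBall_zero.2 (one_mem _)))

/-- The contribution of one shell of the kernel of `β` to `M A_β φ`. -/
lemma setIntegral_pop_succ_sub {ξ : Fin n → F} {v l B C j k : ℤ} {i : Fin n} (hξ : HasVal ξ v)
    (hi : absV (ξ i) = (resCard F : ℝ≥0) ^ (-v)) {φ : (Fin n → F) → ℝ}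
    (hφ : φ ∈ schwartz (Fin n → F) ℝ) (hl : ∀ x, ∀ u ∈ vBall F n l, φ (x + u) = φ x)
    (hC : ∀ x, φ x ≠ 0 → x ∈ vBall F n C) (hBl : l ≤ k + 1 - B) (hBC : C ≤ k + 1 - B)
    (hj : k + 1 ≤ j + C - v) (a : F) :
    ∫ x, ((vBall F n B : Set (Fin n → F)) ∩ slab ξ j 1).indicator (fun _ => (1 : ℝ)) x *
        pop (k + 1) a φ x ∂(haarV F n) -
      ∫ x, ((vBall F n B : Set (Fin n → F)) ∩ slab ξ j 1).indicator (fun _ => (1 : ℝ)) x *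
        pop k a φ x ∂(haarV F n) =
    (haarV F n).real ((vBall F n B : Set (Fin n → F)) ∩ slab ξ j 1) *
      ((resCard F : ℝ) ^ (k + 1 - B - v) * ((resCard F : ℝ) ^ (-(k + 1 - B))) ^ n) *
      (avg (k + 1) a (fun s => φ (s • ξ)) - avg k a fun s => φ (s • ξ)) := by
  classical
  set S := (vBall F n B : Set (Fin n → F)) ∩ slab ξ j 1 with hS
  have hφi := schwartz_integrable_haarV hφ
  have hSi : Integrable (S.indicator fun _ => (1 : ℝ)) (haarV F n) :=
    schwartz_integrable_haarV (indicator_const_mem_schwartz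
      ((isCompact_vBall B).inter_right (isClopen_slab ξ j 1).isClosed)
      ((isOpen_vBall B).inter (isClopen_slab ξ j 1).isOpen) 1)
  -- Symmetry moves the slab operators onto the indicator of S, where they can be computed
  -- pointwise.
  rw [integral_mul_pop_comm _ a hSi hφi, integral_mul_pop_comm _ a hSi hφi,
    ← integral_sub (integrable_mul_pop _ a hφi hSi) (integrable_mul_pop _ a hφi hSi)]
  have hU := indicator_mem_schwartz' hφ (isClopen_tube ξ i (k + 1 - B))
  have hUi := schwartz_integrable_haarV hU
  have hpop : ∀ k' : ℤ, pop k' a ((tube ξ i (k + 1 - B)).indicator φ) (coordDual ξ i) =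
      (resCard F : ℝ) ^ k' * ∫ y, (slab (coordDual ξ i) k' a).indicator
        ((tube ξ i (k + 1 - B)).indicator φ) y ∂(haarV F n) := fun k' => by
    rw [pop, integral_indicator (isClopen_slab _ _ _).isOpen.measurableSet]
  have hint : ∀ k' : ℤ, Integrable ((slab (coordDual ξ i) k' a).indicator
      ((tube ξ i (k + 1 - B)).indicator φ)) (haarV F n) := fun k' =>
    hUi.indicator (isClopen_slab _ _ _).isOpen.measurableSet
  have e1 := pop_tube hξ hi hBC hBl hφ hl hC (k + 1) a
  have e2 := pop_tube hξ hi hBC hBl hφ hl hC k a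
  rw [mul_assoc ((haarV F n).real S), mul_sub, ← e1, ← e2, hpop, hpop, ← integral_const_mul,
    ← integral_const_mul, ← integral_sub ((hint _).const_mul _) ((hint _).const_mul _),
    ← integral_const_mul]
  -- Pointwise in y: in the tube both sides are multiples of the same indicators of y_i/ξ_i; off the
  -- tube thinning the slab changes nothing, so both sides vanish.
  congr 1
  ext y
  by_cases h0 : φ y = 0
  · have : (tube ξ i (k + 1 - B)).indicator φ y = 0 := by
      rw [Set.indicator_apply_eq_zero]
      exact fun _ => h0
    simp [Set.indicator_apply, h0]
  · have hyC := hC y h0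
    by_cases hy : y ∈ tube ξ i (k + 1 - B)
    · have hy' : y ∈ tube ξ i (k - B) := vBall_anti (by omega) (mem_tube.1 hy)
      rw [pop_of_mem_tube hi hyC hj hy, pop_of_mem_tube hi hyC (by omega) hy']
      have hs : ∀ k' : ℤ, (slab (coordDual ξ i) k' a).indicator
          ((tube ξ i (k + 1 - B)).indicator φ) y =
          φ y * {s : F | s - a ∈ pBall F k'}.indicator (fun _ => 1) (y i / ξ i) := by
        intro k'
        have : y ∈ slab (coordDual ξ i) k' a ↔ y i / ξ i ∈ {s : F | s - a ∈ pBall F k'} := by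
          rw [mem_slab, coordDual_dot]
          rfl
        by_cases h : y ∈ slab (coordDual ξ i) k' a
        · rw [Set.indicator_of_mem h, Set.indicator_of_mem hy, Set.indicator_of_mem (this.1 h), mul_one]
        · rw [Set.indicator_of_notMem h, Set.indicator_of_notMem (fun h' => h (this.2 h')), mul_zero]
      rw [hs, hs]
      ring
    · rw [pop_succ_of_notMem_tube hξ hi hy, ← hS]
      have : (tube ξ i (k + 1 - B)).indicator φ y = 0 := Set.indicator_of_notMem hy _
      simp [Set.indicator_apply, hy]

/-- The heart of the inversion: the k-th term of the kernel contributes exactly the difference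
between levels k + 1 and k of the averages of s ↦ φ(sξ) around 1 and 0, and these differences
telescope. -/
lemma pop_bop (hn : 2 ≤ n) {ξ : Fin n → F} {v l B C j : ℤ} {m : ℕ} (hξ : HasVal ξ v) {φ : (Fin n → F) → ℝ}
    (hφ : φ ∈ schwartz (Fin n → F) ℝ) (hl : ∀ x, ∀ u ∈ vBall F n l, φ (x + u) = φ x)
    (hC : ∀ x, φ x ≠ 0 → x ∈ vBall F n C) (hBl : B ≤ 1 - l) (hBC : B ≤ 1 - C) (hBv : B + v ≤ 0)
    (hm : l ≤ m + v) (hj : m ≤ j + C - v) (hj' : B + v ≤ j) :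
    pop j 1 ((vBall F n B : Set (Fin n → F)).indicator (bop m φ)) ξ = φ ξ - φ 0 := by
  classical
  obtain ⟨i, hi⟩ := hξ.exists_coord
  set S := (vBall F n B : Set (Fin n → F)) ∩ slab ξ j 1 with hS
  have hSi : Integrable (S.indicator fun _ => (1 : ℝ)) (haarV F n) :=
    schwartz_integrable_haarV (indicator_const_mem_schwartz
      ((isCompact_vBall B).inter_right (isClopen_slab ξ j 1).isClosed)
      ((isOpen_vBall B).inter (isClopen_slab ξ j 1).isOpen) 1)
  have e0 : pop j 1 ((vBall F n B : Set (Fin n → F)).indicator (bop m φ)) ξ =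
      (resCard F : ℝ) ^ j * ∫ x, S.indicator (fun _ => (1 : ℝ)) x * bop m φ x ∂(haarV F n) := by
    rw [pop, ← integral_indicator (isClopen_slab ξ j 1).isOpen.measurableSet]
    congr 2
    ext x
    by_cases h1 : x ∈ slab ξ j 1 <;> by_cases h2 : x ∈ (vBall F n B : Set (Fin n → F)) <;>
      simp only [Set.indicator_apply, hS, Set.mem_inter_iff, h1, h2, and_true, and_false, if_true,
        if_false, one_mul, zero_mul]
  rw [e0, integral_mul_bop m hSi (schwartz_integrable_haarV hφ), Finset.mul_sum]
  set ψ : F → ℝ := fun s => φ (s • ξ) with hψ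
  have hq := (resCard_pos F).ne'
  have hvol := ball_slab_volume hξ hBv hj'
  rw [← hS] at hvol
  have hterm : ∀ k ∈ Finset.range m, (resCard F : ℝ) ^ j * (((resCard F : ℝ) ^ (n - 1)) ^ (k + 1) *
      (((∫ x, S.indicator (fun _ => (1 : ℝ)) x * pop (k + 1) 1 φ x ∂(haarV F n)) -
          ∫ x, S.indicator (fun _ => (1 : ℝ)) x * pop (k + 1) 0 φ x ∂(haarV F n)) -
        ((∫ x, S.indicator (fun _ => (1 : ℝ)) x * pop k 1 φ x ∂(haarV F n)) -
          ∫ x, S.indicator (fun _ => (1 : ℝ)) x * pop k 0 φ x ∂(haarV F n)))) =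
      (fun k : ℕ => avg k 1 ψ - avg k 0 ψ) (k + 1) - (fun k : ℕ => avg k 1 ψ - avg k 0 ψ) k := by
    intro k hk
    have hk' := Finset.mem_range.1 hk
    have h := fun a => setIntegral_pop_succ_sub (B := B) (j := j) (k := k) hξ hi hφ hl hC (by omega)
      (by omega) (by omega) a
    rw [← hS, ← hψ] at h
    rw [sub_sub_sub_comm, h, h]
    push_cast
    -- The weight q^((n-1)(k+1)) cancels the volume of the slab times that of the tube: the
    -- exponents of q add up to 0.
    have hc : (resCard F : ℝ) ^ j * (((resCard F : ℝ) ^ (n - 1)) ^ (k + 1) * ((haarV F n).real S *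
        ((resCard F : ℝ) ^ ((k : ℤ) + 1 - B - v) * ((resCard F : ℝ) ^ (-((k : ℤ) + 1 - B))) ^ n))) = 1 := by
      calc _ = ((resCard F : ℝ) ^ j * (haarV F n).real S) * (((resCard F : ℝ) ^ (n - 1)) ^ (k + 1) *
        ((resCard F : ℝ) ^ ((k : ℤ) + 1 - B - v) * ((resCard F : ℝ) ^ (-((k : ℤ) + 1 - B))) ^ n)) := by ring
        _ = 1 := by
          rw [hvol]
          obtain ⟨d, rfl⟩ : ∃ d, n = d + 1 := ⟨n - 1, by omega⟩
          simp only [← zpow_natCast, ← zpow_mul, ← zpow_add₀ hq, Nat.add_sub_cancel]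
          refine Eq.trans (congrArg _ ?_) (zpow_zero _)
          push_cast
          ring
    linear_combination (avg ((k : ℤ) + 1) 1 ψ - avg k 1 ψ - (avg ((k : ℤ) + 1) 0 ψ - avg k 0 ψ)) * hc
  rw [Finset.sum_congr rfl hterm,
    Finset.sum_range_sub (fun k : ℕ => avg k 1 ψ - avg k 0 ψ)]
  have hinv : ∀ a, avg m a ψ = ψ a := fun a => avg_eq_of_invariant fun u hu => by
    have := smul_mem_vBall hu (hξ.mem_iff.2 le_rfl)
    simp only [hψ, add_smul]
    exact hl _ _ (vBall_anti hm this)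
  -- At level 0 the cosets of 1 and 0 are both 𝒪, so the lower end of the telescope vanishes.
  have h0 : avg ((0 : ℕ) : ℤ) 1 ψ = avg ((0 : ℕ) : ℤ) 0 ψ :=
    avg_congr (by simpa using mem_pBall_zero.2 (one_mem 𝒪[F])) ψ
  rw [hinv, hinv, h0]
  simp [hψ]

lemma Br_mem_vBall_of_ne_zero {E : Type*} [Field E] [CharZero E] (hn : 2 ≤ n) {φ : (Fin n → F) → E}
    (hφ : φ ∈ schwartz (Fin n → F) E) {l : ℤ} (hl : ∀ x, ∀ u ∈ vBall F n l, φ (x + u) = φ x)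
    {x : Fin n → F} (hx : Br φ x ≠ 0) : x ∈ vBall F n (1 - l) := by
  have h0 : x ≠ 0 := by
    rintro rfl
    simp at hx
  obtain ⟨w, hw⟩ := exists_hasVal h0
  by_contra h
  rw [hw.mem_iff] at h
  exact hx (Br_eq_zero hn hφ hl hw (by omega))

/-- `M A_β φ = φ` for real-valued test functions. -/
lemma Mr_Br_real (hn : 2 ≤ n) {φ : (Fin n → F) → ℝ} (hφ : φ ∈ schwartz (Fin n → F) ℝ) (h0 : φ 0 = 0) :
    Mr (Br φ) = φ := by
  classical
  ext ξ
  by_cases hξ0 : ξ = 0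
  · rw [hξ0, Mr_zero_right, h0]
  obtain ⟨v, hξ⟩ := exists_hasVal hξ0
  obtain ⟨l, hl⟩ := exists_vBall_invariant hφ
  obtain ⟨C, hC⟩ := exists_subset_vBall hφ.2
  obtain ⟨r, hr, hi⟩ := exists_homInv hφ
  have hC' : ∀ x, φ x ≠ 0 → x ∈ vBall F n C := fun x hx => hC hx
  have hs : ∀ x, Br φ x ≠ 0 → x ∈ vBall F n (1 - l) := fun x hx => Br_mem_vBall_of_ne_zero hn hφ hl hx
  have hf := (hi.Br hr hφ).cut_mem_schwartz hr hs (1 - v)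
  obtain ⟨l', hl'⟩ := exists_vBall_invariant hf
  -- Outside the ball of level B, A_β φ vanishes. On the slab around 1 the valuations are at most
  -- -v, so level m = l - v computes A_β φ there. Finally j makes the slab thin enough both for M at
  -- ξ and for `pop_bop`.
  set B : ℤ := min (1 - l) (min (1 - C) (-v)) with hB
  set m : ℕ := (l - v).toNat with hm
  set j : ℤ := max 1 (max (l' + v) (max (m - C + v) (B + v))) with hj
  rw [← Mr_cut _ hξ le_rfl, Mr_of_ne _ hξ0, radon_eq_pop hf hl' (ξ := ⟨ξ, hξ0⟩) (k := j) hξ (by omega)]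
  have h1 := pop_bop (j := j) (B := B) (m := m) hn hξ hφ hl hC' (by omega) (by omega) (by omega) (by omega) (by omega)
    (by omega)
  rw [h0, sub_zero] at h1
  rw [← h1, pop, pop]
  congr 1
  refine setIntegral_congr_fun (isClopen_slab ξ j 1).isOpen.measurableSet fun x hx => ?_
  have hx1 := slab_one_val hξ (by omega) hx
  have hx0 : x ≠ 0 := by
    rintro rfl
    exact hx1 (zero_mem _)
  obtain ⟨w, hw⟩ := exists_hasVal hx0
  rw [Set.indicator_of_mem (show x ∈ (vBall F n (1 - v) : Set (Fin n → F))ᶜ from hx1)]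
  rw [hw.mem_iff] at hx1
  by_cases hxB : x ∈ (vBall F n B : Set (Fin n → F))
  · rw [Set.indicator_of_mem hxB, Br_eq_bop (m := m) hn hφ hl hw (by omega)]
  · rw [Set.indicator_of_notMem hxB]
    rw [SetLike.mem_coe, hw.mem_iff] at hxB
    exact Br_eq_zero hn hφ hl hw (by omega)

end Inversion

/-! ### The second inversion formula, by symmetry of both operators. -/

section Duality

variable {F : Type*} [Field F] [ValuativeRel F] [TopologicalSpace F] [IsNonarchimedeanLocalField F]
variable {n : ℕ} [MeasurableSpace F] [BorelSpace F]

/-- `A_β M f = f` for real-valued test functions. It follows from the other inversion formula, as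
both operators are symmetric. -/
lemma Br_Mr_real (hn : 2 ≤ n) {f : (Fin n → F) → ℝ} (hf : f ∈ schwartz (Fin n → F) ℝ) (h0 : f 0 = 0)
    {r : ℕ} (hr : 1 ≤ r) (hi : HomInv r f) {x : Fin n → F} {v M : ℤ} (hx : HasVal x v)
    (hM : M + r + v ≤ 0) : Br ((vBall F n M : Set (Fin n → F)).indicator (Mr f)) x = f x := by
  classical
  obtain ⟨lf, hlf⟩ := exists_vBall_invariant hf
  obtain ⟨C, hC⟩ := exists_subset_vBall hf.2
  have hC' : ∀ y, f y ≠ 0 → y ∈ vBall F n C := fun y hy => hC hy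
  have hMi := hi.Mr hr hC'
  have hMd : ∀ y ∈ vBall F n (1 - C), Mr f y = 0 := fun y hy => Mr_eq_zero hC' hy
  -- a small ball around `x`
  set P : Set (Fin n → F) := {y | y - x ∈ vBall F n (v + r)} with hP
  have hPo : IsClopen P := IsClopen.preimage ⟨isClosed_vBall _, isOpen_vBall _⟩
    (continuous_id.sub continuous_const : Continuous fun y : Fin n → F => y - x)
  have hPc : IsCompact P := by
    refine (isCompact_vBall v).of_isClosed_subset hPo.isClosed fun y hy => ?_
    have := add_mem (vBall_anti (by omega : v ≤ v + r) hy) (hx.mem_iff.2 le_rfl)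
    rwa [sub_add_cancel] at this
  have hPx : ∀ {k : (Fin n → F) → ℝ}, HomInv r k → ∀ y ∈ P, k y = k x := fun hk y hy => by
    have := hk x v hx _ hy
    rwa [add_sub_cancel] at this
  set g : (Fin n → F) → ℝ := P.indicator fun _ => 1 with hg
  have hgs : g ∈ schwartz (Fin n → F) ℝ := indicator_const_mem_schwartz hPc hPo.isOpen 1
  have hg0 : g 0 = 0 := by
    refine Set.indicator_of_notMem (fun h => ?_) _
    have h1 : 0 - x ∈ vBall F n (v + r) := h
    rw [zero_sub, neg_mem_iff, hx.mem_iff] at h1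
    omega
  obtain ⟨lg, hlg⟩ := exists_vBall_invariant hgs
  obtain ⟨rg, hrg, hgi⟩ := exists_homInv hgs
  have hBg : ∀ y, Br g y ≠ 0 → y ∈ vBall F n (1 - lg) := fun y hy => Br_mem_vBall_of_ne_zero hn hgs hlg hy
  -- The truncation of M f must contain the support of A_β g; enlarging the lattice from M to B does
  -- not change the value at x.
  set B : ℤ := min M (1 - lg) with hB
  rw [← Br_indicator_eq hn hMi hMd (isOpen_vBall B) (isCompact_vBall B)
    (vBall_anti (min_le_left _ _ : B ≤ M)) hx hM]
  set h : (Fin n → F) → ℝ := (vBall F n B : Set (Fin n → F)).indicator (Mr f) with hh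
  have hhs : h ∈ schwartz (Fin n → F) ℝ := indicator_mem_schwartz_of_isLocallyConstant
    (hMi.isLocallyConstant hMd) ⟨isClosed_vBall B, isOpen_vBall B⟩ (isCompact_vBall B)
  have hhi : HomInv r h := hMi.indicator hr (vBall_hom B)
  obtain ⟨lh, hlh⟩ := exists_vBall_invariant hhs
  -- M f vanishes on the removed ball, and M at points of the support of f does not see it. So u
  -- replaces A_β g on both sides and is a test function.
  set u : (Fin n → F) → ℝ := (vBall F n (1 - C) : Set (Fin n → F))ᶜ.indicator (Br g) with hu
  have hus : u ∈ schwartz (Fin n → F) ℝ := (hgi.Br hrg hgs).cut_mem_schwartz hrg hBg (1 - C)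
  have hC2 : ∀ y, u y ≠ 0 → y ∈ vBall F n (1 - lg) := fun y hy => hBg y fun h0 => hy <| by
    rw [hu, Set.indicator_apply_eq_zero]
    exact fun _ => h0
  obtain ⟨lu, hlu⟩ := exists_vBall_invariant hus
  -- One level that computes A_β h on P, where the valuation is v, and A_β g wherever M f can be
  -- nonzero, where it is at most -C.
  set m : ℕ := (max (lh + v) (lg - C)).toNat with hm
  set j : ℤ := max 1 (max (lf - C) (lu - (1 - lg))) with hj
  have e1 : ∀ y, g y * bop m h y = g y * Br h x := fun y => by
    by_cases hy : y ∈ P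
    · have hyv : HasVal y v := by
        have := hx.add (vBall_anti (by omega) (show y - x ∈ vBall F n (v + r) from hy) :
          y - x ∈ vBall F n (v + 1))
        rwa [add_sub_cancel] at this
      rw [← Br_eq_bop (m := m) hn hhs hlh hyv (by omega), hPx (hhi.Br hr hhs) y hy]
    · rw [hg, Set.indicator_of_notMem hy, zero_mul, zero_mul]
  have e2 : ∀ y, h y * bop m g y = u y * Mr f y := fun y => by
    by_cases h1 : y ∈ vBall F n (1 - C)
    · rw [hMd y h1, mul_zero, mul_eq_zero]
      left
      rw [hh, Set.indicator_apply_eq_zero]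
      exact fun _ => hMd y h1
    · have hy0 : y ≠ 0 := by
        rintro rfl
        exact h1 (zero_mem _)
      obtain ⟨w, hw⟩ := exists_hasVal hy0
      have h2 := h1
      rw [hw.mem_iff] at h2
      rw [hu, Set.indicator_of_mem (show y ∈ (vBall F n (1 - C) : Set (Fin n → F))ᶜ from h1),
        ← Br_eq_bop (m := m) hn hgs hlg hw (by omega)]
      by_cases h3 : Br g y = 0
      · rw [h3, mul_zero, zero_mul]
      · rw [hh, Set.indicator_of_mem (vBall_anti (by omega) (hBg y h3)), mul_comm]
  have e3 : ∀ y, f y * Mr u y = f y * g y := fun y => by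
    by_cases h1 : f y = 0
    · rw [h1, zero_mul, zero_mul]
    · have hy0 : y ≠ 0 := by
        rintro rfl
        exact h1 h0
      obtain ⟨w, hw⟩ := exists_hasVal hy0
      have h2 := hC' y h1
      rw [hw.mem_iff] at h2
      rw [hu, Mr_cut _ hw (by omega), Mr_Br_real hn hgs hg0]
  have e4 : ∀ y, f y * g y = g y * f x := fun y => by
    by_cases hy : y ∈ P
    · rw [hPx hi y hy, mul_comm]
    · rw [hg, Set.indicator_of_notMem hy, zero_mul, mul_zero]
  have hgi' := schwartz_integrable_haarV hgs
  -- The kernel of β is moved from h to g, then that of M from f to u, and M A_β g = g is used on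
  -- the support of f.
  have key : ∫ y, g y * Br h x ∂(haarV F n) = ∫ y, g y * f x ∂(haarV F n) := calc
    _ = ∫ y, g y * bop m h y ∂(haarV F n) := by simp only [e1]
    _ = ∫ y, h y * bop m g y ∂(haarV F n) :=
      integral_mul_bop_comm m hgi' (schwartz_integrable_haarV hhs)
    _ = ∫ y, u y * pop j 1 f y ∂(haarV F n) := by
      simp only [e2, Mr_eq_pop hf hlf hC' (by omega : 1 ≤ j) (by omega)]
    _ = ∫ y, f y * pop j 1 u y ∂(haarV F n) :=
      integral_mul_pop_comm j 1 (schwartz_integrable_haarV hus) (schwartz_integrable_haarV hf)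
    _ = ∫ y, g y * f x ∂(haarV F n) := by
      simp only [← Mr_eq_pop hus hlu hC2 (by omega : 1 ≤ j) (by omega), e3, e4]
  rw [integral_mul_const, integral_mul_const] at key
  refine mul_left_cancel₀ ?_ key
  rw [hg, integral_indicator_const _ hPo.isOpen.measurableSet, smul_eq_mul, mul_one]
  refine (ENNReal.toReal_pos (hPo.isOpen.measure_pos _ ⟨x, ?_⟩).ne' (haarV_ne_top hPc)).ne'
  show x - x ∈ vBall F n (v + r)
  rw [sub_self]
  exact zero_mem _

end Duality

/-! ### The inversion formulas with arbitrary coefficients -/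

section Coefficients

variable {F : Type*} [Field F] [ValuativeRel F] [TopologicalSpace F] [IsNonarchimedeanLocalField F]
variable {n : ℕ} {E : Type*} [Field E]

/-- Test functions vanishing at the origin are sums of multiples of indicator functions. -/
lemma schwartz_induction {P : ((Fin n → F) → E) → Prop} (zero : P 0)
    (add : ∀ f g, f ∈ schwartz (Fin n → F) E → g ∈ schwartz (Fin n → F) E → P f → P g → P (f + g))
    (smul : ∀ (c : E) f, f ∈ schwartz (Fin n → F) E → P f → P (c • f))
    (indicator : ∀ A : Set (Fin n → F), IsCompact A → IsOpen A → (0 : Fin n → F) ∉ A →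
      P (A.indicator fun _ => 1)) {f : (Fin n → F) → E} (hf : f ∈ schwartz (Fin n → F) E)
    (h0 : f 0 = 0) : P f := by
  classical
  obtain ⟨T, hT0, hT, hfT⟩ := schwartz_decomp hf
  have hmem : ∀ e ∈ T, e • (f ⁻¹' {e}).indicator (fun _ => (1 : E)) ∈ schwartz (Fin n → F) E :=
    fun e he => Submodule.smul_mem _ _ (indicator_const_mem_schwartz (hT e he).1 (hT e he).2 1)
  have hP : ∀ e ∈ T, P (e • (f ⁻¹' {e}).indicator fun _ => (1 : E)) := fun e he => by
    refine smul e _ (indicator_const_mem_schwartz (hT e he).1 (hT e he).2 1)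
      (indicator _ (hT e he).1 (hT e he).2 fun h => hT0 ?_)
    rwa [← h0, show f 0 = e from h]
  have key : ∀ S ⊆ T, P (∑ e ∈ S, e • (f ⁻¹' {e}).indicator fun _ => (1 : E)) := by
    intro S
    induction S using Finset.induction_on with
    | empty => exact fun _ => by simpa using zero
    | insert a S ha ih =>
      intro hS
      rw [Finset.sum_insert ha]
      exact add _ _ (hmem a (hS (Finset.mem_insert_self a S)))
        (Submodule.sum_mem _ fun e he => hmem e (hS (Finset.mem_insert_of_mem he)))
        (hP a (hS (Finset.mem_insert_self a S))) (ih ((Finset.subset_insert a S).trans hS))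
  rw [hfT]
  exact key T subset_rfl

variable [CharZero E] [MeasurableSpace F] [BorelSpace F]

/-- The functions need not extend to the origin as test functions; at each ξ a suitable cut,
invisible to M, makes them so. -/
lemma Mr_add_of_cut {f g : (Fin n → F) → E}
    (hf : ∀ k, (vBall F n k : Set (Fin n → F))ᶜ.indicator f ∈ schwartz (Fin n → F) E)
    (hg : ∀ k, (vBall F n k : Set (Fin n → F))ᶜ.indicator g ∈ schwartz (Fin n → F) E) :
    Mr (f + g) = Mr f + Mr g := by
  ext ξ
  by_cases h0 : ξ = 0
  · simp [h0]
  · obtain ⟨v, hv⟩ := exists_hasVal h0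
    rw [Pi.add_apply, ← Mr_cut (f + g) hv le_rfl, ← Mr_cut f hv le_rfl, ← Mr_cut g hv le_rfl,
      Set.indicator_add', Mr_add (hf _) (hg _), Pi.add_apply]

lemma Mr_smul_of_cut (c : E) {f : (Fin n → F) → E}
    (hf : ∀ k, (vBall F n k : Set (Fin n → F))ᶜ.indicator f ∈ schwartz (Fin n → F) E) :
    Mr (c • f) = c • Mr f := by
  ext ξ
  by_cases h0 : ξ = 0
  · simp [h0]
  · obtain ⟨v, hv⟩ := exists_hasVal h0
    rw [Pi.smul_apply, ← Mr_cut (c • f) hv le_rfl, ← Mr_cut f hv le_rfl]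
    have : (vBall F n (1 - v) : Set (Fin n → F))ᶜ.indicator (c • f) =
        c • (vBall F n (1 - v) : Set (Fin n → F))ᶜ.indicator f := Set.indicator_const_smul _ c f
    rw [this, Mr_smul _ (hf _), Pi.smul_apply]

lemma Br_cut_mem_schwartz (hn : 2 ≤ n) {φ : (Fin n → F) → E} (hφ : φ ∈ schwartz (Fin n → F) E)
    (k : ℤ) : (vBall F n k : Set (Fin n → F))ᶜ.indicator (Br φ) ∈ schwartz (Fin n → F) E := by
  obtain ⟨r, hr, hi⟩ := exists_homInv hφ
  obtain ⟨l, hl⟩ := exists_vBall_invariant hφ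
  exact (hi.Br hr hφ).cut_mem_schwartz hr (fun x hx => Br_mem_vBall_of_ne_zero hn hφ hl hx) k

lemma indicator_one_map {K K' X : Type*} [Field K] [Field K'] (σ : K →+* K') (A : Set X) :
    (A.indicator fun _ => (1 : K')) = σ ∘ A.indicator fun _ => (1 : K) := by
  classical
  ext x
  by_cases hx : x ∈ A <;> simp [hx]

/-- `M A_β φ = φ` for test functions. -/
lemma Mr_Br (hn : 2 ≤ n) {φ : (Fin n → F) → E} (hφ : φ ∈ schwartz (Fin n → F) E) (h0 : φ 0 = 0) :
    Mr (Br φ) = φ := by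
  refine schwartz_induction (P := fun φ => Mr (Br φ) = φ) ?_ (fun f g hf hg ihf ihg => ?_)
    (fun c f hf ih => ?_) (fun A h1 h2 h0 => ?_) hφ h0
  · rw [Br_zero hn, Mr_zero]
  · rw [Br_add hn hf hg, Mr_add_of_cut (Br_cut_mem_schwartz hn hf) (Br_cut_mem_schwartz hn hg), ihf, ihg]
  · rw [Br_smul hn c hf, Mr_smul_of_cut c (Br_cut_mem_schwartz hn hf), ih]
  -- The indicator has rational values: the identity over ℝ descends to ℚ by injectivity of ℚ → ℝ
  -- and is then mapped to E.
  · rw [indicator_one_map (Rat.castHom E) A, Br_map, Mr_map]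
    congr 1
    have h := Mr_Br_real hn (indicator_const_mem_schwartz h1 h2 (1 : ℝ))
      (Set.indicator_of_notMem h0 _)
    rw [indicator_one_map (Rat.castHom ℝ) A, Br_map, Mr_map] at h
    exact (Rat.castHom ℝ).injective.comp_left h

lemma cut_Mr_mem_schwartz {f : (Fin n → F) → E} (hf : f ∈ schwartz (Fin n → F) E) (M : ℤ) :
    (vBall F n M : Set (Fin n → F)).indicator (Mr f) ∈ schwartz (Fin n → F) E := by
  obtain ⟨r, hr, hi⟩ := exists_homInv hf
  obtain ⟨C, hC⟩ := exists_subset_vBall hf.2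
  exact indicator_mem_schwartz_of_isLocallyConstant ((hi.Mr hr fun x hx => hC hx).isLocallyConstant
    fun y hy => Mr_eq_zero (fun x hx => hC hx) hy) ⟨isClosed_vBall M, isOpen_vBall M⟩ (isCompact_vBall M)

/-- `A_β M f = f` for test functions vanishing at the origin. -/
lemma Br_Mr_schwartz (hn : 2 ≤ n) {f : (Fin n → F) → E} (hf : f ∈ schwartz (Fin n → F) E)
    (h0 : f 0 = 0) {r : ℕ} (hr : 1 ≤ r) (hi : HomInv r f) {x : Fin n → F} {v M : ℤ} (hx : HasVal x v)
    (hM : M + r + v ≤ 0) : Br ((vBall F n M : Set (Fin n → F)).indicator (Mr f)) x = f x := by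
  -- The summands of f have their own radii of invariance, so the induction only gives some
  -- threshold; `Br_indicator_eq` then recovers the stated one.
  have key : ∃ M₀ : ℤ, ∀ M ≤ M₀, Br ((vBall F n M : Set (Fin n → F)).indicator (Mr f)) x = f x := by
    refine schwartz_induction (P := fun f => ∃ M₀ : ℤ, ∀ M ≤ M₀,
      Br ((vBall F n M : Set (Fin n → F)).indicator (Mr f)) x = f x) ?_ (fun f g hf hg ihf ihg => ?_)
      (fun c f hf ih => ?_) (fun A h1 h2 h0 => ?_) hf h0
    · exact ⟨0, fun M _ => by rw [Mr_zero, Set.indicator_zero', Br_zero hn]⟩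
    · obtain ⟨M₁, h1⟩ := ihf
      obtain ⟨M₂, h2⟩ := ihg
      refine ⟨min M₁ M₂, fun M hM => ?_⟩
      rw [Mr_add hf hg, Set.indicator_add', Br_add hn (cut_Mr_mem_schwartz hf M)
        (cut_Mr_mem_schwartz hg M), Pi.add_apply, h1 M (by omega), h2 M (by omega), Pi.add_apply]
    · obtain ⟨M₁, h1⟩ := ih
      refine ⟨M₁, fun M hM => ?_⟩
      have : (vBall F n M : Set (Fin n → F)).indicator (c • Mr f) =
        c • (vBall F n M : Set (Fin n → F)).indicator (Mr f) := Set.indicator_const_smul _ c _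
      rw [Mr_smul c hf, this, Br_smul hn c (cut_Mr_mem_schwartz hf M), Pi.smul_apply, h1 M hM,
        Pi.smul_apply]
    · have hA := indicator_const_mem_schwartz h1 h2 (1 : ℝ)
      obtain ⟨s, hs, hsi⟩ := exists_homInv hA
      refine ⟨-s - v, fun M hM => ?_⟩
      have h := Br_Mr_real hn hA (Set.indicator_of_notMem h0 _) hs hsi hx (by omega : M + s + v ≤ 0)
      rw [indicator_one_map (Rat.castHom ℝ) A, Mr_map,
        Set.indicator_comp_of_zero (map_zero (Rat.castHom ℝ)), Br_map] at h
      rw [indicator_one_map (Rat.castHom E) A, Mr_map,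
        Set.indicator_comp_of_zero (map_zero (Rat.castHom E)), Br_map, Function.comp_apply,
        (Rat.castHom ℝ).injective h, Function.comp_apply]
  obtain ⟨M₀, h⟩ := key
  obtain ⟨C, hC⟩ := exists_subset_vBall hf.2
  rw [← h (min M M₀) (min_le_right _ _)]
  exact (Br_indicator_eq hn (hi.Mr hr fun x hx => hC hx) (d := 1 - C)
    (fun y hy => Mr_eq_zero (fun x hx => hC hx) hy) (isOpen_vBall _) (isCompact_vBall _)
    (vBall_anti (min_le_left _ _)) hx hM).symm

/-- `A_β M f = f` for functions with bounded support. -/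
lemma Br_Mr (hn : 2 ≤ n) {f : (Fin n → F) → E} {r : ℕ} (hr : 1 ≤ r) (hi : HomInv r f) {C : ℤ}
    (hC : ∀ x, f x ≠ 0 → x ∈ vBall F n C) {x : Fin n → F} {v M : ℤ} (hx : HasVal x v)
    (hM : M + r + v ≤ 0) : Br ((vBall F n M : Set (Fin n → F)).indicator (Mr f)) x = f x := by
  -- Removing the ball of level k changes neither M f on the ball of level M nor the value of f at
  -- x.
  set k : ℤ := max (1 - M) (v + 1) with hk
  have h1 : (vBall F n M : Set (Fin n → F)).indicator (Mr f) =
      (vBall F n M : Set (Fin n → F)).indicator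
        (Mr ((vBall F n k : Set (Fin n → F))ᶜ.indicator f)) := by
    refine Set.indicator_congr fun ξ hξ => ?_
    by_cases h0 : ξ = 0
    · simp [h0]
    · obtain ⟨w, hw⟩ := exists_hasVal h0
      rw [SetLike.mem_coe, hw.mem_iff] at hξ
      exact (Mr_cut f hw (by omega)).symm
  have h2 : x ∈ (vBall F n k : Set (Fin n → F))ᶜ := fun h => by
    rw [SetLike.mem_coe, hx.mem_iff] at h
    omega
  rw [h1, Br_Mr_schwartz hn (hi.cut_mem_schwartz hr hC k)
    (Set.indicator_of_notMem (Set.notMem_compl_iff.2 (zero_mem (vBall F n k))) f) hr (hi.indicator hr (vBall_compl_hom k)) hx hM,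
    Set.indicator_of_mem h2]

end Coefficients

/-! ### The operators `M` and `A_β` -/

section Operators

variable {F : Type*} [Field F] [ValuativeRel F] [TopologicalSpace F] [IsNonarchimedeanLocalField F]
variable {n : ℕ} {E : Type*} [Field E] [CharZero E] [MeasurableSpace F] [BorelSpace F]

lemma extZero_add (φ ψ : Punctured F n → E) : extZero (φ + ψ) = extZero φ + extZero ψ := by
  ext x
  by_cases hx : x = 0
  · simp [hx]
  · simp [extZero_of_ne hx]

lemma extZero_smul (c : E) (φ : Punctured F n → E) : extZero (c • φ) = c • extZero φ := by
  ext x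
  by_cases hx : x = 0
  · simp [hx]
  · simp [extZero_of_ne hx]

lemma extZero_opM (f : Punctured F n → E) : extZero (opM f) = Mr (extZero f) := rfl

lemma opM_mem_Cminus {f : Punctured F n → E} (hf : f ∈ Cplus F n E) : opM f ∈ Cminus F n E := by
  obtain ⟨⟨r, hr, hi⟩, C, hC⟩ := mem_Cplus_iff.1 hf
  exact mem_Cminus_iff.2 ⟨⟨r, hr, hi.Mr hr hC⟩, 1 - C, fun y hy => Mr_eq_zero hC hy⟩

lemma Cplus_cut_mem_schwartz {f : Punctured F n → E} (hf : f ∈ Cplus F n E) (k : ℤ) :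
    (vBall F n k : Set (Fin n → F))ᶜ.indicator (extZero f) ∈ schwartz (Fin n → F) E := by
  obtain ⟨⟨r, hr, hi⟩, C, hC⟩ := mem_Cplus_iff.1 hf
  exact hi.cut_mem_schwartz hr hC k

/-- The operator `M` as a linear map `C₊ → C₋`. -/
def linM : Cplus F n E →ₗ[E] Cminus F n E where
  toFun f := ⟨opM f.1, opM_mem_Cminus f.2⟩
  map_add' f g := Subtype.ext <| extZero_injective <| by
    show Mr (extZero (f.1 + g.1)) = extZero (opM f.1 + opM g.1)
    rw [extZero_add, extZero_add, Mr_add_of_cut (Cplus_cut_mem_schwartz f.2)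
      (Cplus_cut_mem_schwartz g.2)]
    rfl
  map_smul' c f := Subtype.ext <| extZero_injective <| by
    show Mr (extZero (c • f.1)) = extZero (c • opM f.1)
    rw [extZero_smul, extZero_smul, Mr_smul_of_cut c (Cplus_cut_mem_schwartz f.2)]
    rfl

lemma partialA_betaDist (hn : 2 ≤ n) (φ : Cminus F n E) (x : Punctured F n) (Λ : Lattice F n) :
    partialA (betaDist E hn) φ x Λ = Br ((Λ.1 : Set (Fin n → F)).indicator (extZero φ.1)) x.1 :=
  (Br_of_ne _ x.2).symm

/-- Any two lattices lie in a common ball, on which both stable values are attained. -/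
lemma IsRegValue.unique {β : Distribution F E} {φ : Cminus F n E} {x : Punctured F n} {c d : E}
    (hc : IsRegValue β φ x c) (hd : IsRegValue β φ x d) : c = d := by
  obtain ⟨Λ₁, h1⟩ := hc
  obtain ⟨Λ₂, h2⟩ := hd
  obtain ⟨C, hC⟩ := exists_subset_vBall (Λ₁.2.2.union Λ₂.2.2)
  rw [← h1 ⟨vBall F n C, isOpen_vBall C, isCompact_vBall C⟩ (Set.subset_union_left.trans hC)]
  exact h2 _ (Set.subset_union_right.trans hC)

lemma opA_eq {β : Distribution F E} {φ : Cminus F n E} {x : Punctured F n} {c : E}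
    (hc : IsRegValue β φ x c) : opA β φ x = c := by
  have h : ∃ c, IsRegValue β φ x c := ⟨c, hc⟩
  unfold opA
  rw [dif_pos h]
  exact h.choose_spec.unique hc

/-- The regularized integral is attained on all sufficiently large lattices. -/
lemma isRegValue_betaDist (hn : 2 ≤ n) {φ : Cminus F n E} {r : ℕ} (hi : HomInv r (extZero φ.1))
    {x : Punctured F n} {v M : ℤ} (hx : HasVal x.1 v) (hM : M + r + v ≤ 0) :
    IsRegValue (betaDist E hn) φ x
      (Br ((vBall F n M : Set (Fin n → F)).indicator (extZero φ.1)) x.1) := by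
  obtain ⟨-, d, hd⟩ := mem_Cminus_iff.1 φ.2
  refine ⟨⟨vBall F n M, isOpen_vBall M, isCompact_vBall M⟩, fun Λ hΛ => ?_⟩
  rw [partialA_betaDist]
  exact Br_indicator_eq hn hi hd Λ.2.1 Λ.2.2 hΛ hx hM

lemma extZero_opA (hn : 2 ≤ n) {φ : Cminus F n E} {r : ℕ} (hi : HomInv r (extZero φ.1))
    {x : Fin n → F} {v M : ℤ} (hx : HasVal x v) (hM : M + r + v ≤ 0) :
    extZero (opA (betaDist E hn) φ) x =
      Br ((vBall F n M : Set (Fin n → F)).indicator (extZero φ.1)) x := by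
  rw [extZero_of_ne hx.ne_zero]
  exact opA_eq (isRegValue_betaDist hn hi (x := ⟨x, hx.ne_zero⟩) hx hM)

lemma Cminus_cut_mem_schwartz (φ : Cminus F n E) (M : ℤ) :
    (vBall F n M : Set (Fin n → F)).indicator (extZero φ.1) ∈ schwartz (Fin n → F) E :=
  indicator_mem_schwartz φ ⟨vBall F n M, isOpen_vBall M, isCompact_vBall M⟩

lemma opA_mem_Cplus (hn : 2 ≤ n) (φ : Cminus F n E) : opA (betaDist E hn) φ ∈ Cplus F n E := by
  obtain ⟨⟨r, hr, hi⟩, d, hd⟩ := mem_Cminus_iff.1 φ.2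
  refine mem_Cplus_iff.2 ⟨⟨r, hr, fun x v hx u hu => ?_⟩, 1 - d - r, fun x hx => ?_⟩
  · rw [extZero_opA hn hi hx (M := -r - v) (by omega),
      extZero_opA hn hi (hx.add (vBall_anti (by omega) hu)) (M := -r - v) (by omega)]
    exact (hi.indicator hr (vBall_hom _)).Br hr (Cminus_cut_mem_schwartz φ _) x v hx u hu
  · by_cases h0 : x = 0
    · exact h0 ▸ zero_mem _
    obtain ⟨v, hv⟩ := exists_hasVal h0
    by_contra h
    rw [hv.mem_iff] at h
    refine hx ?_
    -- The first bound makes the truncation compute A_β φ at x. The second makes the ball stable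
    -- under level d + r, under which φ is invariant everywhere because it vanishes on the ball of
    -- level d.
    set M : ℤ := min (-r - v) (d + r) with hM
    have hinv : ∀ y, ∀ u ∈ vBall F n (d + r), extZero φ.1 (y + u) = extZero φ.1 y := by
      intro y u hu
      by_cases hy : y ∈ vBall F n d
      · rw [hd y hy, hd _ (add_mem hy (vBall_anti (by omega) hu))]
      · have hy0 : y ≠ 0 := by
          rintro rfl
          exact hy (zero_mem _)
        obtain ⟨w, hw⟩ := exists_hasVal hy0
        rw [hw.mem_iff] at hy
        exact hi y w hw u (vBall_anti (by omega) hu)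
    rw [extZero_opA hn hi hv (M := M) (by omega)]
    refine Br_eq_zero hn (Cminus_cut_mem_schwartz φ M) (l := d + r) (fun y u hu => ?_) hv (by omega)
    have hyu : y + u ∈ vBall F n M ↔ y ∈ vBall F n M := add_mem_cancel_right (vBall_anti (by omega) hu)
    by_cases hy : y ∈ (vBall F n M : Set (Fin n → F))
    · rw [Set.indicator_of_mem hy, Set.indicator_of_mem (hyu.2 hy), hinv y u hu]
    · rw [Set.indicator_of_notMem hy, Set.indicator_of_notMem fun h => hy (hyu.1 h)]

lemma opA_opM (hn : 2 ≤ n) (f : Cplus F n E) : opA (betaDist E hn) (linM f) = f.1 := by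
  obtain ⟨⟨r, hr, hi⟩, C, hC⟩ := mem_Cplus_iff.1 f.2
  refine extZero_injective (funext fun x => ?_)
  by_cases h0 : x = 0
  · simp [h0]
  obtain ⟨v, hv⟩ := exists_hasVal h0
  rw [extZero_opA hn (φ := linM f) (hi.Mr hr hC) hv (M := -r - v) (by omega)]
  exact Br_Mr hn hr hi hC hv (by omega)

lemma opM_opA (hn : 2 ≤ n) (φ : Cminus F n E) : opM (opA (betaDist E hn) φ) = φ.1 := by
  obtain ⟨⟨r, hr, hi⟩, d, hd⟩ := mem_Cminus_iff.1 φ.2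
  refine extZero_injective (funext fun ξ => ?_)
  by_cases h0 : ξ = 0
  · simp [h0]
  obtain ⟨v, hv⟩ := exists_hasVal h0
  -- M at ξ only sees y of valuation at most -v, so one truncation computes A_β φ at all of them; M
  -- ≤ v keeps ξ inside the truncating ball.
  set M : ℤ := min (v - r) v with hM
  have hg : (vBall F n M : Set (Fin n → F)).indicator (extZero φ.1) 0 = 0 := by
    rw [Set.indicator_apply_eq_zero]
    exact fun _ => extZero_zero _
  rw [extZero_opM, Mr_congr (g := Br ((vBall F n M : Set (Fin n → F)).indicator (extZero φ.1))) hv,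
    Mr_Br hn (Cminus_cut_mem_schwartz φ M) hg, Set.indicator_of_mem]
  · exact hv.mem_iff.2 (by omega)
  · intro y hy
    have hy0 : y ≠ 0 := by
      rintro rfl
      exact hy (zero_mem _)
    obtain ⟨w, hw⟩ := exists_hasVal hy0
    rw [hw.mem_iff] at hy
    exact extZero_opA hn hi hw (by omega)

/-- The isomorphism `M : C₊ → C₋` with inverse `A_β`. -/
def equivM (hn : 2 ≤ n) : Cplus F n E ≃ₗ[E] Cminus F n E :=
  { linM with
    invFun := fun φ => ⟨opA (betaDist E hn) φ, opA_mem_Cplus hn φ⟩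
    left_inv := fun f => Subtype.ext (opA_opM hn f)
    right_inv := fun φ => Subtype.ext (opM_opA hn φ) }

end Operators

end RadonLocal

end

theorem theorem3p6 (F : Type*) [Field F] [ValuativeRel F] [TopologicalSpace F]
    [IsNonarchimedeanLocalField F] [MeasurableSpace F] [BorelSpace F]
    (E : Type*) [Field E] [CharZero E] (n : ℕ) (hn : 2 ≤ n) :
    ∃ β : RadonLocal.Distribution F E,
      -- `β` is the distribution given by the formula,
      (∀ f : RadonLocal.schwartz F E, β f = RadonLocal.betaValue n f.1) ∧
      -- it has compact support and total mass zero,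
      (∃ S : Set F, IsCompact S ∧
        (∀ f : RadonLocal.schwartz F E, (∀ s ∈ S, f.1 s = 0) → β f = 0) ∧
        (∀ f : RadonLocal.schwartz F E, (∀ s ∈ S, f.1 s = 1) → β f = 0)) ∧
      -- `M` is an isomorphism from `C₊` to `C₋`, the regularized integrals defining `A_β φ`
      -- exist, and `A_β` is the inverse of `M`.
      ∃ M : RadonLocal.Cplus F n E ≃ₗ[E] RadonLocal.Cminus F n E,
        (∀ f, (M f).1 = RadonLocal.opM f.1) ∧
        ∀ φ : RadonLocal.Cminus F n E,
          (∀ x, RadonLocal.IsRegValue β φ x (RadonLocal.opA β φ x)) ∧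
          (M.symm φ).1 = RadonLocal.opA β φ := by
  -- With S = 𝒪, compact support and zero mass are two cases of β killing functions that are
  -- constant on 𝒪.
  refine ⟨RadonLocal.betaDist E hn, fun f => rfl, ⟨_, RadonLocal.isCompact_pBall (F := F) 0, ?_, ?_⟩,
    RadonLocal.equivM hn, fun f => rfl, fun φ => ⟨fun x => ?_, rfl⟩⟩
  · exact fun f hf => RadonLocal.betaValue_eq_zero hn f.2 fun s hs => by
      rw [hf s hs, hf 0 (zero_mem _)]
  · exact fun f hf => RadonLocal.betaValue_eq_zero hn f.2 fun s hs => by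
      rw [hf s hs, hf 0 (zero_mem _)]
  · obtain ⟨⟨r, -, hi⟩, -⟩ := RadonLocal.mem_Cminus_iff.1 φ.2
    obtain ⟨v, hv⟩ := RadonLocal.exists_hasVal x.2
    have h := RadonLocal.isRegValue_betaDist hn hi hv (M := -r - v) (by omega)
    rwa [RadonLocal.opA_eq h]
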